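/- Let $n\in\mathbb N$, $\nu_1>0$, $\sigma>0$. On $\mathbb C^4$ with coordinates $(\xi,\eta)=(\xi_1,\xi_2,\eta_1,\eta_2)$, the Hamiltonian equations of a (time-dependent) function $h$ are $\dot\xi_j=-i\,\partial h/\partial\eta_j$, $\dot\eta_j=i\,\partial h/\partial\xi_j$, $j=1,2$. A state $(\xi,\eta)$ is called real if it is fixed by the involution $(\xi_1,\eta_1,\xi_2,\eta_2)\mapsto(\bar\eta_1,\bar\xi_1,\bar\xi_2,\overline{\xi_2-\eta_2})$, i.e. if $\eta_1=\bar\xi_1$, $\xi_2\in\mathbb R$ and $2\operatorname{Re}\eta_2=\xi_2$. Let $q(\theta,\xi_1,\eta_1,\xi_2)$ be a homogeneous polynomial of degree $2$ in $(\xi_1,\eta_1,\xi_2)$ (so independent of $\eta_2$), whose coefficients are $2\pi$-periodic in each $\theta_j$ and analytic in the complex strip $\{\theta\in\mathbb C^n:|\operatorname{Im}\theta_j|\le\sigma\ \text{for all } j\}$, and which takes real values when $\theta\in\mathbb R^n$ and $(\xi,\eta)$ is real. Consider $$h_\varepsilon(t,\xi,\eta)=\nu_1\xi_1\eta_1+\varepsilon\,q(\omega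 t,\xi_1,\eta_1,\xi_2).$$ Then there exist $\varepsilon_*>0$, $C>0$ (depending on $n,\nu_1,\sigma,q$ only) and, for every $\omega$, a constant $K_\omega$ independent of $\varepsilon$, such that for every real $\varepsilon$ with $|\varepsilon|<\varepsilon_*$ there is a Borel set $\mathcal E_\varepsilon\subset(0,2\pi]^n$ with $$\operatorname{meas}\big((0,2\pi]^n\setminus\mathcal E_\varepsilon\big)\le C|\varepsilon|^{1/9},$$ and for every $\omega\in\mathcal E_\varepsilon$ there are a real-analytic map $\theta\mapsto A_\omega(\theta)\in\mathrm{sp}(2)$ on $\mathbb R^n$, $2\pi$-periodic in each $\theta_j$ (where $\mathrm{sp}(2)$ denotes the complex $4\times4$ matrices $A$ with $A^{T}J+JA=0$, $J$ the standard symplectic matrix), and real numbers $\nu_1(\varepsilon),c(\varepsilon)$ (depending also on $\omega$) such that the change of coordinates $(\xi',\eta')=e^{A_\omega(\omega t)}(\xi,\eta)$ conjugates the Hamiltonian equations of $h_\varepsilon$ to those of $$h_\infty(\xi,\eta)=\nu_1(\varepsilon)\,\xi_1\eta_1+c(\varepsilon)\,\xi_2^2,\qquad |\nu_1(\varepsilon)-\nu_1|\le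 C|\varepsilon|,\quad |c(\varepsilon)|\le C|\varepsilon|.$$ Moreover $A_\omega$ is $\varepsilon$-close to zero: all entries of $A_\omega(\theta)$, $\theta\in\mathbb R^n$, are bounded in modulus by $K_\omega|\varepsilon|$, and also, uniformly in $\omega\in\mathcal E_\varepsilon$, by $C|\varepsilon|^{1/2}$. Finally, for every $\theta\in\mathbb R^n$ the map $e^{A_\omega(\theta)}$ maps real states to real states. -/

import Mathlib

open Matrix

/-- The phase space `ℂ⁴` with coordinates `(ξ₁, ξ₂, η₁, η₂)`:
`ξ_j` is the coordinate `Sum.inl (j - 1)` and `η_j` the coordinate `Sum.inr (j - 1)`. -/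
abbrev PhaseSpace : Type := Fin 2 ⊕ Fin 2 → ℂ

/-- The complex strip `{θ ∈ ℂⁿ : |Im θ_j| ≤ σ for all j}`; the complexified torus `𝕋ⁿ_σ` is its
quotient by `2πℤⁿ`, and functions on the torus are `2π`-periodic functions. -/
def strip (n : ℕ) (σ : ℝ) : Set (Fin n → ℂ) := {θ | ∀ j, |(θ j).im| ≤ σ}

/-- The inclusion of `ℝⁿ` into `ℂⁿ`. -/
def toComplexVec {n : ℕ} (θ : Fin n → ℝ) : Fin n → ℂ := fun j => (θ j : ℂ)

/-- The involution `(ξ₁, ξ₂, η₁, η₂) ↦ (conj η₁, conj ξ₂, conj ξ₁, conj (ξ₂ - η₂))`. -/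
noncomputable def realInvolution (z : PhaseSpace) : PhaseSpace :=
  Sum.elim
    ![starRingEnd ℂ (z (Sum.inr 0)), starRingEnd ℂ (z (Sum.inl 1))]
    ![starRingEnd ℂ (z (Sum.inl 0)), starRingEnd ℂ (z (Sum.inl 1) - z (Sum.inr 1))]

/-- The real states: `η₁ = conj ξ₁`, `ξ₂` is real and `2 Re η₂ = ξ₂`. -/
def IsRealState (z : PhaseSpace) : Prop := realInvolution z = z

/-- Quadratic perturbations: `q θ` is a homogeneous polynomial of degree two in `(ξ₁, η₁, ξ₂)`,
not containing `η₂`, whose coefficients are functions on the torus that are analytic in the strip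
of width `σ`, and which takes real values at real states for real angles. -/
structure IsQuadraticPerturbation {n : ℕ} (σ : ℝ)
    (q : (Fin n → ℂ) → MvPolynomial (Fin 2 ⊕ Fin 2) ℂ) : Prop where
  homogeneous : ∀ θ ∈ strip n σ, (q θ).IsHomogeneous 2
  indep_eta₂ : ∀ θ ∈ strip n σ, Sum.inr 1 ∉ (q θ).vars
  analytic : ∀ m : (Fin 2 ⊕ Fin 2) →₀ ℕ, AnalyticOnNhd ℂ (fun θ => (q θ).coeff m) (strip n σ)
  periodic : ∀ θ ∈ strip n σ, ∀ j, q (θ + Pi.single j ((2 * Real.pi : ℝ) : ℂ)) = q θ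
  real : ∀ (θ : Fin n → ℝ) (z : PhaseSpace), IsRealState z →
    (MvPolynomial.eval z (q (toComplexVec θ))).im = 0

/-- `z` solves the Hamiltonian equations `ξ_j' = -i ∂h/∂η_j`, `η_j' = i ∂h/∂ξ_j` of the time
dependent polynomial Hamiltonian `h`, for all times. -/
def IsHamiltonianTrajectory (h : ℝ → MvPolynomial (Fin 2 ⊕ Fin 2) ℂ) (z : ℝ → PhaseSpace) : Prop :=
  ∀ (t : ℝ) (j : Fin 2),
    HasDerivAt (fun s => z s (Sum.inl j))
      (-Complex.I * MvPolynomial.eval (z t) (MvPolynomial.pderiv (Sum.inr j) (h t))) t ∧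
    HasDerivAt (fun s => z s (Sum.inr j))
      (Complex.I * MvPolynomial.eval (z t) (MvPolynomial.pderiv (Sum.inl j) (h t))) t

/-- The time dependent linear change of coordinates `z' = M t z` conjugates the Hamiltonian
equations of `h` to those of `h'`. -/
def Conjugates (M : ℝ → Matrix (Fin 2 ⊕ Fin 2) (Fin 2 ⊕ Fin 2) ℂ)
    (h h' : ℝ → MvPolynomial (Fin 2 ⊕ Fin 2) ℂ) : Prop :=
  ∀ z : ℝ → PhaseSpace,
    IsHamiltonianTrajectory h z ↔ IsHamiltonianTrajectory h' (fun t => M t *ᵥ z t)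

/-- The Hamiltonian `ν₁ ξ₁ η₁ + ε q(ω t, ξ₁, η₁, ξ₂)`. -/
noncomputable def perturbedHamiltonian {n : ℕ} (ν₁ : ℝ)
    (q : (Fin n → ℂ) → MvPolynomial (Fin 2 ⊕ Fin 2) ℂ) (ε : ℝ) (ω : Fin n → ℝ) (t : ℝ) :
    MvPolynomial (Fin 2 ⊕ Fin 2) ℂ :=
  MvPolynomial.C (ν₁ : ℂ) * (MvPolynomial.X (Sum.inl 0) * MvPolynomial.X (Sum.inr 0)) +
    MvPolynomial.C (ε : ℂ) * q (toComplexVec (t • ω))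

/-- The normal form `a ξ₁ η₁ + c ξ₂²`. -/
noncomputable def normalForm (a c : ℝ) : MvPolynomial (Fin 2 ⊕ Fin 2) ℂ :=
  MvPolynomial.C (a : ℂ) * (MvPolynomial.X (Sum.inl 0) * MvPolynomial.X (Sum.inr 0)) +
    MvPolynomial.C (c : ℂ) * MvPolynomial.X (Sum.inl 1) ^ 2

/-- The box `(0, 2π]ⁿ` of frequencies. -/
def frequencyBox (n : ℕ) : Set (Fin n → ℝ) :=
  Set.univ.pi fun _ => Set.Ioc 0 (2 * Real.pi)

namespace QuasiPeriodic

open scoped ENNReal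

variable {n : ℕ}

/-- The `ℓ¹` length of a lattice vector. -/
def l1 (k : Fin n → ℤ) : ℝ := ∑ j, |(k j : ℝ)|

/-- The pairing `k · θ`. -/
def dot (k : Fin n → ℤ) (θ : Fin n → ℝ) : ℝ := ∑ j, (k j : ℝ) * θ j

/-- The character `θ ↦ exp (i k · θ)`. -/
noncomputable def fchar (k : Fin n → ℤ) (θ : Fin n → ℝ) : ℂ :=
  Complex.exp (Complex.I * (dot k θ : ℂ))

/-- The weighted `ℓ¹` norm of a family of Fourier coefficients. -/
noncomputable def wnorm (s : ℝ) (a : (Fin n → ℤ) → ℂ) : ℝ≥0∞ :=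
  ∑' k, ‖a k‖ₑ * ENNReal.ofReal (Real.exp (s * l1 k))

/-- `F` is the sum of a Fourier series whose weighted `ℓ¹` norm is at most `r`. -/
def InWiener (s r : ℝ) (F : (Fin n → ℝ) → ℂ) : Prop :=
  ∃ a, wnorm s a ≤ ENNReal.ofReal r ∧ ∀ θ, HasSum (fun k => a k * fchar k θ) (F θ)

theorem l1_nonneg (k : Fin n → ℤ) : 0 ≤ l1 k := Finset.sum_nonneg fun _ _ => abs_nonneg _

@[simp] theorem l1_zero : l1 (0 : Fin n → ℤ) = 0 := by simp [l1]

@[simp] theorem l1_neg (k : Fin n → ℤ) : l1 (-k) = l1 k := by simp [l1]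

theorem l1_add_le (k l : Fin n → ℤ) : l1 (k + l) ≤ l1 k + l1 l := by
  unfold l1
  rw [← Finset.sum_add_distrib]
  refine Finset.sum_le_sum fun j _ => ?_
  simpa using abs_add_le (k j : ℝ) (l j)

@[simp] theorem dot_zero_left (θ : Fin n → ℝ) : dot 0 θ = 0 := by simp [dot]

theorem dot_add_left (k l : Fin n → ℤ) (θ : Fin n → ℝ) : dot (k + l) θ = dot k θ + dot l θ := by
  simp [dot, add_mul, Finset.sum_add_distrib]

theorem dot_neg_left (k : Fin n → ℤ) (θ : Fin n → ℝ) : dot (-k) θ = -dot k θ := by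
  simp [dot]

theorem dot_add_right (k : Fin n → ℤ) (θ θ' : Fin n → ℝ) :
    dot k (θ + θ') = dot k θ + dot k θ' := by
  simp [dot, mul_add, Finset.sum_add_distrib]

theorem dot_smul_right (k : Fin n → ℤ) (t : ℝ) (θ : Fin n → ℝ) :
    dot k (t • θ) = t * dot k θ := by
  simp only [dot, Pi.smul_apply, smul_eq_mul, Finset.mul_sum]
  exact Finset.sum_congr rfl fun j _ => by ring

theorem dot_sub_right (k : Fin n → ℤ) (θ θ' : Fin n → ℝ) :
    dot k (θ - θ') = dot k θ - dot k θ' := by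
  simp [dot, mul_sub, Finset.sum_sub_distrib]

theorem abs_dot_le (k : Fin n → ℤ) (θ : Fin n → ℝ) : |dot k θ| ≤ l1 k * ‖θ‖ := by
  unfold dot l1
  rw [Finset.sum_mul]
  refine (Finset.abs_sum_le_sum_abs _ _).trans (Finset.sum_le_sum fun j _ => ?_)
  rw [abs_mul]
  exact mul_le_mul_of_nonneg_left (norm_le_pi_norm θ j) (abs_nonneg _)

@[simp] theorem fchar_zero (θ : Fin n → ℝ) : fchar 0 θ = 1 := by simp [fchar]

theorem fchar_add (k l : Fin n → ℤ) (θ : Fin n → ℝ) :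
    fchar (k + l) θ = fchar k θ * fchar l θ := by
  rw [fchar, fchar, fchar, ← Complex.exp_add, dot_add_left]
  push_cast
  ring_nf

theorem fchar_add_right (k : Fin n → ℤ) (θ θ' : Fin n → ℝ) :
    fchar k (θ + θ') = fchar k θ * fchar k θ' := by
  rw [fchar, fchar, fchar, ← Complex.exp_add, dot_add_right]
  push_cast
  ring_nf

@[simp] theorem norm_fchar (k : Fin n → ℤ) (θ : Fin n → ℝ) : ‖fchar k θ‖ = 1 := by
  rw [fchar, mul_comm, Complex.norm_exp_ofReal_mul_I]

@[simp] theorem enorm_fchar (k : Fin n → ℤ) (θ : Fin n → ℝ) : ‖fchar k θ‖ₑ = 1 := by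
  rw [← ofReal_norm, norm_fchar, ENNReal.ofReal_one]

theorem fchar_neg (k : Fin n → ℤ) (θ : Fin n → ℝ) :
    fchar (-k) θ = starRingEnd ℂ (fchar k θ) := by
  rw [fchar, fchar, ← Complex.exp_conj, dot_neg_left]
  simp

theorem fchar_periodic (k : Fin n → ℤ) (θ : Fin n → ℝ) (j : Fin n) :
    fchar k (θ + Pi.single j (2 * Real.pi)) = fchar k θ := by
  rw [fchar_add_right]
  have h : dot k (Pi.single j (2 * Real.pi)) = (k j : ℝ) * (2 * Real.pi) := by
    simp [dot, Pi.single_apply]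
  have : fchar k (Pi.single j (2 * Real.pi)) = 1 := by
    rw [fchar, h, Complex.exp_eq_one_iff]
    exact ⟨k j, by push_cast; ring⟩
  rw [this, mul_one]

theorem tsum_enorm_le_wnorm {s : ℝ} (hs : 0 ≤ s) (a : (Fin n → ℤ) → ℂ) :
    ∑' k, ‖a k‖ₑ ≤ wnorm s a := by
  refine ENNReal.tsum_le_tsum fun k => le_mul_of_one_le_right' ?_
  rw [ENNReal.one_le_ofReal]
  exact Real.one_le_exp (mul_nonneg hs (l1_nonneg k))

theorem summable_norm_of_tsum_enorm {ι : Type*} {f : ι → ℂ} (h : ∑' k, ‖f k‖ₑ ≠ ⊤) :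
    Summable fun k => ‖f k‖ := by
  have := ENNReal.summable_toReal h
  simpa using this

theorem summable_norm_of_wnorm {s : ℝ} (hs : 0 ≤ s) {a : (Fin n → ℤ) → ℂ} (h : wnorm s a ≠ ⊤) :
    Summable fun k => ‖a k‖ :=
  summable_norm_of_tsum_enorm (ne_top_of_le_ne_top h (tsum_enorm_le_wnorm hs a))

theorem summable_mul_fchar {a : (Fin n → ℤ) → ℂ} (h : Summable fun k => ‖a k‖)
    (θ : Fin n → ℝ) : Summable fun k => a k * fchar k θ :=
  Summable.of_norm (by simpa using h)

/-- The weighted `ℓ¹` norm as a real sum. -/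
theorem wnorm_le_iff {s r : ℝ} (hr : 0 ≤ r) {a : (Fin n → ℤ) → ℂ} :
    wnorm s a ≤ ENNReal.ofReal r ↔
      Summable (fun k => ‖a k‖ * Real.exp (s * l1 k)) ∧
        ∑' k, ‖a k‖ * Real.exp (s * l1 k) ≤ r := by
  have hnn : ∀ k, 0 ≤ ‖a k‖ * Real.exp (s * l1 k) := fun k => by positivity
  have he : wnorm s a = ∑' k, ENNReal.ofReal (‖a k‖ * Real.exp (s * l1 k)) := by
    refine tsum_congr fun k => ?_
    rw [ENNReal.ofReal_mul (norm_nonneg _), ofReal_norm]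
  constructor
  · intro h
    have hs : Summable (fun k => ‖a k‖ * Real.exp (s * l1 k)) := by
      have := ENNReal.summable_toReal (ne_top_of_le_ne_top ENNReal.ofReal_ne_top (he ▸ h))
      refine this.congr fun k => ENNReal.toReal_ofReal (hnn k)
    refine ⟨hs, ?_⟩
    rw [he, ← ENNReal.ofReal_tsum_of_nonneg hnn hs] at h
    exact (ENNReal.ofReal_le_ofReal_iff hr).1 h
  · rintro ⟨hs, h⟩
    rw [he, ← ENNReal.ofReal_tsum_of_nonneg hnn hs]
    exact ENNReal.ofReal_le_ofReal h

theorem wnorm_mono {s s' : ℝ} (h : s ≤ s') (a : (Fin n → ℤ) → ℂ) : wnorm s a ≤ wnorm s' a := by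
  refine ENNReal.tsum_le_tsum fun k => ?_
  gcongr
  exact l1_nonneg k

theorem wnorm_add_le (s : ℝ) (a b : (Fin n → ℤ) → ℂ) :
    wnorm s (fun k => a k + b k) ≤ wnorm s a + wnorm s b := by
  unfold wnorm
  rw [← ENNReal.tsum_add]
  refine ENNReal.tsum_le_tsum fun k => ?_
  rw [← add_mul]
  gcongr
  exact enorm_add_le _ _

/-- A Fourier multiplier bounded by `B exp ((s' - s) |k|)` maps weight `s'` to weight `s`. -/
theorem wnorm_multiplier {s s' B : ℝ} (a μ : (Fin n → ℤ) → ℂ)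
    (h : ∀ k, ‖μ k‖ ≤ B * Real.exp ((s' - s) * l1 k)) :
    wnorm s (fun k => μ k * a k) ≤ ENNReal.ofReal B * wnorm s' a := by
  unfold wnorm
  rw [← ENNReal.tsum_mul_left]
  refine ENNReal.tsum_le_tsum fun k => ?_
  have hB : 0 ≤ B := by
    by_contra hB
    have := (norm_nonneg _).trans (h k)
    have h2 := Real.exp_pos ((s' - s) * l1 k)
    nlinarith
  rw [← ofReal_norm, ← ofReal_norm, ← ENNReal.ofReal_mul (norm_nonneg _),
    ← ENNReal.ofReal_mul (norm_nonneg _), ← ENNReal.ofReal_mul hB]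
  refine ENNReal.ofReal_le_ofReal ?_
  rw [norm_mul]
  calc ‖μ k‖ * ‖a k‖ * Real.exp (s * l1 k)
      ≤ B * Real.exp ((s' - s) * l1 k) * ‖a k‖ * Real.exp (s * l1 k) := by
        gcongr
        exact h k
    _ = B * (‖a k‖ * (Real.exp ((s' - s) * l1 k) * Real.exp (s * l1 k))) := by ring
    _ = _ := by rw [← Real.exp_add]; ring_nf

theorem wnorm_conv_le {s : ℝ} (hs : 0 ≤ s) (a b : (Fin n → ℤ) → ℂ) :
    wnorm s (fun k => ∑' l, a l * b (k - l)) ≤ wnorm s a * wnorm s b := by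
  unfold wnorm
  calc ∑' k, ‖∑' l, a l * b (k - l)‖ₑ * ENNReal.ofReal (Real.exp (s * l1 k))
      ≤ ∑' k, ∑' l, (‖a l‖ₑ * ENNReal.ofReal (Real.exp (s * l1 l))) *
          (‖b (k - l)‖ₑ * ENNReal.ofReal (Real.exp (s * l1 (k - l)))) := by
        refine ENNReal.tsum_le_tsum fun k => ?_
        refine (mul_le_mul_left (enorm_tsum_le_tsum_enorm) _).trans ?_
        rw [← ENNReal.tsum_mul_right]
        refine ENNReal.tsum_le_tsum fun l => ?_
        rw [enorm_mul]
        have : ENNReal.ofReal (Real.exp (s * l1 k)) ≤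
            ENNReal.ofReal (Real.exp (s * l1 l)) * ENNReal.ofReal (Real.exp (s * l1 (k - l))) := by
          rw [← ENNReal.ofReal_mul (Real.exp_pos _).le, ← Real.exp_add]
          refine ENNReal.ofReal_le_ofReal (Real.exp_le_exp.2 ?_)
          have := l1_add_le l (k - l)
          rw [add_sub_cancel] at this
          nlinarith
        calc _ ≤ ‖a l‖ₑ * ‖b (k - l)‖ₑ * (ENNReal.ofReal (Real.exp (s * l1 l)) *
              ENNReal.ofReal (Real.exp (s * l1 (k - l)))) := by gcongr
          _ = _ := by ring
    _ = _ := by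
        rw [ENNReal.tsum_comm, ← ENNReal.tsum_mul_right]
        refine tsum_congr fun l => ?_
        rw [ENNReal.tsum_mul_left]
        congr 1
        exact (Equiv.subRight l).tsum_eq
          (fun k => ‖b k‖ₑ * ENNReal.ofReal (Real.exp (s * l1 k)))

namespace InWiener

variable {s s' r r' : ℝ} {F G : (Fin n → ℝ) → ℂ}

theorem mono (hF : InWiener s r F) (hs : s' ≤ s) (hr : r ≤ r') : InWiener s' r' F := by
  obtain ⟨a, ha, h⟩ := hF
  exact ⟨a, (wnorm_mono hs a).trans (ha.trans (ENNReal.ofReal_le_ofReal hr)), h⟩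

theorem of_wnorm (hs : 0 ≤ s) {a : (Fin n → ℤ) → ℂ} (ha : wnorm s a ≤ ENNReal.ofReal r) :
    InWiener s r (fun θ => ∑' k, a k * fchar k θ) :=
  ⟨a, ha, fun θ => (summable_mul_fchar (summable_norm_of_wnorm hs
    (ne_top_of_le_ne_top ENNReal.ofReal_ne_top ha)) θ).hasSum⟩

theorem norm_le (hF : InWiener s r F) (hs : 0 ≤ s) (hr : 0 ≤ r) (θ : Fin n → ℝ) :
    ‖F θ‖ ≤ r := by
  obtain ⟨a, ha, h⟩ := hF
  rw [← (h θ).tsum_eq]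
  have h1 : ‖∑' k, a k * fchar k θ‖ₑ ≤ ENNReal.ofReal r := by
    refine enorm_tsum_le_tsum_enorm.trans (le_trans ?_ ((tsum_enorm_le_wnorm hs a).trans ha))
    simp
  rw [← ofReal_norm] at h1
  exact (ENNReal.ofReal_le_ofReal_iff hr).1 h1

theorem const (c : ℂ) (hc : ‖c‖ ≤ r) : InWiener s r (fun _ : Fin n → ℝ => c) := by
  classical
  refine ⟨Pi.single 0 c, ?_, fun θ => ?_⟩
  · unfold wnorm
    rw [tsum_eq_single 0]
    · simp only [Pi.single_eq_same, l1_zero, mul_zero, Real.exp_zero, ENNReal.ofReal_one, mul_one]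
      rw [← ofReal_norm]
      exact ENNReal.ofReal_le_ofReal hc
    · intro k hk
      simp [hk]
  · have := hasSum_single (f := fun k => (Pi.single 0 c : (Fin n → ℤ) → ℂ) k * fchar k θ) 0
      (fun k hk => by simp [hk])
    simpa using this

theorem add (hF : InWiener s r F) (hG : InWiener s r' G) (hr : 0 ≤ r) (hr' : 0 ≤ r') :
    InWiener s (r + r') (fun θ => F θ + G θ) := by
  obtain ⟨a, ha, h⟩ := hF
  obtain ⟨b, hb, h'⟩ := hG
  refine ⟨fun k => a k + b k, ?_, fun θ => ?_⟩
  · rw [ENNReal.ofReal_add hr hr']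
    exact (wnorm_add_le s a b).trans (add_le_add ha hb)
  · simpa [add_mul] using (h θ).add (h' θ)

theorem const_mul (hF : InWiener s r F) (c : ℂ) (hc : ‖c‖ ≤ r') :
    InWiener s (r' * r) (fun θ => c * F θ) := by
  obtain ⟨a, ha, h⟩ := hF
  refine ⟨fun k => c * a k, ?_, fun θ => ?_⟩
  · rw [ENNReal.ofReal_mul ((norm_nonneg _).trans hc)]
    exact (wnorm_multiplier (s' := s) (B := r') a (fun _ => c) (fun k => by simpa using hc)).trans
      (mul_le_mul_right ha _)
  · simpa [mul_assoc] using (h θ).mul_left c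

theorem neg (hF : InWiener s r F) : InWiener s r (fun θ => -F θ) := by
  simpa using hF.const_mul (-1) (r' := 1) (by simp)

theorem sub (hF : InWiener s r F) (hG : InWiener s r' G) (hr : 0 ≤ r) (hr' : 0 ≤ r') :
    InWiener s (r + r') (fun θ => F θ - G θ) := by
  simpa [sub_eq_add_neg] using hF.add hG.neg hr hr'

theorem conj (hF : InWiener s r F) : InWiener s r (fun θ => starRingEnd ℂ (F θ)) := by
  obtain ⟨a, ha, h⟩ := hF
  refine ⟨fun k => starRingEnd ℂ (a (-k)), ?_, fun θ => ?_⟩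
  · refine le_trans (le_of_eq ?_) ha
    unfold wnorm
    rw [← (Equiv.neg (Fin n → ℤ)).tsum_eq]
    refine tsum_congr fun k => ?_
    simp only [Equiv.neg_apply, neg_neg, l1_neg]
    rw [← ofReal_norm, ← ofReal_norm, RCLike.norm_conj]
  · have h1 := (Complex.hasSum_conj'.2 (h θ))
    have h2 := (Equiv.neg (Fin n → ℤ)).hasSum_iff.2 h1
    refine h2.congr_fun ?_ 
    intro k
    simp [fchar_neg]

theorem mul (hF : InWiener s r F) (hG : InWiener s r' G) (hs : 0 ≤ s) (hr : 0 ≤ r) :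
    InWiener s (r * r') (fun θ => F θ * G θ) := by
  obtain ⟨a, ha, h⟩ := hF
  obtain ⟨b, hb, h'⟩ := hG
  refine ⟨fun k => ∑' l, a l * b (k - l), ?_, fun θ => ?_⟩
  · rw [ENNReal.ofReal_mul hr]
    exact (wnorm_conv_le hs a b).trans (mul_le_mul' ha hb)
  · have hsa := summable_norm_of_wnorm hs (ne_top_of_le_ne_top ENNReal.ofReal_ne_top ha)
    have hsb := summable_norm_of_wnorm hs (ne_top_of_le_ne_top ENNReal.ofReal_ne_top hb)
    have hsum : Summable fun p : (Fin n → ℤ) × (Fin n → ℤ) =>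
        (a p.1 * fchar p.1 θ) * (b p.2 * fchar p.2 θ) :=
      summable_mul_of_summable_norm (f := fun k => a k * fchar k θ) (g := fun k => b k * fchar k θ)
        (by simpa using hsa) (by simpa using hsb)
    have h1 := (h θ).mul (h' θ) hsum
    let e : (Fin n → ℤ) × (Fin n → ℤ) ≃ (Fin n → ℤ) × (Fin n → ℤ) :=
      { toFun := fun p => (p.2, p.1 - p.2)
        invFun := fun p => (p.1 + p.2, p.1)
        left_inv := fun p => by simp
        right_inv := fun p => by simp }
    have h2 := e.hasSum_iff.2 h1
    have h3 := h2.prod_fiberwise (fun k => (h2.summable.prod_factor k).hasSum)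
    have h4 : ∀ k, (∑' l, a l * b (k - l)) * fchar k θ =
        ∑' l, a l * fchar l θ * (b (k - l) * fchar (k - l) θ) := fun k => by
      rw [← tsum_mul_right]
      refine tsum_congr fun l => ?_
      have : fchar k θ = fchar l θ * fchar (k - l) θ := by rw [← fchar_add, add_sub_cancel]
      rw [this]
      ring
    simp only [h4]
    exact h3

/-- A series of functions that is summable in norm. -/
theorem tsum {F : ℕ → (Fin n → ℝ) → ℂ} {r : ℕ → ℝ} (hs : 0 ≤ s)
    (hF : ∀ j, InWiener s (r j) (F j)) (hr : ∀ j, 0 ≤ r j) (hsum : Summable r)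
    {H : (Fin n → ℝ) → ℂ} (hH : ∀ θ, HasSum (fun j => F j θ) (H θ)) :
    InWiener s (∑' j, r j) H := by
  choose a ha h using hF
  have hle : ∑' j, wnorm s (a j) ≤ ENNReal.ofReal (∑' j, r j) := by
    rw [ENNReal.ofReal_tsum_of_nonneg hr hsum]
    exact ENNReal.tsum_le_tsum ha
  refine ⟨fun k => ∑' j, a j k, le_trans ?_ hle, fun θ => ?_⟩
  · unfold wnorm
    rw [ENNReal.tsum_comm]
    refine ENNReal.tsum_le_tsum fun k => ?_
    rw [ENNReal.tsum_mul_right]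
    gcongr
    exact enorm_tsum_le_tsum_enorm
  · have hab : Summable fun p : (Fin n → ℤ) × ℕ => a p.2 p.1 * fchar p.1 θ := by
      refine Summable.of_norm (summable_norm_of_tsum_enorm
        (f := fun p : (Fin n → ℤ) × ℕ => a p.2 p.1 * fchar p.1 θ) ?_)
      refine ne_top_of_le_ne_top ENNReal.ofReal_ne_top (le_trans ?_ hle)
      rw [ENNReal.tsum_prod (f := fun (k : Fin n → ℤ) (j : ℕ) => ‖a j k * fchar k θ‖ₑ),
        ENNReal.tsum_comm]
      refine ENNReal.tsum_le_tsum fun j => le_trans (le_of_eq ?_) (tsum_enorm_le_wnorm hs (a j))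
      simp
    have h1 := hab.hasSum
    have h2 := h1.prod_fiberwise (fun k => (hab.prod_factor k).hasSum)
    have h3 := ((Equiv.prodComm _ _).hasSum_iff.2 h1).prod_fiberwise (fun j => h j θ)
    rw [← h3.unique (hH θ)]
    have h4 : ∀ k, (∑' j, a j k) * fchar k θ = ∑' j, a j k * fchar k θ := fun k => by
      rw [tsum_mul_right]
    simp only [h4]
    exact h2

theorem pow (hF : InWiener s r F) (hs : 0 ≤ s) (hr : 0 ≤ r) (m : ℕ) :
    InWiener s (r ^ m) (fun θ => F θ ^ m) := by
  induction m with
  | zero => simpa using const (n := n) (s := s) (r := 1) 1 (by simp)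
  | succ m ih => simpa [pow_succ] using ih.mul hF hs (by positivity)

theorem exp (hF : InWiener s r F) (hs : 0 ≤ s) (hr : 0 ≤ r) :
    InWiener s (Real.exp r) (fun θ => Complex.exp (F θ)) := by
  have h := tsum (F := fun j θ => ((j.factorial : ℂ)⁻¹) * F θ ^ j)
    (r := fun j => (j.factorial : ℝ)⁻¹ * r ^ j) hs
    (fun j => (hF.pow hs hr j).const_mul _ (by simp)) (fun j => by positivity)
    (by simpa [div_eq_inv_mul] using Real.summable_pow_div_factorial r)
    (H := fun θ => Complex.exp (F θ)) (fun θ => by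
      have := NormedSpace.expSeries_div_hasSum_exp (𝔸 := ℂ) (F θ)
      rw [← Complex.exp_eq_exp_ℂ] at this
      simpa [div_eq_inv_mul] using this)
  have h2 : ∑' j : ℕ, (j.factorial : ℝ)⁻¹ * r ^ j = Real.exp r := by
    have := (NormedSpace.expSeries_div_hasSum_exp (𝔸 := ℝ) r).tsum_eq
    rw [← Real.exp_eq_exp_ℝ] at this
    simpa [div_eq_inv_mul] using this
  rwa [h2] at h

theorem exp_sub_one (hF : InWiener s r F) (hs : 0 ≤ s) (hr : 0 ≤ r) :
    InWiener s (Real.exp r - 1) (fun θ => Complex.exp (F θ) - 1) := by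
  have h := tsum (F := fun j θ => (((j + 1).factorial : ℂ)⁻¹) * F θ ^ (j + 1))
    (r := fun j => ((j + 1).factorial : ℝ)⁻¹ * r ^ (j + 1)) hs
    (fun j => (hF.pow hs hr (j + 1)).const_mul _ (by simp)) (fun j => by positivity)
    (by
      have := (summable_nat_add_iff 1).2 (Real.summable_pow_div_factorial r)
      simpa [div_eq_inv_mul] using this)
    (H := fun θ => Complex.exp (F θ) - 1) (fun θ => by
      have := NormedSpace.expSeries_div_hasSum_exp (𝔸 := ℂ) (F θ)
      rw [← Complex.exp_eq_exp_ℂ] at this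
      have := (hasSum_nat_add_iff' 1).2 this
      simpa [div_eq_inv_mul] using this)
  have h2 : ∑' j : ℕ, ((j + 1).factorial : ℝ)⁻¹ * r ^ (j + 1) = Real.exp r - 1 := by
    have := (NormedSpace.expSeries_div_hasSum_exp (𝔸 := ℝ) r)
    rw [← Real.exp_eq_exp_ℝ] at this
    have := ((hasSum_nat_add_iff' 1).2 this).tsum_eq
    simpa [div_eq_inv_mul] using this
  rwa [h2] at h

theorem periodic (hF : InWiener s r F) (θ : Fin n → ℝ) (j : Fin n) :
    F (θ + Pi.single j (2 * Real.pi)) = F θ := by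
  obtain ⟨a, -, h⟩ := hF
  refine (h _).unique ?_
  simpa only [fchar_periodic] using h θ

end InWiener

end QuasiPeriodic

namespace QuasiPeriodic

open scoped ENNReal

variable {n : ℕ}

/-- The derivative of `F` along the direction `ω`. -/
noncomputable def dir (ω : Fin n → ℝ) (F : (Fin n → ℝ) → ℂ) (θ : Fin n → ℝ) : ℂ :=
  deriv (fun t : ℝ => F (θ + t • ω)) 0

theorem fchar_line (k : Fin n → ℤ) (θ ω : Fin n → ℝ) (t : ℝ) :
    fchar k (θ + t • ω) = fchar k θ * Complex.exp (Complex.I * dot k ω * t) := by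
  rw [fchar_add_right]
  congr 1
  rw [fchar, dot_smul_right]
  push_cast
  ring_nf

theorem hasDerivAt_fchar_line (k : Fin n → ℤ) (θ ω : Fin n → ℝ) (t : ℝ) :
    HasDerivAt (fun t : ℝ => fchar k (θ + t • ω))
      (Complex.I * dot k ω * fchar k (θ + t • ω)) t := by
  have h1 : HasDerivAt (fun t : ℝ => Complex.I * dot k ω * (t : ℂ)) (Complex.I * dot k ω) t := by
    simpa using (Complex.ofRealCLM.hasDerivAt (x := t)).const_mul (Complex.I * dot k ω)
  have h2 := (h1.cexp).const_mul (fchar k θ)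
  simp only [fchar_line]
  exact h2.congr_deriv (by ring)

theorem l1_le_exp {s : ℝ} (hs : 0 < s) (k : Fin n → ℤ) : l1 k ≤ Real.exp (s * l1 k) / s := by
  rw [le_div_iff₀ hs]
  have := Real.add_one_le_exp (s * l1 k)
  nlinarith

theorem norm_dot_mul_le {s : ℝ} (hs : 0 < s) (ω : Fin n → ℝ) (a : (Fin n → ℤ) → ℂ)
    (k : Fin n → ℤ) :
    ‖a k * (Complex.I * dot k ω)‖ ≤ ‖ω‖ / s * (‖a k‖ * Real.exp (s * l1 k)) := by
  rw [norm_mul, norm_mul, Complex.norm_I, one_mul, Complex.norm_real, Real.norm_eq_abs]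
  calc ‖a k‖ * |dot k ω| ≤ ‖a k‖ * (Real.exp (s * l1 k) / s * ‖ω‖) := by
        gcongr
        exact (abs_dot_le k ω).trans (by gcongr; exact l1_le_exp hs k)
    _ = _ := by ring

theorem hasDerivAt_fourier_line {s r : ℝ} (hs : 0 < s) (hr : 0 ≤ r) {a : (Fin n → ℤ) → ℂ}
    (ha : wnorm s a ≤ ENNReal.ofReal r) (θ ω : Fin n → ℝ) (t : ℝ) :
    HasDerivAt (fun t : ℝ => ∑' k, a k * fchar k (θ + t • ω))
      (∑' k, a k * (Complex.I * dot k ω) * fchar k (θ + t • ω)) t := by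
  have hsum := ((wnorm_le_iff hr).1 ha).1.mul_left (‖ω‖ / s)
  have h := hasDerivAt_tsum (y₀ := t) (y := t)
    (g := fun (k : Fin n → ℤ) (t : ℝ) => a k * fchar k (θ + t • ω))
    (g' := fun k t => a k * (Complex.I * dot k ω) * fchar k (θ + t • ω)) hsum
    (fun k t => by
      simpa [mul_assoc] using (hasDerivAt_fchar_line k θ ω t).const_mul (a k))
    (fun k t => by
      rw [norm_mul, norm_fchar, mul_one]
      exact norm_dot_mul_le hs ω a k)
    (summable_mul_fchar (summable_norm_of_wnorm hs.le
      (ne_top_of_le_ne_top ENNReal.ofReal_ne_top ha)) _)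
  exact h

theorem dir_fourier {s r : ℝ} (hs : 0 < s) (hr : 0 ≤ r) {a : (Fin n → ℤ) → ℂ}
    (ha : wnorm s a ≤ ENNReal.ofReal r) (θ ω : Fin n → ℝ) :
    dir ω (fun θ => ∑' k, a k * fchar k θ) θ =
      ∑' k, a k * (Complex.I * dot k ω) * fchar k θ := by
  have := (hasDerivAt_fourier_line hs hr ha θ ω 0).deriv
  simpa [dir] using this

namespace InWiener

variable {s s' r r' : ℝ} {F G : (Fin n → ℝ) → ℂ}

theorem nonneg_radius (hF : InWiener s r F) : InWiener s (max r 0) F :=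
  hF.mono le_rfl (le_max_left _ _)

theorem hasDerivAt_line (hF : InWiener s r F) (hs : 0 < s) (ω θ : Fin n → ℝ) (t : ℝ) :
    HasDerivAt (fun t : ℝ => F (θ + t • ω)) (dir ω F (θ + t • ω)) t := by
  obtain ⟨a, ha, h⟩ := hF.nonneg_radius
  have hF' : F = fun θ => ∑' k, a k * fchar k θ := funext fun θ => (h θ).tsum_eq.symm
  rw [hF', dir_fourier hs (le_max_right _ _) ha]
  exact hasDerivAt_fourier_line hs (le_max_right _ _) ha θ ω t

theorem hasDerivAt_dir (hF : InWiener s r F) (hs : 0 < s) (ω θ : Fin n → ℝ) :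
    HasDerivAt (fun t : ℝ => F (θ + t • ω)) (dir ω F θ) 0 := by
  simpa using hF.hasDerivAt_line hs ω θ 0

theorem norm_dir_sub_le (hF : InWiener s r F) (hs : 0 < s) (hr : 0 ≤ r) (ω ω' θ : Fin n → ℝ) :
    ‖dir ω F θ - dir ω' F θ‖ ≤ r / s * ‖ω - ω'‖ := by
  obtain ⟨a, ha, h⟩ := hF
  have hF' : F = fun θ => ∑' k, a k * fchar k θ := funext fun θ => (h θ).tsum_eq.symm
  obtain ⟨hsum, hle⟩ := (wnorm_le_iff hr).1 ha
  have hsm : ∀ ω : Fin n → ℝ, Summable fun k => a k * (Complex.I * dot k ω) * fchar k θ :=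
    fun ω => Summable.of_norm_bounded (hsum.mul_left (‖ω‖ / s)) (fun k => by
      rw [norm_mul, norm_fchar, mul_one]
      exact norm_dot_mul_le hs ω a k)
  rw [hF', dir_fourier hs hr ha, dir_fourier hs hr ha, ← (hsm ω).tsum_sub (hsm ω')]
  have h2 : ∀ k, ‖a k * (Complex.I * dot k ω) * fchar k θ -
      a k * (Complex.I * dot k ω') * fchar k θ‖ ≤
        ‖ω - ω'‖ / s * (‖a k‖ * Real.exp (s * l1 k)) := fun k => by
    have : a k * (Complex.I * dot k ω) * fchar k θ - a k * (Complex.I * dot k ω') * fchar k θ =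
        a k * (Complex.I * dot k (ω - ω')) * fchar k θ := by
      rw [dot_sub_right]
      push_cast
      ring
    rw [this, norm_mul, norm_fchar, mul_one]
    exact norm_dot_mul_le hs _ a k
  refine (tsum_of_norm_bounded (hsum.mul_left _).hasSum h2).trans ?_
  rw [tsum_mul_left]
  calc _ ≤ ‖ω - ω'‖ / s * r := by gcongr
    _ = _ := by ring

theorem norm_dir_le (hF : InWiener s r F) (hs : 0 < s) (hr : 0 ≤ r) (ω θ : Fin n → ℝ) :
    ‖dir ω F θ‖ ≤ r / s * ‖ω‖ := by
  have h0 : dir 0 F θ = 0 := by simp [dir]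
  simpa [h0] using hF.norm_dir_sub_le hs hr ω 0 θ

theorem dir_sub (hF : InWiener s r F) (hG : InWiener s' r' G) (hs : 0 < s) (hs' : 0 < s')
    (ω θ : Fin n → ℝ) : dir ω (fun θ => F θ - G θ) θ = dir ω F θ - dir ω G θ :=
  ((hF.hasDerivAt_dir hs ω θ).sub (hG.hasDerivAt_dir hs' ω θ)).deriv

end InWiener

/-- Division by the small divisors `i (k · ω - β)` on a set of modes. -/
theorem exists_smallDivisor_solution {s s' r r₀ : ℝ} (hs' : 0 < s') (hs : s' ≤ s)
    (ω : Fin n → ℝ) (β : ℂ)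
    {a : (Fin n → ℤ) → ℂ} (ha : wnorm s a ≤ ENNReal.ofReal r) (keep : Set (Fin n → ℤ))
    [DecidablePred (· ∈ keep)] (hr : 0 ≤ r) (hr₀ : 0 ≤ r₀)
    (h0 : ∀ k ∈ keep, ‖((dot k ω : ℂ) - β)⁻¹‖ ≤ r₀ * Real.exp ((s - s') * l1 k)) :
    ∃ U : (Fin n → ℝ) → ℂ,
      (∀ θ, dir ω U θ = Complex.I * β * U θ +
        ∑' k, (if k ∈ keep ∧ (dot k ω : ℂ) - β ≠ 0 then a k else 0) * fchar k θ) ∧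
      ∀ B s'' : ℝ, 0 ≤ B → 0 ≤ s'' →
        (∀ k ∈ keep, ‖((dot k ω : ℂ) - β)⁻¹‖ ≤ B * Real.exp ((s - s'') * l1 k)) →
        InWiener s'' (B * r) U := by
  set μ : (Fin n → ℤ) → ℂ := fun k => if k ∈ keep then (Complex.I * ((dot k ω : ℂ) - β))⁻¹ else 0
    with hμ
  have hμb : ∀ B s'' : ℝ, 0 ≤ B →
      (∀ k ∈ keep, ‖((dot k ω : ℂ) - β)⁻¹‖ ≤ B * Real.exp ((s - s'') * l1 k)) →
      wnorm s'' (fun k => μ k * a k) ≤ ENNReal.ofReal (B * r) := by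
    intro B s'' hB hk
    rw [ENNReal.ofReal_mul hB]
    refine (wnorm_multiplier (s' := s) (B := B) a μ fun k => ?_).trans (mul_le_mul_right ha _)
    by_cases h : k ∈ keep
    · simpa [hμ, h] using hk k h
    · simp only [hμ, h, if_false, norm_zero]
      positivity
  refine ⟨fun θ => ∑' k, (μ k * a k) * fchar k θ, fun θ => ?_, fun B s'' hB hs'' hk =>
    InWiener.of_wnorm hs'' (hμb B s'' hB hk)⟩
  have hw := hμb r₀ s' hr₀ h0
  rw [dir_fourier hs' (by positivity) hw]
  have hS1 := summable_mul_fchar (summable_norm_of_wnorm hs'.le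
    (ne_top_of_le_ne_top ENNReal.ofReal_ne_top hw)) θ
  have hS2 : Summable fun k =>
      (if k ∈ keep ∧ (dot k ω : ℂ) - β ≠ 0 then a k else 0) * fchar k θ := by
    refine summable_mul_fchar ?_ θ
    refine Summable.of_nonneg_of_le (fun k => norm_nonneg _) (fun k => ?_)
      (summable_norm_of_wnorm (hs'.le.trans hs) (ne_top_of_le_ne_top ENNReal.ofReal_ne_top ha))
    split_ifs
    · exact le_rfl
    · simp
  rw [← tsum_mul_left, ← (hS1.mul_left _).tsum_add hS2]
  refine tsum_congr fun k => ?_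
  by_cases h : k ∈ keep
  · by_cases hd : (dot k ω : ℂ) - β = 0
    · simp [hμ, hd]
    · simp only [hμ, h, hd, if_true, true_and, ne_eq, not_false_eq_true]
      have hI := Complex.I_ne_zero
      field_simp
      ring
  · simp [hμ, h]

theorem hasSum_split {s r : ℝ} (hs : 0 ≤ s)
    {a : (Fin n → ℤ) → ℂ} (ha : wnorm s a ≤ ENNReal.ofReal r)
    (P : (Fin n → ℤ) → Prop) [DecidablePred P] (θ : Fin n → ℝ) :
    ∑' k, a k * fchar k θ = (∑' k, (if P k then a k else 0) * fchar k θ) +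
      ∑' k, (if P k then 0 else a k) * fchar k θ := by
  have hn := summable_norm_of_wnorm hs (ne_top_of_le_ne_top ENNReal.ofReal_ne_top ha)
  have h1 : Summable fun k => (if P k then a k else 0) * fchar k θ := by
    refine summable_mul_fchar (Summable.of_nonneg_of_le (fun k => norm_nonneg _) (fun k => ?_) hn) θ
    split_ifs <;> simp
  have h2 : Summable fun k => (if P k then 0 else a k) * fchar k θ := by
    refine summable_mul_fchar (Summable.of_nonneg_of_le (fun k => norm_nonneg _) (fun k => ?_) hn) θ
    split_ifs <;> simp
  rw [← h1.tsum_add h2]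
  refine tsum_congr fun k => ?_
  split_ifs <;> simp

theorem norm_coeff_le {s r : ℝ} (hr : 0 ≤ r) {a : (Fin n → ℤ) → ℂ}
    (ha : wnorm s a ≤ ENNReal.ofReal r) (k : Fin n → ℤ) :
    ‖a k‖ * Real.exp (s * l1 k) ≤ r := by
  obtain ⟨hsum, hle⟩ := (wnorm_le_iff hr).1 ha
  exact (hsum.le_tsum k (fun _ _ => by positivity)).trans hle

namespace InWiener

variable {s s' r : ℝ} {F : (Fin n → ℝ) → ℂ}

/-- The truncated homological equation `D U = i β U + F - m - R`. -/
theorem exists_truncated (hF : InWiener s r F) (hs : 0 < s) (hr : 0 ≤ r) (ω : Fin n → ℝ) (β : ℂ)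
    {ς N κ₀ : ℝ} (hς : 0 ≤ ς) (hN : 0 ≤ N) (hκ₀ : 0 < κ₀)
    (hnz : ∀ k : Fin n → ℤ, k ≠ 0 → l1 k ≤ N → (dot k ω : ℂ) - β ≠ 0)
    (h0 : ∀ k : Fin n → ℤ, l1 k ≤ N → (dot k ω : ℂ) - β ≠ 0 → κ₀ ≤ ‖(dot k ω : ℂ) - β‖) :
    ∃ (U R : (Fin n → ℝ) → ℂ) (m : ℂ), ‖m‖ ≤ r ∧ (β ≠ 0 → m = 0) ∧
      (∀ θ, dir ω U θ = Complex.I * β * U θ + F θ - m - R θ) ∧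
      InWiener (s - ς) (Real.exp (-(ς * N)) * r) R ∧
      ∀ κ > (0 : ℝ), (∀ k : Fin n → ℤ, l1 k ≤ N → (dot k ω : ℂ) - β ≠ 0 →
        κ ≤ ‖(dot k ω : ℂ) - β‖) → InWiener s (r / κ) U := by
  classical
  obtain ⟨a, ha, h⟩ := hF
  have key : ∀ κ > (0 : ℝ), (∀ k : Fin n → ℤ, l1 k ≤ N → (dot k ω : ℂ) - β ≠ 0 →
      κ ≤ ‖(dot k ω : ℂ) - β‖) → ∀ k ∈ {k : Fin n → ℤ | l1 k ≤ N},
      ‖((dot k ω : ℂ) - β)⁻¹‖ ≤ κ⁻¹ * Real.exp ((s - s) * l1 k) := by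
    intro κ hκ hb k hk
    rw [sub_self, zero_mul, Real.exp_zero, mul_one, norm_inv]
    by_cases hd : (dot k ω : ℂ) - β = 0
    · rw [hd, norm_zero, _root_.inv_zero]
      positivity
    · exact inv_anti₀ hκ (hb k hk hd)
  obtain ⟨U, hU, hUb⟩ := exists_smallDivisor_solution (s' := s) (r₀ := κ₀⁻¹) hs le_rfl ω β ha
    {k | l1 k ≤ N} hr (by positivity) (key κ₀ hκ₀ h0)
  set m : ℂ := if β = 0 then a 0 else 0 with hm
  have htail : wnorm (s - ς) (fun k => (if N < l1 k then a k else 0)) ≤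
      ENNReal.ofReal (Real.exp (-(ς * N)) * r) := by
    rw [ENNReal.ofReal_mul (Real.exp_pos _).le]
    refine le_trans (le_of_eq ?_) ((wnorm_multiplier (s := s - ς) (s' := s)
      (B := Real.exp (-(ς * N))) a
      (fun k => if N < l1 k then 1 else 0) fun k => ?_).trans (mul_le_mul_right ha _))
    · congr 1
      funext k
      split_ifs <;> simp
    · split_ifs with hk
      · rw [norm_one, ← Real.exp_add]
        refine Real.one_le_exp ?_
        nlinarith
      · rw [norm_zero]
        positivity
  refine ⟨U, fun θ => F θ - m - ∑' k, (if l1 k ≤ N ∧ (dot k ω : ℂ) - β ≠ 0 then a k else 0) *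
    fchar k θ, m, ?_, ?_, fun θ => ?_, ?_, fun κ hκ hb => ?_⟩
  · rw [hm]
    split_ifs
    · simpa using norm_coeff_le hr ha 0
    · simpa using hr
  · intro hβ
    simp [hm, hβ]
  · have := hU θ
    simp only [Set.mem_ofPred_eq] at this
    rw [this]
    ring
  · refine ⟨_, htail, fun θ => ?_⟩
    have hn := summable_norm_of_wnorm hs.le (ne_top_of_le_ne_top ENNReal.ofReal_ne_top ha)
    have hS : Summable fun k => (if N < l1 k then a k else 0) * fchar k θ := by
      refine summable_mul_fchar (Summable.of_nonneg_of_le (fun k => norm_nonneg _)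
        (fun k => ?_) hn) θ
      split_ifs <;> simp
    convert hS.hasSum using 1
    beta_reduce
    rw [← (h θ).tsum_eq, hasSum_split hs.le ha (fun k => l1 k ≤ N ∧ (dot k ω : ℂ) - β ≠ 0) θ]
    suffices hs : ∑' k, (if l1 k ≤ N ∧ (dot k ω : ℂ) - β ≠ 0 then 0 else a k) * fchar k θ =
        (∑' k, (if N < l1 k then a k else 0) * fchar k θ) + m by
      rw [hs]
      ring
    have hm' : m = ∑' k, (if k = 0 ∧ β = 0 then a k else 0) * fchar k θ := by
      rw [tsum_eq_single 0 (fun k hk => by simp [hk])]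
      simp [hm]
    have hS' : Summable fun k => (if k = 0 ∧ β = 0 then a k else 0) * fchar k θ := by
      refine summable_mul_fchar (Summable.of_nonneg_of_le (fun k => norm_nonneg _)
        (fun k => ?_) hn) θ
      split_ifs <;> simp
    rw [hm', ← hS.tsum_add hS']
    refine tsum_congr fun k => ?_
    rw [← add_mul]
    congr 1
    by_cases hk0 : k = 0
    · subst hk0
      by_cases hβ : β = 0
      · simp [hβ, hN]
      · simp [hβ, hN]
    · by_cases hkN : l1 k ≤ N
      · simp [hk0, hkN, hnz k hk0 hkN]
      · simp [hk0, not_le.1 hkN, hkN]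
  · have := hUb κ⁻¹ s (by positivity) hs.le (key κ hκ hb)
    rwa [inv_mul_eq_div] at this

theorem one_add_pow_mul_exp_le {ς : ℝ} (hς : 0 < ς) (τ : ℕ) {y : ℝ} (hy : 0 ≤ y) :
    (1 + y) ^ τ ≤ τ.factorial * Real.exp ς / ς ^ τ * Real.exp (ς * y) := by
  have h := Real.pow_div_factorial_le_exp (ς * (1 + y)) (by positivity) τ
  rw [div_le_iff₀ (by positivity), mul_pow, mul_add, mul_one, Real.exp_add] at h
  rw [div_mul_eq_mul_div, le_div_iff₀ (by positivity)]
  linarith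

/-- The homological equation `D U = i β U + F - m` under a Diophantine condition. -/
theorem exists_diophantine (hF : InWiener s r F) (hs' : 0 < s') (hs : s' < s) (hr : 0 ≤ r)
    (ω : Fin n → ℝ) (β : ℂ) {κ₀ : ℝ} {τ₀ : ℕ} (hκ₀ : 0 < κ₀)
    (hnz : ∀ k : Fin n → ℤ, k ≠ 0 → (dot k ω : ℂ) - β ≠ 0)
    (h0 : ∀ k : Fin n → ℤ, (dot k ω : ℂ) - β ≠ 0 →
      κ₀ / (1 + l1 k) ^ τ₀ ≤ ‖(dot k ω : ℂ) - β‖) :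
    ∃ (U : (Fin n → ℝ) → ℂ) (m : ℂ), ‖m‖ ≤ r ∧ (β ≠ 0 → m = 0) ∧
      (∀ θ, dir ω U θ = Complex.I * β * U θ + F θ - m) ∧
      ∀ κ > (0 : ℝ), ∀ τ : ℕ, (∀ k : Fin n → ℤ, (dot k ω : ℂ) - β ≠ 0 →
        κ / (1 + l1 k) ^ τ ≤ ‖(dot k ω : ℂ) - β‖) →
        InWiener s' (τ.factorial * Real.exp (s - s') / (s - s') ^ τ * r / κ) U := by
  classical
  obtain ⟨a, ha, h⟩ := hF
  have hss : 0 < s - s' := sub_pos.2 hs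
  have key : ∀ κ > (0 : ℝ), ∀ τ : ℕ, (∀ k : Fin n → ℤ, (dot k ω : ℂ) - β ≠ 0 →
      κ / (1 + l1 k) ^ τ ≤ ‖(dot k ω : ℂ) - β‖) → ∀ k ∈ (Set.univ : Set (Fin n → ℤ)),
      ‖((dot k ω : ℂ) - β)⁻¹‖ ≤ (τ.factorial * Real.exp (s - s') / (s - s') ^ τ / κ) *
        Real.exp ((s - s') * l1 k) := by
    intro κ hκ τ hb k _
    have hl := l1_nonneg k
    rw [norm_inv]
    by_cases hd : (dot k ω : ℂ) - β = 0
    · rw [hd, norm_zero, _root_.inv_zero]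
      positivity
    · refine (inv_anti₀ (by positivity) (hb k hd)).trans ?_
      rw [inv_div, div_mul_eq_mul_div]
      gcongr
      exact one_add_pow_mul_exp_le hss τ hl
  obtain ⟨U, hU, hUb⟩ := exists_smallDivisor_solution (s' := s') hs' hs.le ω β ha
    Set.univ hr (by positivity) (key κ₀ hκ₀ τ₀ h0)
  refine ⟨U, if β = 0 then a 0 else 0, ?_, fun hβ => by simp [hβ], fun θ => ?_,
    fun κ hκ τ hb => ?_⟩
  · split_ifs
    · simpa using norm_coeff_le hr ha 0
    · simpa using hr
  · rw [hU θ, ← (h θ).tsum_eq, hasSum_split (hs'.le.trans hs.le) ha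
      (fun k => k ∈ (Set.univ : Set (Fin n → ℤ)) ∧ (dot k ω : ℂ) - β ≠ 0) θ]
    have : ∑' k, (if k ∈ (Set.univ : Set (Fin n → ℤ)) ∧ (dot k ω : ℂ) - β ≠ 0 then 0 else a k) *
        fchar k θ = if β = 0 then a 0 else 0 := by
      rw [tsum_eq_single 0 (fun k hk => by simp [hnz k hk])]
      by_cases hβ : β = 0 <;> simp [hβ]
    rw [this]
    ring
  · have := hUb _ s' (by positivity) hs'.le (key κ hκ τ hb)
    rwa [div_mul_eq_mul_div] at this

end InWiener

end QuasiPeriodic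

namespace QuasiPeriodic

open scoped ENNReal

variable {n : ℕ}

/-- `(w, Φ, β)` solves the quasi-periodic Riccati equation `D w = a₀ + b₀ w + c₀ w²` and the
equation `D Φ = b₀ + 2 c₀ w - i β` of its linearization up to errors of size `δ` and `γ`. -/
structure ApproxRiccati (ω : Fin n → ℝ) (a₀ b₀ c₀ : (Fin n → ℝ) → ℂ) (s P δ γ : ℝ)
    (w Φ : (Fin n → ℝ) → ℂ) (β : ℂ) : Prop where
  mem_w : InWiener s P w
  mem_Φ : InWiener s P Φ
  eq_w : ∃ a, InWiener s δ a ∧ ∀ θ, dir ω w θ =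
    a₀ θ + b₀ θ * w θ + c₀ θ * w θ ^ 2 - Complex.exp (Φ θ) * a θ
  eq_Φ : ∃ g, InWiener s γ g ∧ ∀ θ, dir ω Φ θ =
    b₀ θ + 2 * c₀ θ * w θ - Complex.I * β - g θ

theorem exp_le_three {r : ℝ} (hr : r ≤ 1) : Real.exp r ≤ 3 :=
  (Real.exp_le_exp.2 hr).trans (Real.exp_one_lt_d9.le.trans (by norm_num))

theorem exp_le_two {r : ℝ} (hr : r ≤ 1 / 2) : Real.exp r ≤ 2 := by
  have h1 : Real.exp r ≤ Real.exp (1 / 2) := Real.exp_le_exp.2 hr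
  have h2 : Real.exp (1 / 2) * Real.exp (1 / 2) = Real.exp 1 := by
    rw [← Real.exp_add]
    norm_num
  have h3 := exp_le_three le_rfl
  nlinarith [Real.exp_pos (1 / 2)]

/-- One Newton step for the quasi-periodic Riccati equation. -/
theorem ApproxRiccati.exists_step {ω : Fin n → ℝ} {a₀ b₀ c₀ : (Fin n → ℝ) → ℂ}
    {s P δ γ η ς N κ : ℝ} {w Φ : (Fin n → ℝ) → ℂ} {β : ℂ}
    (h : ApproxRiccati ω a₀ b₀ c₀ s P δ γ w Φ β) (hP0 : 0 ≤ P) (hP : P ≤ 1) (hδ : 0 ≤ δ)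
    (hγ : 0 ≤ γ) (hη : 0 ≤ η) (hc : InWiener s η c₀) (hς : 0 ≤ ς) (hs : ς < s) (hN : 0 ≤ N)
    (hκ : 0 < κ)
    (hres : ∀ k : Fin n → ℤ, l1 k ≤ N → κ ≤ ‖(dot k ω : ℂ) - β‖)
    (hdio : ∀ k : Fin n → ℤ, k ≠ 0 → l1 k ≤ N → κ ≤ |dot k ω|)
    {G : ℝ} (hG : γ + 6 * η * (δ / κ) ≤ G) (hGκ : G / κ ≤ 1 / 2) :
    ∃ (w' Φ' : (Fin n → ℝ) → ℂ) (β' : ℂ), ‖β' - β‖ ≤ G ∧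
      ApproxRiccati ω a₀ b₀ c₀ (s - ς) (P + max (3 * (δ / κ)) (G / κ))
        (2 * (3 * η * (δ / κ) ^ 2 + γ * (δ / κ) + Real.exp (-(ς * N)) * δ))
        (Real.exp (-(ς * N)) * G) w' Φ' β' ∧
      ∀ κ' > (0 : ℝ), (∀ k : Fin n → ℤ, l1 k ≤ N → κ' ≤ ‖(dot k ω : ℂ) - β‖) →
        (∀ k : Fin n → ℤ, k ≠ 0 → l1 k ≤ N → κ' ≤ |dot k ω|) →
        InWiener s (3 * (δ / κ')) (fun θ => w' θ - w θ) ∧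
        InWiener s (G / κ') (fun θ => Φ' θ - Φ θ) := by
  obtain ⟨hw, hΦ, ⟨a, ha, hwe⟩, ⟨g, hg, hΦe⟩⟩ := h
  have hs0 : 0 < s := hς.trans_lt hs
  have hG0 : 0 ≤ G := le_trans (by positivity) hG
  have hres' : ∀ k : Fin n → ℤ, l1 k ≤ N → (dot k ω : ℂ) - β ≠ 0 := fun k hk h0 => by
    have := hres k hk
    rw [h0, norm_zero] at this
    linarith
  have hβ : β ≠ 0 := by
    have := hres' 0 (by simpa using hN)
    simpa using this
  obtain ⟨u, R, m₀, -, hm₀, hue, hR, hub⟩ := ha.exists_truncated hs0 hδ ω β hς hN hκ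
    (fun k _ hk => hres' k hk) (fun k hk _ => hres k hk)
  rw [hm₀ hβ] at hue
  have hu := hub κ hκ (fun k hk _ => hres k hk)
  have hexp : InWiener s 3 (fun θ => Complex.exp (Φ θ)) :=
    (hΦ.exp hs0.le hP0).mono le_rfl (exp_le_three hP)
  have hEu : ∀ κ' > (0 : ℝ), (∀ k : Fin n → ℤ, l1 k ≤ N → κ' ≤ ‖(dot k ω : ℂ) - β‖) →
      InWiener s (3 * (δ / κ')) (fun θ => Complex.exp (Φ θ) * u θ) := fun κ' hκ' hk =>
    hexp.mul (hub κ' hκ' fun k hk' _ => hk k hk') hs0.le (by norm_num)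
  set v : (Fin n → ℝ) → ℂ := fun θ => Complex.exp (Φ θ) * u θ with hv
  have hvW := hEu κ hκ hres
  have hgt : InWiener s G (fun θ => g θ + 2 * (c₀ θ * v θ)) := by
    have h2 : InWiener s (2 * (η * (3 * (δ / κ)))) (fun θ => 2 * (c₀ θ * v θ)) :=
      (hc.mul hvW hs0.le hη).const_mul 2 (by simp)
    refine (hg.add h2 hγ (by positivity)).mono le_rfl (le_trans (le_of_eq ?_) hG)
    ring
  obtain ⟨φ, R', m, hm, -, hφe, hR', hφb⟩ := hgt.exists_truncated hs0 hG0 ω 0 hς hN hκ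
    (fun k hk hkN h0 => by
      have := hdio k hk hkN
      rw [sub_zero, Complex.ofReal_eq_zero] at h0
      rw [h0, abs_zero] at this
      linarith)
    (fun k hkN h0 => by
      rw [sub_zero, Complex.norm_real, Real.norm_eq_abs]
      refine hdio k (fun h => h0 ?_) hkN
      simp [h])
  have hφb' : ∀ κ' > (0 : ℝ), (∀ k : Fin n → ℤ, k ≠ 0 → l1 k ≤ N → κ' ≤ |dot k ω|) →
      InWiener s (G / κ') φ := fun κ' hκ' hk => hφb κ' hκ' fun k hkN h0 => by
    rw [sub_zero, Complex.norm_real, Real.norm_eq_abs]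
    refine hk k (fun h => h0 ?_) hkN
    simp [h]
  have hφ := hφb' κ hκ hdio
  have hss : s - ς ≤ s := sub_le_self _ hς
  have hss0 : 0 ≤ s - ς := (sub_pos.2 hs).le
  refine ⟨fun θ => w θ + v θ, fun θ => Φ θ + φ θ, β - Complex.I * m, ?_, ⟨?_, ?_, ?_, ?_⟩, ?_⟩
  · simpa using hm
  · exact (hw.add hvW hP0 (by positivity)).mono hss (by gcongr; exact le_max_left _ _)
  · exact (hΦ.add hφ hP0 (by positivity)).mono hss (by gcongr; exact le_max_right _ _)
  · refine ⟨fun θ => Complex.exp (-φ θ) * (c₀ θ * Complex.exp (Φ θ) * u θ ^ 2 + g θ * u θ + R θ),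
      ?_, fun θ => ?_⟩
    · have h1 : InWiener (s - ς) 2 (fun θ => Complex.exp (-φ θ)) :=
        ((hφ.neg.exp hs0.le (by positivity)).mono hss (exp_le_two hGκ))
      have h2 : InWiener s (η * 3 * (δ / κ) ^ 2) (fun θ => c₀ θ * Complex.exp (Φ θ) * u θ ^ 2) :=
        (hc.mul hexp hs0.le hη).mul (hu.pow hs0.le (by positivity) 2) hs0.le (by positivity)
      have h3 : InWiener s (γ * (δ / κ)) (fun θ => g θ * u θ) := hg.mul hu hs0.le hγ
      have h4 := h1.mul ((((h2.add h3 (by positivity) (by positivity)).mono hss le_rfl).add hR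
        (by positivity) (by positivity))) hss0 (by norm_num)
      refine h4.mono le_rfl (le_of_eq ?_)
      ring
    · have hd : dir ω (fun θ => w θ + v θ) θ =
          dir ω w θ + (Complex.exp (Φ θ) * dir ω Φ θ * u θ + Complex.exp (Φ θ) * dir ω u θ) := by
        have := (hw.hasDerivAt_dir hs0 ω θ).add
          (((hΦ.hasDerivAt_dir hs0 ω θ).cexp).mul (hu.hasDerivAt_dir hs0 ω θ))
        exact (this.congr_deriv (by simp)).deriv
      rw [hd, hwe, hΦe, hue]
      have he : Complex.exp (Φ θ + φ θ) * (Complex.exp (-φ θ) *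
          (c₀ θ * Complex.exp (Φ θ) * u θ ^ 2 + g θ * u θ + R θ)) =
          Complex.exp (Φ θ) * (c₀ θ * Complex.exp (Φ θ) * u θ ^ 2 + g θ * u θ + R θ) := by
        rw [← mul_assoc, ← Complex.exp_add, add_neg_cancel_right]
      rw [he]
      simp only [hv]
      ring
  · refine ⟨R', hR', fun θ => ?_⟩
    have hd : dir ω (fun θ => Φ θ + φ θ) θ = dir ω Φ θ + dir ω φ θ :=
      ((hΦ.hasDerivAt_dir hs0 ω θ).add (hφ.hasDerivAt_dir hs0 ω θ)).deriv
    rw [hd, hΦe, hφe]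
    linear_combination (-m) * Complex.I_mul_I
  · intro κ' hκ' h1 h2
    constructor
    · simpa using hEu κ' hκ' h1
    · simpa using hφb' κ' hκ' h2

end QuasiPeriodic

namespace QuasiPeriodic

open scoped ENNReal

variable {n : ℕ}

/-- States of the Newton iteration. -/
abbrev NewtonState (n : ℕ) : Type := ((Fin n → ℝ) → ℂ) × ((Fin n → ℝ) → ℂ) × ℂ

/-- The non-resonance condition of the `m`-th Newton step. -/
def NonResonant (ρ x : ℝ) (L : ℕ) (ω : Fin n → ℝ) (m : ℕ) (β : ℂ) : Prop :=
  ∀ k : Fin n → ℤ, l1 k ≤ L * 2 ^ m →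
    x * ρ ^ m ≤ |dot k ω - β.re| ∧ (k ≠ 0 → x * ρ ^ m ≤ |dot k ω|)

/-- The estimates that hold after `m` Newton steps. -/
def NewtonInvariant (a₀ b₀ c₀ : (Fin n → ℝ) → ℂ) (β₀ : ℂ) (s₀ C₀ ρ x : ℝ) (ω : Fin n → ℝ) (m : ℕ)
    (X : NewtonState n) : Prop :=
  ApproxRiccati ω a₀ b₀ c₀ (s₀ / 2 + s₀ / 2 * (1 / 2) ^ m) (6 * C₀ * x ^ 8 * (1 - (1 / 2) ^ m))
    (C₀ * x ^ 9 * ρ ^ (3 * m)) (C₀ * x ^ 9 * ρ ^ (2 * m)) X.1 X.2.1 X.2.2 ∧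
  ‖X.2.2 - β₀‖ ≤ 4 * C₀ * x ^ 9 * (1 - (1 / 2) ^ m)

/-- The size of the `m`-th Newton step. -/
def NewtonClose (s₀ C₀ ρ x : ℝ) (L : ℕ) (ω : Fin n → ℝ) (m : ℕ) (X X' : NewtonState n) : Prop :=
  ‖X'.2.2 - X.2.2‖ ≤ 2 * C₀ * x ^ 9 * ρ ^ (2 * m) ∧
  ∀ κ > (0 : ℝ), (∀ k : Fin n → ℤ, l1 k ≤ L * 2 ^ m → κ ≤ |dot k ω - X.2.2.re|) →
    (∀ k : Fin n → ℤ, k ≠ 0 → l1 k ≤ L * 2 ^ m → κ ≤ |dot k ω|) →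
    InWiener (s₀ / 2) (3 * (C₀ * x ^ 9 * ρ ^ (3 * m) / κ)) (fun θ => X'.1 θ - X.1 θ) ∧
    InWiener (s₀ / 2) (2 * (C₀ * x ^ 9 * ρ ^ (2 * m) / κ)) (fun θ => X'.2.1 θ - X.2.1 θ)

/-- The smallness conditions on the parameters of the Newton iteration. -/
structure NewtonParameters (s₀ C₀ ρ x : ℝ) (L : ℕ) : Prop where
  s_pos : 0 < s₀
  one_le_C : 1 ≤ C₀
  ρ_pos : 0 < ρ
  ρ_le : ρ ≤ 1 / 2
  x_pos : 0 < x
  x_le : x ≤ 1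
  small : 24 * C₀ * x ^ 8 ≤ ρ ^ 3
  cutoff : Real.exp (-(s₀ * L / 8)) ≤ ρ ^ 3 / 8

theorem abs_sub_re_le (d : ℝ) (β : ℂ) : |d - β.re| ≤ ‖(d : ℂ) - β‖ := by
  simpa using Complex.abs_re_le_norm ((d : ℂ) - β)

theorem newton_error_le {x y q ρ e : ℝ} (hx : 0 ≤ x) (hy : 0 ≤ y) (hq : 0 ≤ q) (hq1 : q ≤ 1)
    (hρ : 0 ≤ ρ) (hyρ : 24 * y ≤ ρ ^ 3) (hy1 : y ≤ 1 / 24) (he : e ≤ ρ ^ 3 / 8) :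
    2 * (3 * (x * y) * (y * q ^ 2) ^ 2 + x * y * q ^ 2 * (y * q ^ 2) + e * (x * y * q ^ 3)) ≤
      x * y * q ^ 3 * ρ ^ 3 := by
  have hq4 : q ^ 4 ≤ q ^ 3 := pow_le_pow_of_le_one hq hq1 (by norm_num)
  have t1 : 3 * (x * y) * (y * q ^ 2) ^ 2 ≤ x * y * (y * q ^ 3) := by
    have : 3 * (x * y) * (y * q ^ 2) ^ 2 = x * y * (3 * y * (y * q ^ 4)) := by ring
    rw [this]
    have : y * q ^ 4 ≤ y * q ^ 3 := by gcongr
    have h5 : 0 ≤ y * q ^ 4 := by positivity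
    have : 3 * y * (y * q ^ 4) ≤ y * q ^ 3 := by nlinarith
    gcongr
  have t2 : x * y * q ^ 2 * (y * q ^ 2) ≤ x * y * (y * q ^ 3) := by
    have : x * y * q ^ 2 * (y * q ^ 2) = x * y * (y * q ^ 4) := by ring
    rw [this]
    gcongr
  have t3 : e * (x * y * q ^ 3) ≤ ρ ^ 3 / 8 * (x * y * q ^ 3) := by gcongr
  have t4 : x * y * (y * q ^ 3) ≤ ρ ^ 3 / 24 * (x * y * q ^ 3) := by
    have : x * y * (y * q ^ 3) = y * (x * y * q ^ 3) := by ring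
    rw [this]
    gcongr
    linarith
  have t5 : 0 ≤ ρ ^ 3 * (x * y * q ^ 3) := by positivity
  linarith

set_option maxHeartbeats 800000 in
theorem NewtonInvariant.exists_step {a₀ b₀ c₀ : (Fin n → ℝ) → ℂ} {β₀ : ℂ} {s₀ C₀ ρ x : ℝ} {L : ℕ}
    (hp : NewtonParameters s₀ C₀ ρ x L) (hc : InWiener s₀ (C₀ * x ^ 9) c₀)
    {ω : Fin n → ℝ} {m : ℕ} {X : NewtonState n}
    (hX : NewtonInvariant a₀ b₀ c₀ β₀ s₀ C₀ ρ x ω m X) (hres : NonResonant ρ x L ω m X.2.2) :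
    ∃ X', NewtonInvariant a₀ b₀ c₀ β₀ s₀ C₀ ρ x ω (m + 1) X' ∧
      NewtonClose s₀ C₀ ρ x L ω m X X' := by
  obtain ⟨hs, hC, hρ, hρ2, hx, hx1, hsmall, hcut⟩ := hp
  obtain ⟨hA, hβ⟩ := hX
  have hC0 : 0 < C₀ := by linarith
  have hh : (0 : ℝ) < (1 / 2) ^ m := by positivity
  have hh1 : ((1 : ℝ) / 2) ^ m ≤ 1 := pow_le_one₀ (by norm_num) (by norm_num)
  have hρm : ρ ^ m ≤ (1 / 2) ^ m := pow_le_pow_left₀ hρ.le hρ2 m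
  have hρm1 : ρ ^ m ≤ 1 := hρm.trans hh1
  have hρm0 : 0 < ρ ^ m := by positivity
  have hρ3 : ρ ^ 3 ≤ 1 / 8 := (pow_le_pow_left₀ hρ.le hρ2 3).trans (by norm_num)
  set y := C₀ * x ^ 8 with hy
  have hy0 : 0 < y := by positivity
  have hysm : 24 * y ≤ ρ ^ 3 := by rw [hy]; linarith
  have hCx : C₀ * x ^ 9 = x * y := by rw [hy]; ring
  have h3m : ρ ^ (3 * m) = (ρ ^ m) ^ 3 := by rw [← pow_mul, mul_comm]
  have h2m : ρ ^ (2 * m) = (ρ ^ m) ^ 2 := by rw [← pow_mul, mul_comm]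
  have hδκ : C₀ * x ^ 9 * ρ ^ (3 * m) / (x * ρ ^ m) = y * (ρ ^ m) ^ 2 := by
    rw [hCx, h3m]
    field_simp
  have hGκ : 2 * (C₀ * x ^ 9 * ρ ^ (2 * m)) / (x * ρ ^ m) = 2 * y * ρ ^ m := by
    rw [hCx, h2m]
    field_simp
  have hyx : x * y ≤ y := by nlinarith
  have hp1 : ((1 : ℝ) / 2) ^ (m + 1) = (1 / 2) ^ m * (1 / 2) := pow_succ _ _
  have hmax : max (3 * (y * (ρ ^ m) ^ 2)) (2 * y * ρ ^ m) ≤ 3 * y * (1 / 2) ^ m := by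
    have h1 : (ρ ^ m) ^ 2 ≤ (1 / 2) ^ m := by nlinarith
    refine max_le ?_ ?_
    · rw [← mul_assoc]
      gcongr
    · gcongr
      norm_num
  have hcutN : Real.exp (-(s₀ / 4 * (1 / 2) ^ m * (L * 2 ^ m))) ≤ ρ ^ 3 / 8 := by
    have : s₀ / 4 * (1 / 2) ^ m * (L * 2 ^ m) = s₀ * L / 4 := by
      have : ((1 : ℝ) / 2) ^ m * 2 ^ m = 1 := by rw [← mul_pow]; norm_num
      linear_combination (s₀ / 4 * L) * this
    rw [this]
    refine le_trans (Real.exp_le_exp.2 ?_) hcut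
    have : 0 ≤ s₀ * L := by positivity
    linarith
  obtain ⟨w', Φ', β', hβ', hA', hcl⟩ := hA.exists_step (η := C₀ * x ^ 9)
    (ς := s₀ / 4 * (1 / 2) ^ m) (N := L * 2 ^ m) (κ := x * ρ ^ m)
    (G := 2 * (C₀ * x ^ 9 * ρ ^ (2 * m)))
    (by have := sub_nonneg.2 hh1; positivity)
    (by
      have h1 : 0 ≤ 1 - ((1 : ℝ) / 2) ^ m := sub_nonneg.2 hh1
      have h2 : 1 - ((1 : ℝ) / 2) ^ m ≤ 1 := by linarith
      have h3 : 6 * C₀ * x ^ 8 ≤ 1 := by rw [mul_assoc, ← hy]; linarith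
      exact mul_le_one₀ h3 h1 h2)
    (by positivity) (by positivity) (by positivity)
    (hc.mono (by nlinarith) le_rfl) (by positivity) (by nlinarith) (by positivity) (by positivity)
    (fun k hk => (hres k hk).1.trans (abs_sub_re_le _ _)) (fun k hk0 hk => (hres k hk).2 hk0)
    (by
      rw [hδκ, hCx, h2m]
      have : 0 ≤ x * y * (ρ ^ m) ^ 2 := by positivity
      nlinarith)
    (by
      rw [hGκ]
      nlinarith)
  refine ⟨(w', Φ', β'), ⟨⟨?_, ?_, ?_, ?_⟩, ?_⟩, ?_, ?_⟩
  · refine hA'.mem_w.mono (le_of_eq (by ring)) ?_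
    rw [hδκ, hGκ, hp1, mul_assoc 6, ← hy]
    linarith
  · refine hA'.mem_Φ.mono (le_of_eq (by ring)) ?_
    rw [hδκ, hGκ, hp1, mul_assoc 6, ← hy]
    linarith
  · obtain ⟨a, ha, he⟩ := hA'.eq_w
    refine ⟨a, ha.mono (le_of_eq (by ring)) ?_, he⟩
    rw [hδκ, hCx, h2m, h3m]
    have e1 : ρ ^ (3 * (m + 1)) = (ρ ^ m) ^ 3 * ρ ^ 3 := by
      rw [← pow_mul, ← pow_add]
      ring_nf
    rw [e1]
    refine (newton_error_le hx.le hy0.le hρm0.le hρm1 hρ.le hysm (by linarith) hcutN).trans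
      (le_of_eq ?_)
    ring
  · obtain ⟨g, hg, he⟩ := hA'.eq_Φ
    refine ⟨g, hg.mono (le_of_eq (by ring)) ?_, he⟩
    have e1 : ρ ^ (2 * (m + 1)) = ρ ^ (2 * m) * ρ ^ 2 := by
      rw [← pow_add]
      ring_nf
    rw [e1]
    have hρ32 : ρ ^ 3 ≤ ρ ^ 2 := pow_le_pow_of_le_one hρ.le (by linarith) (by norm_num)
    calc _ ≤ ρ ^ 3 / 8 * (2 * (C₀ * x ^ 9 * ρ ^ (2 * m))) := by gcongr
      _ = ρ ^ 3 / 4 * (C₀ * x ^ 9 * ρ ^ (2 * m)) := by ring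
      _ ≤ ρ ^ 2 * (C₀ * x ^ 9 * ρ ^ (2 * m)) := by
        gcongr
        have : 0 ≤ ρ ^ 3 := by positivity
        linarith
      _ = _ := by ring
  · have h1 : β' - β₀ = (β' - X.2.2) + (X.2.2 - β₀) := by ring
    change ‖β' - β₀‖ ≤ _
    rw [h1]
    refine (norm_add_le _ _).trans ?_
    have h2 : 2 * (C₀ * x ^ 9 * ρ ^ (2 * m)) ≤ 2 * (C₀ * x ^ 9 * (1 / 2) ^ m) := by
      rw [h2m]
      gcongr
      nlinarith
    rw [hp1]
    linarith
  · exact hβ'.trans (le_of_eq (by ring))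
  · intro κ hκ h1 h2
    obtain ⟨i1, i2⟩ := hcl κ hκ (fun k hk => (h1 k hk).trans (abs_sub_re_le _ _)) h2
    have hs2 : s₀ / 2 ≤ s₀ / 2 + s₀ / 2 * (1 / 2) ^ m := by
      have : 0 ≤ s₀ / 2 * (1 / 2) ^ m := by positivity
      linarith
    exact ⟨i1.mono hs2 le_rfl, i2.mono hs2 (le_of_eq (by ring))⟩

theorem newtonInvariant_zero {A B c₀ : (Fin n → ℝ) → ℂ} {β₀ : ℂ} {s₀ C₀ ρ x : ℝ}
    (hA : InWiener s₀ (C₀ * x ^ 9) A) (hB : InWiener s₀ (C₀ * x ^ 9) B) (ω : Fin n → ℝ) :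
    NewtonInvariant A (fun θ => Complex.I * β₀ + B θ) c₀ β₀ s₀ C₀ ρ x ω 0 (0, 0, β₀) := by
  have hz : InWiener (s₀ / 2 + s₀ / 2 * (1 / 2) ^ 0) (6 * C₀ * x ^ 8 * (1 - (1 / 2) ^ 0))
      (0 : (Fin n → ℝ) → ℂ) := InWiener.const 0 (by simp)
  have hd : ∀ θ, dir ω (0 : (Fin n → ℝ) → ℂ) θ = 0 := fun θ => by simp [dir]
  have e : s₀ / 2 + s₀ / 2 * (1 / 2) ^ 0 ≤ s₀ := by simp
  refine ⟨⟨hz, hz, ⟨A, hA.mono e (by simp), fun θ => ?_⟩, ⟨B, hB.mono e (by simp), fun θ => ?_⟩⟩,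
    by simp⟩
  · rw [hd]
    simp
  · rw [hd]
    simp

/-- The Newton iterates, for all frequencies at once. -/
theorem exists_newtonSequence {A B c₀ : (Fin n → ℝ) → ℂ} {β₀ : ℂ} {s₀ C₀ ρ x : ℝ} {L : ℕ}
    (hp : NewtonParameters s₀ C₀ ρ x L) (hA : InWiener s₀ (C₀ * x ^ 9) A)
    (hB : InWiener s₀ (C₀ * x ^ 9) B) (hc : InWiener s₀ (C₀ * x ^ 9) c₀) :
    ∃ X : ℕ → (Fin n → ℝ) → NewtonState n, (∀ ω, X 0 ω = (0, 0, β₀)) ∧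
      ∀ ω m, (∀ j < m, NonResonant ρ x L ω j (X j ω).2.2) →
        NewtonInvariant A (fun θ => Complex.I * β₀ + B θ) c₀ β₀ s₀ C₀ ρ x ω m (X m ω) ∧
        ∀ j < m, NewtonClose s₀ C₀ ρ x L ω j (X j ω) (X (j + 1) ω) := by
  classical
  have hstep : ∀ (ω : Fin n → ℝ) (m : ℕ) (Y : NewtonState n), ∃ Y',
      NewtonInvariant A (fun θ => Complex.I * β₀ + B θ) c₀ β₀ s₀ C₀ ρ x ω m Y →
      NonResonant ρ x L ω m Y.2.2 →
      NewtonInvariant A (fun θ => Complex.I * β₀ + B θ) c₀ β₀ s₀ C₀ ρ x ω (m + 1) Y' ∧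
      NewtonClose s₀ C₀ ρ x L ω m Y Y' := by
    intro ω m Y
    by_cases h : NewtonInvariant A (fun θ => Complex.I * β₀ + B θ) c₀ β₀ s₀ C₀ ρ x ω m Y ∧
        NonResonant ρ x L ω m Y.2.2
    · obtain ⟨Y', hY'⟩ := h.1.exists_step hp hc h.2
      exact ⟨Y', fun _ _ => hY'⟩
    · exact ⟨Y, fun h1 h2 => (h ⟨h1, h2⟩).elim⟩
  choose next hnext using hstep
  refine ⟨fun m ω => Nat.rec (0, 0, β₀) (fun j Y => next ω j Y) m, fun ω => rfl, fun ω m => ?_⟩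
  induction m with
  | zero => exact fun _ => ⟨newtonInvariant_zero hA hB ω, fun j hj => by omega⟩
  | succ m ih =>
    intro h
    obtain ⟨h1, h2⟩ := ih (fun j hj => h j (by omega))
    have h3 := hnext ω m _ h1 (h m (by omega))
    refine ⟨h3.1, fun j hj => ?_⟩
    rcases Nat.lt_succ_iff_lt_or_eq.1 hj with hj | rfl
    · exact h2 j hj
    · exact h3.2

/-- Limits of sequences whose increments decay geometrically. -/
theorem exists_wienerLimit {s c : ℝ} (hs : 0 ≤ s) (hc : 0 ≤ c) {F : ℕ → (Fin n → ℝ) → ℂ}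
    (hF : ∀ m, InWiener s (c * (1 / 2) ^ m) (fun θ => F (m + 1) θ - F m θ)) :
    ∃ H : (Fin n → ℝ) → ℂ, ∀ c' : ℝ, 0 ≤ c' → ∀ M,
      (∀ m, InWiener s (c' * (1 / 2) ^ m) (fun θ => F (M + m + 1) θ - F (M + m) θ)) →
      InWiener s (2 * c') (fun θ => H θ - F M θ) := by
  have hg : Summable fun m : ℕ => ((1 : ℝ) / 2) ^ m :=
    summable_geometric_of_lt_one (by norm_num) (by norm_num)
  have hsum : ∀ θ, Summable fun m => F (m + 1) θ - F m θ := fun θ =>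
    Summable.of_norm_bounded (hg.mul_left c) fun m => (hF m).norm_le hs (by positivity) θ
  refine ⟨fun θ => (∑' m, (F (m + 1) θ - F m θ)) + F 0 θ, fun c' hc' M hM => ?_⟩
  have h := InWiener.tsum (F := fun m θ => F (M + m + 1) θ - F (M + m) θ) hs hM
    (fun m => by positivity) (hg.mul_left c')
    (H := fun θ => (∑' m, (F (m + 1) θ - F m θ)) + F 0 θ - F M θ) (fun θ => by
      have := (hasSum_nat_add_iff' M).2 (hsum θ).hasSum
      rw [Finset.sum_range_sub (fun m => F m θ)] at this
      have e : (∑' m, (F (m + 1) θ - F m θ)) + F 0 θ - F M θ =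
          (∑' m, (F (m + 1) θ - F m θ)) - (F M θ - F 0 θ) := by ring
      rw [e]
      simpa only [add_comm M] using this)
  rw [tsum_mul_left, tsum_geometric_two] at h
  exact h.mono le_rfl (by linarith)

end QuasiPeriodic

namespace QuasiPeriodic

open scoped ENNReal

variable {n : ℕ}

theorem norm_le_of_bounded_solution {y e : ℝ → ℂ} {lam : ℂ} {E : ℝ} (hE : 0 ≤ E)
    (hy : ∀ t, HasDerivAt y (Complex.I * lam * y t + e t) t) (h1 : ∀ t, ‖y t - 1‖ ≤ 1 / 2)
    (he : ∀ t, ‖e t‖ ≤ E) : ‖lam‖ ≤ 2 * E := by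
  by_contra! hlam
  set c := ‖lam‖ ^ 2 / 2 - ‖lam‖ * E with hc
  have hc0 : 0 < c := by
    have : 0 < ‖lam‖ := by linarith
    rw [hc]
    nlinarith
  set μ := starRingEnd ℂ (Complex.I * lam) with hμ
  have hμn : ‖μ‖ = ‖lam‖ := by rw [hμ, RCLike.norm_conj, norm_mul, Complex.norm_I, one_mul]
  have hμμ : μ * (Complex.I * lam) = ((‖lam‖ ^ 2 : ℝ) : ℂ) := by
    rw [hμ, mul_comm, Complex.mul_conj, Complex.normSq_eq_norm_sq, norm_mul, Complex.norm_I,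
      one_mul]
  have hd : ∀ t, HasDerivAt (fun t => (μ * y t).re)
      (μ * (Complex.I * lam * y t + e t)).re t := fun t => by
    have := ((hy t).const_mul μ)
    exact (Complex.reCLM.hasFDerivAt.comp_hasDerivAt t this)
  have hge : ∀ t, c ≤ (μ * (Complex.I * lam * y t + e t)).re := fun t => by
    have e1 : μ * (Complex.I * lam * y t + e t) =
        ((‖lam‖ ^ 2 : ℝ) : ℂ) * y t + μ * e t := by
      rw [← hμμ]
      ring
    rw [e1, Complex.add_re, Complex.re_ofReal_mul]
    have h2 : 1 / 2 ≤ (y t).re := by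
      have := (Complex.abs_re_le_norm (y t - 1)).trans (h1 t)
      rw [Complex.sub_re, Complex.one_re, abs_le] at this
      linarith
    have h3 : -(‖lam‖ * E) ≤ (μ * e t).re := by
      have := (Complex.abs_re_le_norm (μ * e t))
      rw [norm_mul, hμn] at this
      have h4 : ‖lam‖ * ‖e t‖ ≤ ‖lam‖ * E := by gcongr; exact he t
      exact (abs_le.1 (this.trans h4)).1
    nlinarith [sq_nonneg ‖lam‖]
  have hb : ∀ t, |(μ * y t).re| ≤ ‖lam‖ * (3 / 2) := fun t => by
    refine (Complex.abs_re_le_norm _).trans ?_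
    rw [norm_mul, hμn]
    gcongr
    calc ‖y t‖ = ‖(y t - 1) + 1‖ := by ring_nf
      _ ≤ ‖y t - 1‖ + ‖(1 : ℂ)‖ := norm_add_le _ _
      _ ≤ 3 / 2 := by
        have := h1 t
        rw [norm_one]
        linarith
  have hT : (0 : ℝ) ≤ 4 * ‖lam‖ / c := by positivity
  have := mul_sub_le_image_sub_of_le_deriv (fun t => (hd t).differentiableAt)
    (C := c) (fun t => by rw [(hd t).deriv]; exact hge t) hT
  have e2 : c * (4 * ‖lam‖ / c - 0) = 4 * ‖lam‖ := by field_simp; ring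
  rw [e2] at this
  have h5 := abs_le.1 (hb (4 * ‖lam‖ / c))
  have h6 := abs_le.1 (hb 0)
  have : 0 < ‖lam‖ := by linarith
  linarith

/-- Approximate Lipschitz dependence of the exponent `β` on the frequency. -/
theorem ApproxRiccati.norm_sub_conj_le {ω ω' : Fin n → ℝ} {a₀ b₀ c₀ : (Fin n → ℝ) → ℂ}
    {s P δ γ : ℝ} {w Φ w' Φ' : (Fin n → ℝ) → ℂ} {β β' : ℂ}
    (h : ApproxRiccati ω a₀ b₀ c₀ s P δ γ w Φ β) (h' : ApproxRiccati ω' a₀ b₀ c₀ s P δ γ w' Φ' β')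
    (hs : 0 < s) (hP0 : 0 ≤ P) (hP : P ≤ 1 / 8) (hδ : 0 ≤ δ) (hγ : 0 ≤ γ)
    (ha : ∀ θ, starRingEnd ℂ (a₀ θ) = -c₀ θ) (hb : ∀ θ, starRingEnd ℂ (b₀ θ) = -b₀ θ) :
    ‖β' - starRingEnd ℂ β‖ ≤ 16 * (P / s * ‖ω' - ω‖) + 48 * δ + 16 * γ := by
  obtain ⟨hw, hΦ, ⟨a, haW, hwe⟩, ⟨g, hgW, hΦe⟩⟩ := h
  obtain ⟨hw', hΦ', ⟨a', haW', hwe'⟩, ⟨g', hgW', hΦe'⟩⟩ := h'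
  set d := P / s * ‖ω' - ω‖ with hd
  have hd0 : 0 ≤ d := by positivity
  have hexp3 : ∀ {Φ : (Fin n → ℝ) → ℂ}, InWiener s P Φ → ∀ θ, ‖Complex.exp (Φ θ)‖ ≤ 3 :=
    fun hΦ θ => (Complex.norm_exp_le_exp_norm _).trans
      (exp_le_three ((hΦ.norm_le hs.le hP0 θ).trans (by linarith)))
  have hc : ∀ θ, starRingEnd ℂ (c₀ θ) = -a₀ θ := fun θ => by
    rw [← neg_neg (c₀ θ), ← ha θ, map_neg, Complex.conj_conj]
  -- the errors of the pulled back solution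
  let e1 : (Fin n → ℝ) → ℂ := fun θ => (dir ω' w θ - dir ω w θ) - Complex.exp (Φ θ) * a θ
  let e2 : (Fin n → ℝ) → ℂ := fun θ => (dir ω' Φ θ - dir ω Φ θ) - g θ
  let e1' : (Fin n → ℝ) → ℂ := fun θ => -(Complex.exp (Φ' θ) * a' θ)
  have n1' : ∀ θ, ‖e1' θ‖ ≤ 3 * δ := fun θ => by
    simp only [e1', norm_neg, norm_mul]
    exact mul_le_mul (hexp3 hΦ' θ) (haW'.norm_le hs.le hδ θ) (norm_nonneg _) (by norm_num)
  have n1 : ∀ θ, ‖e1 θ‖ ≤ d + 3 * δ := fun θ => by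
    refine (norm_sub_le _ _).trans (add_le_add (hw.norm_dir_sub_le hs hP0 _ _ θ) ?_)
    rw [norm_mul]
    exact mul_le_mul (hexp3 hΦ θ) (haW.norm_le hs.le hδ θ) (norm_nonneg _) (by norm_num)
  have n2 : ∀ θ, ‖e2 θ‖ ≤ d + γ := fun θ =>
    (norm_sub_le _ _).trans (add_le_add (hΦ.norm_dir_sub_le hs hP0 _ _ θ)
      (hgW.norm_le hs.le hγ θ))
  have n2' : ∀ θ, ‖g' θ‖ ≤ γ := fun θ => hgW'.norm_le hs.le hγ θ
  have nw : ∀ θ, ‖w θ‖ ≤ P := fun θ => hw.norm_le hs.le hP0 θ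
  have nw' : ∀ θ, ‖w' θ‖ ≤ P := fun θ => hw'.norm_le hs.le hP0 θ
  have nz : ∀ θ, ‖-(starRingEnd ℂ (Φ θ) + Φ' θ) / 2‖ ≤ P := fun θ => by
    rw [norm_div, norm_neg]
    have h1 := norm_add_le (starRingEnd ℂ (Φ θ)) (Φ' θ)
    rw [RCLike.norm_conj] at h1
    have h2 := hΦ.norm_le hs.le hP0 θ
    have h3 := hΦ'.norm_le hs.le hP0 θ
    rw [show ‖(2 : ℂ)‖ = 2 by simp]
    linarith
  let N : (Fin n → ℝ) → ℂ := fun θ => 1 - starRingEnd ℂ (w θ) * w' θ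
  let Ex : (Fin n → ℝ) → ℂ := fun θ => Complex.exp (-(starRingEnd ℂ (Φ θ) + Φ' θ) / 2)
  let err : (Fin n → ℝ) → ℂ := fun θ => Ex θ * (N θ * (-(starRingEnd ℂ (e2 θ) - g' θ) / 2) -
    starRingEnd ℂ (e1 θ) * w' θ - starRingEnd ℂ (w θ) * e1' θ)
  have nww : ∀ θ, ‖starRingEnd ℂ (w θ) * w' θ‖ ≤ 1 / 64 := fun θ => by
    rw [norm_mul, RCLike.norm_conj]
    have := mul_le_mul (nw θ) (nw' θ) (norm_nonneg _) hP0
    nlinarith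
  have nN : ∀ θ, ‖N θ‖ ≤ 65 / 64 := fun θ => by
    have := norm_sub_le (1 : ℂ) (starRingEnd ℂ (w θ) * w' θ)
    rw [norm_one] at this
    have h2 := nww θ
    simp only [N]
    linarith
  have nE : ∀ θ, ‖Ex θ‖ ≤ 2 := fun θ =>
    (Complex.norm_exp_le_exp_norm _).trans (exp_le_two ((nz θ).trans (by linarith)))
  have nE1 : ∀ θ, ‖Ex θ - 1‖ ≤ 1 / 4 := fun θ => by
    have := Complex.norm_exp_sub_one_le (x := -(starRingEnd ℂ (Φ θ) + Φ' θ) / 2)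
      ((nz θ).trans (by linarith))
    have h2 := nz θ
    simp only [Ex]
    linarith
  have nerr : ∀ θ, ‖err θ‖ ≤ 4 * d + 12 * δ + 4 * γ := fun θ => by
    have h1 : ‖N θ * (-(starRingEnd ℂ (e2 θ) - g' θ) / 2)‖ ≤ 65 / 64 * ((d + γ + γ) / 2) := by
      rw [norm_mul, norm_div, norm_neg, show ‖(2 : ℂ)‖ = 2 by simp]
      have := norm_sub_le (starRingEnd ℂ (e2 θ)) (g' θ)
      rw [RCLike.norm_conj] at this
      have h2 := n2 θ
      have h3 := n2' θ
      refine mul_le_mul (nN θ) ?_ (by positivity) (by norm_num)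
      linarith
    have h2 : ‖starRingEnd ℂ (e1 θ) * w' θ‖ ≤ (d + 3 * δ) * (1 / 8) := by
      rw [norm_mul, RCLike.norm_conj]
      exact mul_le_mul (n1 θ) ((nw' θ).trans hP) (norm_nonneg _) (by positivity)
    have h3 : ‖starRingEnd ℂ (w θ) * e1' θ‖ ≤ 1 / 8 * (3 * δ) := by
      rw [norm_mul, RCLike.norm_conj]
      exact mul_le_mul ((nw θ).trans hP) (n1' θ) (norm_nonneg _) (by norm_num)
    have h4 := norm_sub_le (N θ * (-(starRingEnd ℂ (e2 θ) - g' θ) / 2) -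
      starRingEnd ℂ (e1 θ) * w' θ) (starRingEnd ℂ (w θ) * e1' θ)
    have h5 := norm_sub_le (N θ * (-(starRingEnd ℂ (e2 θ) - g' θ) / 2))
      (starRingEnd ℂ (e1 θ) * w' θ)
    calc ‖err θ‖ ≤ 2 * (65 / 64 * ((d + γ + γ) / 2) + (d + 3 * δ) * (1 / 8) +
          1 / 8 * (3 * δ)) := by
          simp only [err]
          rw [norm_mul]
          exact mul_le_mul (nE θ) (by linarith) (norm_nonneg _) (by norm_num)
      _ ≤ _ := by linarith
  have hderiv : ∀ t : ℝ, HasDerivAt (fun t : ℝ => Ex (0 + t • ω') * N (0 + t • ω'))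
      (Complex.I * ((β' - starRingEnd ℂ β) / 2) * (Ex (0 + t • ω') * N (0 + t • ω')) +
        err (0 + t • ω')) t := by
    intro t
    have d1 := (hΦ.hasDerivAt_line hs ω' 0 t).star
    have d2 := hΦ'.hasDerivAt_line hs ω' 0 t
    have d3 := (hw.hasDerivAt_line hs ω' 0 t).star
    have d4 := hw'.hasDerivAt_line hs ω' 0 t
    have dE := (((d1.add d2).neg.div_const 2).cexp)
    have dN := ((d3.mul d4).const_sub 1)
    refine (dE.mul dN).congr_deriv ?_
    simp only [Pi.add_apply, Pi.neg_apply, Pi.mul_apply, Ex, N, err, e1, e2, e1',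
      Complex.star_def, map_sub, map_mul]
    generalize (0 : Fin n → ℝ) + t • ω' = θ
    have q1 : starRingEnd ℂ (dir ω w θ) = -c₀ θ - b₀ θ * starRingEnd ℂ (w θ) -
        a₀ θ * starRingEnd ℂ (w θ) ^ 2 -
        starRingEnd ℂ (Complex.exp (Φ θ)) * starRingEnd ℂ (a θ) := by
      rw [hwe]
      simp only [map_sub, map_add, map_mul, map_pow, ha, hb, hc]
      ring
    have q2 : starRingEnd ℂ (dir ω Φ θ) = -b₀ θ - 2 * a₀ θ * starRingEnd ℂ (w θ) +
        Complex.I * starRingEnd ℂ β - starRingEnd ℂ (g θ) := by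
      rw [hΦe]
      simp only [map_sub, map_add, map_mul, hb, hc, Complex.conj_I, Complex.conj_ofNat]
      ring
    rw [q1, q2, hwe', hΦe']
    ring
  have key := norm_le_of_bounded_solution (lam := (β' - starRingEnd ℂ β) / 2)
    (E := 4 * d + 12 * δ + 4 * γ) (by positivity) hderiv (fun t => by
      generalize (0 : Fin n → ℝ) + t • ω' = θ
      have e : Ex θ * N θ - 1 = (Ex θ - 1) * N θ - starRingEnd ℂ (w θ) * w' θ := by
        simp only [N]
        ring
      rw [e]
      refine (norm_sub_le _ _).trans ?_
      rw [norm_mul (Ex θ - 1)]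
      have := mul_le_mul (nE1 θ) (nN θ) (norm_nonneg _) (by norm_num)
      have h2 := nww θ
      linarith) (fun t => nerr _)
  rw [norm_div, show ‖(2 : ℂ)‖ = 2 by simp] at key
  linarith

end QuasiPeriodic

namespace QuasiPeriodic

open scoped ENNReal

open Filter Topology

variable {n : ℕ}

theorem NewtonInvariant.abs_sub_re_le {A B c₀ : (Fin n → ℝ) → ℂ} {β₀ : ℝ} {s₀ C₀ ρ x : ℝ} {L : ℕ}
    (hp : NewtonParameters s₀ C₀ ρ x L) (hsm : 384 * C₀ * x ^ 8 ≤ s₀)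
    (hA : ∀ θ, starRingEnd ℂ (A θ) = -c₀ θ) (hB : ∀ θ, starRingEnd ℂ (B θ) = -B θ)
    {ω ω' : Fin n → ℝ} {m : ℕ} {X X' : NewtonState n}
    (hX : NewtonInvariant A (fun θ => Complex.I * (β₀ : ℂ) + B θ) c₀ β₀ s₀ C₀ ρ x ω m X)
    (hX' : NewtonInvariant A (fun θ => Complex.I * (β₀ : ℂ) + B θ) c₀ β₀ s₀ C₀ ρ x ω' m X') :
    |X'.2.2.re - X.2.2.re| ≤ 1 / 2 * ‖ω' - ω‖ + 64 * C₀ * x ^ 9 * ρ ^ (2 * m) := by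
  obtain ⟨hs, hC, hρ, hρ2, hx, hx1, hsmall, hcut⟩ := hp
  have hC0 : 0 < C₀ := by linarith
  have hh : (0 : ℝ) < (1 / 2) ^ m := by positivity
  have hh1 : ((1 : ℝ) / 2) ^ m ≤ 1 := pow_le_one₀ (by norm_num) (by norm_num)
  have hρ3 : ρ ^ 3 ≤ 1 / 8 := (pow_le_pow_left₀ hρ.le hρ2 3).trans (by norm_num)
  have hy0 : 0 < C₀ * x ^ 8 := by positivity
  have hP0 : 0 ≤ 6 * C₀ * x ^ 8 * (1 - (1 / 2) ^ m) :=
    mul_nonneg (by positivity) (by linarith)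
  have hP1 : 6 * C₀ * x ^ 8 * (1 - (1 / 2) ^ m) ≤ 6 * C₀ * x ^ 8 :=
    mul_le_of_le_one_right (by positivity) (by linarith)
  have h := hX.1.norm_sub_conj_le hX'.1 (by positivity) hP0 (by linarith)
    (by positivity) (by positivity) hA (fun θ => by
      simp only [map_add, map_mul, Complex.conj_I, Complex.conj_ofReal, hB]
      ring)
  have hre : |X'.2.2.re - X.2.2.re| ≤ ‖X'.2.2 - starRingEnd ℂ X.2.2‖ := by
    simpa using Complex.abs_re_le_norm (X'.2.2 - starRingEnd ℂ X.2.2)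
  refine hre.trans (h.trans ?_)
  have h1 : 16 * (6 * C₀ * x ^ 8 * (1 - (1 / 2) ^ m) / (s₀ / 2 + s₀ / 2 * (1 / 2) ^ m)) ≤ 1 / 2 := by
    have hden : s₀ / 2 ≤ s₀ / 2 + s₀ / 2 * (1 / 2) ^ m := by
      have : 0 ≤ s₀ / 2 * (1 / 2) ^ m := by positivity
      linarith
    rw [← mul_div_assoc, div_le_iff₀ (by positivity)]
    linarith
  have h2 : ρ ^ (3 * m) ≤ ρ ^ (2 * m) := pow_le_pow_of_le_one hρ.le (by linarith) (by omega)
  have h3 : 48 * (C₀ * x ^ 9 * ρ ^ (3 * m)) ≤ 48 * (C₀ * x ^ 9 * ρ ^ (2 * m)) := by gcongr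
  have h4 := mul_le_mul_of_nonneg_right h1 (norm_nonneg (ω' - ω))
  linarith

/-- The Newton iterates converge to a solution of the Riccati equation and of the equation for
its linearization. -/
theorem exists_riccati_solution {A B c₀ : (Fin n → ℝ) → ℂ} {β₀ : ℂ} {s₀ C₀ ρ x : ℝ} {L τ : ℕ}
    (hp : NewtonParameters s₀ C₀ ρ x L) (hρτ : ρ * 2 ^ τ ≤ 1 / 2)
    {ω : Fin n → ℝ} {X : ℕ → NewtonState n} (hX0 : X 0 = (0, 0, β₀))
    (hinv : ∀ m, NewtonInvariant A (fun θ => Complex.I * β₀ + B θ) c₀ β₀ s₀ C₀ ρ x ω m (X m))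
    (hclose : ∀ m, NewtonClose s₀ C₀ ρ x L ω m (X m) (X (m + 1)))
    (hres : ∀ m, NonResonant ρ x L ω m (X m).2.2) :
    ∃ (w Φ : (Fin n → ℝ) → ℂ) (β : ℂ), Tendsto (fun m => (X m).2.2) atTop (𝓝 β) ∧
      ‖β - β₀‖ ≤ 4 * C₀ * x ^ 9 ∧
      InWiener (s₀ / 2) (6 * C₀ * x ^ 8) w ∧ InWiener (s₀ / 2) (6 * C₀ * x ^ 8) Φ ∧
      (∀ θ, dir ω w θ = A θ + (Complex.I * β₀ + B θ) * w θ + c₀ θ * w θ ^ 2) ∧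
      (∀ θ, dir ω Φ θ = (Complex.I * β₀ + B θ) + 2 * c₀ θ * w θ - Complex.I * β) ∧
      ∀ c > (0 : ℝ), (∀ (m : ℕ) (k : Fin n → ℤ), l1 k ≤ L * 2 ^ m →
          c * ρ ^ m / (1 + l1 k) ^ τ ≤ |dot k ω - (X m).2.2.re| ∧
          (k ≠ 0 → c * ρ ^ m / (1 + l1 k) ^ τ ≤ |dot k ω|)) →
        InWiener (s₀ / 2) (6 * C₀ * (1 + L) ^ τ / c * x ^ 9) w ∧
        InWiener (s₀ / 2) (6 * C₀ * (1 + L) ^ τ / c * x ^ 9) Φ := by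
  obtain ⟨hs, hC, hρ, hρ2, hx, hx1, hsmall, hcut⟩ := hp
  have hC0 : 0 < C₀ := by linarith
  have hs2 : 0 < s₀ / 2 := by positivity
  have hρm : ∀ m : ℕ, ρ ^ m ≤ (1 / 2) ^ m := fun m => pow_le_pow_left₀ hρ.le hρ2 m
  have hρm1 : ∀ m : ℕ, ρ ^ m ≤ 1 := fun m => pow_le_one₀ hρ.le (by linarith)
  have hinc : ∀ c > (0 : ℝ), ∀ (τ' : ℕ), ρ * 2 ^ τ' ≤ 1 / 2 →
      (∀ (m : ℕ) (k : Fin n → ℤ), l1 k ≤ L * 2 ^ m →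
        c * ρ ^ m / (1 + l1 k) ^ τ' ≤ |dot k ω - (X m).2.2.re| ∧
        (k ≠ 0 → c * ρ ^ m / (1 + l1 k) ^ τ' ≤ |dot k ω|)) →
      ∀ m, InWiener (s₀ / 2) (3 * C₀ * x ^ 9 * (1 + L) ^ τ' / c * (1 / 2) ^ m)
          (fun θ => (X (m + 1)).1 θ - (X m).1 θ) ∧
        InWiener (s₀ / 2) (3 * C₀ * x ^ 9 * (1 + L) ^ τ' / c * (1 / 2) ^ m)
          (fun θ => (X (m + 1)).2.1 θ - (X m).2.1 θ) := by
    intro c hc0 τ' hτ' hlow m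
    have hlow' : ∀ k : Fin n → ℤ, l1 k ≤ L * 2 ^ m →
        c * ρ ^ m / ((1 + L) * 2 ^ m) ^ τ' ≤ c * ρ ^ m / (1 + l1 k) ^ τ' := fun k hk => by
      have := l1_nonneg k
      have h2 : (1 : ℝ) ≤ 2 ^ m := one_le_pow₀ (by norm_num)
      gcongr
      linarith
    obtain ⟨i1, i2⟩ := (hclose m).2 (c * ρ ^ m / ((1 + L) * 2 ^ m) ^ τ') (by positivity)
      (fun k hk => (hlow' k hk).trans (hlow m k hk).1)
      (fun k hk0 hk => (hlow' k hk).trans ((hlow m k hk).2 hk0))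
    have h2τ : ρ ^ m * (2 ^ m) ^ τ' ≤ (1 / 2) ^ m := by
      rw [pow_right_comm, ← mul_pow]
      exact pow_le_pow_left₀ (by positivity) hτ' m
    have hb : C₀ * x ^ 9 * ρ ^ (2 * m) / (c * ρ ^ m / ((1 + L) * 2 ^ m) ^ τ') ≤
        C₀ * x ^ 9 * (1 + L) ^ τ' / c * (1 / 2) ^ m := by
      have e : C₀ * x ^ 9 * ρ ^ (2 * m) / (c * ρ ^ m / ((1 + L) * 2 ^ m) ^ τ') =
          C₀ * x ^ 9 * (1 + L) ^ τ' / c * (ρ ^ m * (2 ^ m) ^ τ') := by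
        have : ρ ^ (2 * m) = ρ ^ m * ρ ^ m := by rw [two_mul, pow_add]
        rw [this, mul_pow]
        field_simp
      rw [e]
      gcongr
    have hb' : C₀ * x ^ 9 * ρ ^ (3 * m) / (c * ρ ^ m / ((1 + L) * 2 ^ m) ^ τ') ≤
        C₀ * x ^ 9 * (1 + L) ^ τ' / c * (1 / 2) ^ m := by
      refine le_trans ?_ hb
      gcongr 1
      gcongr 1
      exact pow_le_pow_of_le_one hρ.le (by linarith) (by omega)
    constructor
    · refine i1.mono le_rfl (le_trans (mul_le_mul_of_nonneg_left hb' (by norm_num)) (le_of_eq ?_))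
      ring
    · refine i2.mono le_rfl (le_trans (mul_le_mul_of_nonneg_left hb (by norm_num)) ?_)
      have : 0 ≤ C₀ * x ^ 9 * (1 + L) ^ τ' / c * (1 / 2) ^ m := by positivity
      have e : 3 * C₀ * x ^ 9 * (1 + L) ^ τ' / c * (1 / 2) ^ m =
        3 * (C₀ * x ^ 9 * (1 + L) ^ τ' / c * (1 / 2) ^ m) := by ring
      linarith
  have hinc0 : ∀ m, InWiener (s₀ / 2) (3 * C₀ * x ^ 8 * (1 / 2) ^ m)
          (fun θ => (X (m + 1)).1 θ - (X m).1 θ) ∧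
        InWiener (s₀ / 2) (3 * C₀ * x ^ 8 * (1 / 2) ^ m)
          (fun θ => (X (m + 1)).2.1 θ - (X m).2.1 θ) := fun m => by
    have e : 3 * C₀ * x ^ 9 * (1 + L) ^ 0 / x * (1 / 2) ^ m = 3 * C₀ * x ^ 8 * (1 / 2) ^ m := by
      field_simp
    rw [← e]
    exact hinc x hx 0 (by simpa using hρ2) (fun m k hk => by simpa using hres m k hk) m
  obtain ⟨w, hw⟩ := exists_wienerLimit (F := fun m => (X m).1) (c := 3 * C₀ * x ^ 8) hs2.le
    (by positivity) (fun m => (hinc0 m).1)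
  obtain ⟨Φ, hΦ⟩ := exists_wienerLimit (F := fun m => (X m).2.1) (c := 3 * C₀ * x ^ 8) hs2.le
    (by positivity) (fun m => (hinc0 m).2)
  have hwM : ∀ M, InWiener (s₀ / 2) (6 * C₀ * x ^ 8 * (1 / 2) ^ M)
      (fun θ => w θ - (X M).1 θ) := fun M =>
    (hw (3 * C₀ * x ^ 8 * (1 / 2) ^ M) (by positivity) M fun m =>
      (hinc0 (M + m)).1.mono le_rfl (le_of_eq (by rw [pow_add]; ring))).mono le_rfl
      (le_of_eq (by ring))
  have hΦM : ∀ M, InWiener (s₀ / 2) (6 * C₀ * x ^ 8 * (1 / 2) ^ M)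
      (fun θ => Φ θ - (X M).2.1 θ) := fun M =>
    (hΦ (3 * C₀ * x ^ 8 * (1 / 2) ^ M) (by positivity) M fun m =>
      (hinc0 (M + m)).2.mono le_rfl (le_of_eq (by rw [pow_add]; ring))).mono le_rfl
      (le_of_eq (by ring))
  have hwW : InWiener (s₀ / 2) (6 * C₀ * x ^ 8) w := by
    simpa [hX0] using hwM 0
  have hΦW : InWiener (s₀ / 2) (6 * C₀ * x ^ 8) Φ := by
    simpa [hX0] using hΦM 0
  have hgeo : ∀ K : ℝ, Tendsto (fun m : ℕ => K * (1 / 2) ^ m) atTop (𝓝 0) := fun K => by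
    simpa using (tendsto_pow_atTop_nhds_zero_of_lt_one (by norm_num : (0 : ℝ) ≤ 1 / 2)
      (by norm_num)).const_mul K
  have htend : ∀ {f : ℕ → ℂ} {y : ℂ} (K : ℝ), (∀ m, ‖y - f m‖ ≤ K * (1 / 2) ^ m) →
      Tendsto f atTop (𝓝 y) := fun {f y} K h => by
    refine tendsto_iff_norm_sub_tendsto_zero.2 (squeeze_zero (fun m => norm_nonneg _) (fun m => ?_)
      (hgeo K))
    rw [norm_sub_rev]
    exact h m
  have hmem : ∀ m, InWiener (s₀ / 2) (6 * C₀ * x ^ 8) (X m).1 ∧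
      InWiener (s₀ / 2) (6 * C₀ * x ^ 8) (X m).2.1 := fun m => by
    have hh1 : ((1 : ℝ) / 2) ^ m ≤ 1 := pow_le_one₀ (by norm_num) (by norm_num)
    have hh0 : (0 : ℝ) ≤ (1 / 2) ^ m := by positivity
    have h1 : s₀ / 2 ≤ s₀ / 2 + s₀ / 2 * (1 / 2) ^ m := by nlinarith
    have h2 : 6 * C₀ * x ^ 8 * (1 - (1 / 2) ^ m) ≤ 6 * C₀ * x ^ 8 :=
      mul_le_of_le_one_right (by positivity) (by linarith)
    exact ⟨(hinv m).1.mem_w.mono h1 h2, (hinv m).1.mem_Φ.mono h1 h2⟩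
  have tw : ∀ θ, Tendsto (fun m => (X m).1 θ) atTop (𝓝 (w θ)) := fun θ =>
    htend (6 * C₀ * x ^ 8) fun m => (hwM m).norm_le hs2.le (by positivity) θ
  have tΦ : ∀ θ, Tendsto (fun m => (X m).2.1 θ) atTop (𝓝 (Φ θ)) := fun θ =>
    htend (6 * C₀ * x ^ 8) fun m => (hΦM m).norm_le hs2.le (by positivity) θ
  have tdw : ∀ θ, Tendsto (fun m => dir ω (X m).1 θ) atTop (𝓝 (dir ω w θ)) := fun θ =>
    htend (6 * C₀ * x ^ 8 / (s₀ / 2) * ‖ω‖) fun m => by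
      rw [← hwW.dir_sub (hmem m).1 hs2 hs2]
      exact ((hwM m).norm_dir_le hs2 (by positivity) ω θ).trans (le_of_eq (by ring))
  have tdΦ : ∀ θ, Tendsto (fun m => dir ω (X m).2.1 θ) atTop (𝓝 (dir ω Φ θ)) := fun θ =>
    htend (6 * C₀ * x ^ 8 / (s₀ / 2) * ‖ω‖) fun m => by
      rw [← hΦW.dir_sub (hmem m).2 hs2 hs2]
      exact ((hΦM m).norm_dir_le hs2 (by positivity) ω θ).trans (le_of_eq (by ring))
  have hβinc : ∀ m, dist ((X m).2.2) ((X (m + 1)).2.2) ≤ 4 * C₀ * x ^ 9 / 2 / 2 ^ m := fun m => by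
    rw [dist_comm, dist_eq_norm]
    refine (hclose m).1.trans ?_
    have : ρ ^ (2 * m) ≤ 1 / 2 ^ m := by
      rw [two_mul, pow_add, ← _root_.one_div_pow]
      have := hρm m
      have := hρm1 m
      have := pow_pos hρ m
      nlinarith
    calc 2 * C₀ * x ^ 9 * ρ ^ (2 * m) ≤ 2 * C₀ * x ^ 9 * (1 / 2 ^ m) := by gcongr
      _ = _ := by ring
  obtain ⟨β, hβ⟩ := cauchySeq_tendsto_of_complete (cauchySeq_of_le_geometric_two hβinc)
  have hres0 : ∀ (K : ℝ) (f : ℕ → ℂ), (∀ m, ‖f m‖ ≤ K * (1 / 2) ^ m) → Tendsto f atTop (𝓝 0) :=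
    fun K f h => htend K fun m => by simpa using h m
  have hxC : 24 * (C₀ * x ^ 8) ≤ 1 / 8 := by
    have hρ3 : ρ ^ 3 ≤ 1 / 8 := (pow_le_pow_left₀ hρ.le hρ2 3).trans (by norm_num)
    linarith
  refine ⟨w, Φ, β, hβ, ?_, hwW, hΦW, fun θ => ?_, fun θ => ?_, fun c hc0 hlow => ?_⟩
  · have := dist_le_of_le_geometric_two_of_tendsto₀ hβinc hβ
    rwa [hX0, dist_comm, dist_eq_norm] at this
  · have h1 : ∀ m, ∃ y : ℂ, ‖y‖ ≤ 3 * (C₀ * x ^ 9) * (1 / 2) ^ m ∧ dir ω (X m).1 θ =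
        A θ + (Complex.I * β₀ + B θ) * (X m).1 θ + c₀ θ * (X m).1 θ ^ 2 - y := fun m => by
      obtain ⟨a, ha, he⟩ := (hinv m).1.eq_w
      refine ⟨_, ?_, he θ⟩
      rw [norm_mul, mul_assoc 3]
      refine mul_le_mul ((Complex.norm_exp_le_exp_norm _).trans (exp_le_three
        (((hmem m).2.norm_le hs2.le (by positivity) θ).trans (by linarith))))
        ((ha.norm_le (by positivity) (by positivity) θ).trans ?_) (norm_nonneg _) (by norm_num)
      gcongr
      exact (pow_le_pow_of_le_one hρ.le (by linarith) (by omega : m ≤ 3 * m)).trans (hρm m)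
    choose y hy hy2 using h1
    have h2 := tdw θ
    simp only [hy2] at h2
    have h3 := ((((tw θ).const_mul (Complex.I * β₀ + B θ)).const_add (A θ)).add
      (((tw θ).pow 2).const_mul (c₀ θ))).sub (hres0 _ y hy)
    rw [sub_zero] at h3
    exact tendsto_nhds_unique h2 h3
  · have h1 : ∀ m, ∃ y : ℂ, ‖y‖ ≤ C₀ * x ^ 9 * (1 / 2) ^ m ∧ dir ω (X m).2.1 θ =
        Complex.I * β₀ + B θ + 2 * c₀ θ * (X m).1 θ - Complex.I * (X m).2.2 - y := fun m => by
      obtain ⟨a, ha, he⟩ := (hinv m).1.eq_Φ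
      refine ⟨_, (ha.norm_le (by positivity) (by positivity) θ).trans ?_, he θ⟩
      gcongr
      exact (pow_le_pow_of_le_one hρ.le (by linarith) (by omega : m ≤ 2 * m)).trans (hρm m)
    choose y hy hy2 using h1
    have h2 := tdΦ θ
    simp only [hy2] at h2
    have h3 := ((((tw θ).const_mul (2 * c₀ θ)).const_add (Complex.I * β₀ + B θ)).sub
      (hβ.const_mul Complex.I)).sub (hres0 _ y hy)
    rw [sub_zero] at h3
    exact tendsto_nhds_unique h2 h3
  · have h := hinc c hc0 τ hρτ hlow
    constructor
    · have := hw (3 * C₀ * x ^ 9 * (1 + L) ^ τ / c) (by positivity) 0 fun m => by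
        simpa using (h m).1
      refine InWiener.mono (by simpa [hX0] using this) le_rfl (le_of_eq (by ring))
    · have := hΦ (3 * C₀ * x ^ 9 * (1 + L) ^ τ / c) (by positivity) 0 fun m => by
        simpa using (h m).2
      refine InWiener.mono (by simpa [hX0] using this) le_rfl (le_of_eq (by ring))

end QuasiPeriodic

namespace QuasiPeriodic

open scoped ENNReal

open MeasureTheory

/-- An approximately Lipschitz function is close to a Lipschitz function. -/
theorem exists_lipschitz_approx {E : Type*} [SeminormedAddCommGroup E] {G : Set E} {f : E → ℝ}
    {c η : ℝ} (hc : 0 ≤ c)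
    (hf : ∀ y ∈ G, ∀ y' ∈ G, |f y' - f y| ≤ c * ‖y' - y‖ + η) :
    ∃ g : E → ℝ, (∀ y y', |g y' - g y| ≤ c * ‖y' - y‖) ∧ ∀ y ∈ G, |f y - g y| ≤ η := by
  rcases G.eq_empty_or_nonempty with rfl | ⟨y₀, hy₀⟩
  · exact ⟨fun _ => 0, fun y y' => by simp; positivity, fun y hy => hy.elim⟩
  have : Nonempty G := ⟨⟨y₀, hy₀⟩⟩
  have hbd : ∀ z y : E, y ∈ G → f y₀ - c * ‖z - y₀‖ - η ≤ f y + c * ‖z - y‖ := fun z y hy => by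
    have h1 := (abs_le.1 (hf y hy y₀ hy₀)).2
    have h2 : ‖y₀ - y‖ ≤ ‖z - y₀‖ + ‖z - y‖ := by
      rw [norm_sub_rev z y₀]
      simpa using norm_add_le (y₀ - z) (z - y)
    nlinarith
  have hbdd : ∀ z : E, BddBelow (Set.range fun y : G => f y + c * ‖z - y‖) := fun z =>
    ⟨f y₀ - c * ‖z - y₀‖ - η, by rintro _ ⟨y, rfl⟩; exact hbd z y y.2⟩
  refine ⟨fun z => ⨅ y : G, (f y + c * ‖z - y‖), fun z z' => ?_, fun z hz => ?_⟩
  · have key : ∀ z z' : E, (⨅ y : G, (f y + c * ‖z' - y‖)) - (⨅ y : G, (f y + c * ‖z - y‖)) ≤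
        c * ‖z' - z‖ := fun z z' => by
      rw [sub_le_iff_le_add', ← sub_le_iff_le_add]
      refine le_ciInf fun y => ?_
      rw [sub_le_iff_le_add]
      refine (ciInf_le (hbdd z') y).trans ?_
      have : ‖z' - (y : E)‖ ≤ ‖z' - z‖ + ‖z - y‖ := by simpa using norm_add_le (z' - z) (z - y)
      nlinarith
    rw [abs_le]
    have h2 := key z' z
    rw [norm_sub_rev] at h2
    exact ⟨by linarith, key z z'⟩
  · have h1 : (⨅ y : G, (f y + c * ‖z - y‖)) ≤ f z := by
      simpa using ciInf_le (hbdd z) ⟨z, hz⟩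
    have h2 : f z - η ≤ ⨅ y : G, (f y + c * ‖z - y‖) := le_ciInf fun y => by
      have := (abs_le.1 (hf y y.2 z hz)).2
      linarith
    rw [abs_le]
    constructor <;> linarith

theorem measurableSet_frequencyBox (n : ℕ) : MeasurableSet (frequencyBox n) :=
  MeasurableSet.univ_pi fun _ => measurableSet_Ioc

theorem volume_frequencyBox (n : ℕ) :
    volume (frequencyBox n) = ENNReal.ofReal ((2 * Real.pi) ^ n) := by
  rw [frequencyBox, volume_pi_pi]
  simp [ENNReal.ofReal_pow Real.two_pi_pos.le]

/-- The set of frequencies at which `k · ω` is close to an approximately Lipschitz function. -/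
theorem volume_resonant_le {n : ℕ} {k : Fin n → ℤ} (hk : k ≠ 0) {G : Set (Fin n → ℝ)}
    (hG : G ⊆ frequencyBox n) {f : (Fin n → ℝ) → ℝ} {η κ : ℝ} (hη : 0 ≤ η) (hκ : 0 ≤ κ)
    (hf : ∀ ω ∈ G, ∀ ω' ∈ G, |f ω' - f ω| ≤ 1 / 2 * ‖ω' - ω‖ + η) :
    volume {ω ∈ G | |dot k ω - f ω| < κ} ≤
      ENNReal.ofReal (4 * (2 * Real.pi) ^ n * (κ + η)) := by
  obtain ⟨g, hg, hfg⟩ := exists_lipschitz_approx (by norm_num : (0 : ℝ) ≤ 1 / 2) hf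
  have hgc : Continuous g := by
    refine (LipschitzWith.of_dist_le_mul (K := 1 / 2) fun y y' => ?_).continuous
    rw [Real.dist_eq, dist_eq_norm]
    simpa using hg y' y
  have hdc : Continuous fun ω : Fin n → ℝ => dot k ω := by
    unfold dot
    fun_prop
  set T : Set (Fin n → ℝ) := frequencyBox n ∩ {ω | |dot k ω - g ω| ≤ κ + η} with hT
  have hTm : MeasurableSet T :=
    (measurableSet_frequencyBox n).inter
      (isClosed_le (by fun_prop) continuous_const).measurableSet
  have hsub : {ω ∈ G | |dot k ω - f ω| < κ} ⊆ T := by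
    rintro ω ⟨hω, h⟩
    refine ⟨hG hω, ?_⟩
    have h1 := hfg ω hω
    change |dot k ω - g ω| ≤ κ + η
    calc |dot k ω - g ω| = |(dot k ω - f ω) + (f ω - g ω)| := by ring_nf
      _ ≤ _ := (abs_add_le _ _).trans (by linarith)
  refine (measure_mono hsub).trans ?_
  obtain ⟨j, hj⟩ : ∃ j, k j ≠ 0 := by
    by_contra! h
    exact hk (funext h)
  obtain ⟨m, rfl⟩ : ∃ m, n = m + 1 := ⟨n - 1, by have := j.pos; omega⟩
  have hmp := (volume_preserving_piFinSuccAbove (fun _ : Fin (m + 1) => ℝ) j).symm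
  rw [← hmp.measure_preimage hTm.nullMeasurableSet, Measure.volume_eq_prod,
    Measure.prod_apply_symm (hmp.measurable hTm)]
  have hslice : ∀ y : Fin m → ℝ,
      volume ((fun x : ℝ => (x, y)) ⁻¹'
        ((MeasurableEquiv.piFinSuccAbove (fun _ : Fin (m + 1) => ℝ) j).symm ⁻¹' T)) ≤
      (frequencyBox m).indicator (fun _ => ENNReal.ofReal (4 * (κ + η))) y := by
    intro y
    by_cases hy : y ∈ frequencyBox m
    · rw [Set.indicator_of_mem hy]
      refine (Real.volume_le_diam _).trans (Metric.ediam_le fun x hx x' hx' => ?_)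
      rw [edist_dist]
      refine ENNReal.ofReal_le_ofReal ?_
      have h1 : |dot k (j.insertNth x y) - g (j.insertNth x y)| ≤ κ + η := hx.2
      have h2 : |dot k (j.insertNth x' y) - g (j.insertNth x' y)| ≤ κ + η := hx'.2
      have hdiff : (j.insertNth x y : Fin (m + 1) → ℝ) - j.insertNth x' y =
          Pi.single j (x - x') := by
        funext i
        refine Fin.succAboveCases j ?_ (fun i => ?_) i
        · simp
        · simp [Fin.succAbove_ne]
      have h3 := hg (j.insertNth x' y) (j.insertNth x y)
      rw [hdiff, Pi.norm_single] at h3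
      have h4 : dot k (j.insertNth x y : Fin (m + 1) → ℝ) - dot k (j.insertNth x' y) =
          k j * (x - x') := by
        rw [← dot_sub_right, hdiff]
        simp [dot, Pi.single_apply]
      have h5 : |x - x'| ≤ |(k j : ℝ) * (x - x')| := by
        rw [abs_mul]
        refine le_mul_of_one_le_left (abs_nonneg _) ?_
        exact_mod_cast Int.one_le_abs hj
      rw [← h4] at h5
      rw [Real.dist_eq]
      rw [Real.norm_eq_abs] at h3
      have h6 : |dot k (j.insertNth x y : Fin (m + 1) → ℝ) - dot k (j.insertNth x' y)| ≤
          (κ + η) + (κ + η) + 1 / 2 * |x - x'| := by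
        rw [abs_le] at h1 h2 h3 ⊢
        constructor <;> linarith
      linarith
    · rw [Set.indicator_of_notMem hy]
      refine le_of_eq (measure_mono_null ?_ measure_empty)
      intro x hx
      refine hy ?_
      have hbox : (j.insertNth x y : Fin (m + 1) → ℝ) ∈ frequencyBox (m + 1) := hx.1
      intro i _
      have := hbox (j.succAbove i) trivial
      simpa using this
  refine (lintegral_mono hslice).trans ?_
  rw [lintegral_indicator (measurableSet_frequencyBox m), setLIntegral_const,
    volume_frequencyBox, ← ENNReal.ofReal_mul (by positivity)]
  refine ENNReal.ofReal_le_ofReal ?_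
  have h1 : (2 * Real.pi) ^ m ≤ (2 * Real.pi) ^ (m + 1) :=
    pow_le_pow_right₀ (by linarith [Real.pi_gt_three]) (by omega)
  have h2 : 0 ≤ κ + η := by positivity
  nlinarith

end QuasiPeriodic

namespace QuasiPeriodic

open scoped ENNReal

open MeasureTheory Filter Topology

theorem tsum_pi_prod (f : ℤ → ℝ≥0∞) (n : ℕ) :
    ∑' k : Fin n → ℤ, ∏ j, f (k j) = (∑' i, f i) ^ n := by
  induction n with
  | zero => simp [tsum_fintype]
  | succ n ih =>
    rw [← (Fin.consEquiv fun _ : Fin (n + 1) => ℤ).tsum_eq,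
      ENNReal.tsum_prod' (f := fun p : ℤ × (Fin n → ℤ) =>
        ∏ j, f ((Fin.consEquiv fun _ : Fin (n + 1) => ℤ) p j))]
    simp only [Fin.consEquiv_apply, Fin.prod_univ_succ, Fin.cons_zero, Fin.cons_succ]
    simp only [ENNReal.tsum_mul_left, ih, ENNReal.tsum_mul_right]
    rw [pow_succ, mul_comm]

theorem tsum_one_add_l1_ne_top (n : ℕ) :
    ∑' k : Fin n → ℤ, ENNReal.ofReal (1 / (1 + l1 k) ^ (2 * n)) ≠ ⊤ := by
  have h1 : ∀ k : Fin n → ℤ, ENNReal.ofReal (1 / (1 + l1 k) ^ (2 * n)) ≤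
      ∏ j, ENNReal.ofReal (1 / (1 + |(k j : ℝ)|) ^ 2) := fun k => by
    rw [← ENNReal.ofReal_prod_of_nonneg (fun j _ => by positivity)]
    refine ENNReal.ofReal_le_ofReal ?_
    have h2 : ∏ j : Fin n, (1 + |(k j : ℝ)|) ^ 2 ≤ (1 + l1 k) ^ (2 * n) := by
      calc ∏ j : Fin n, (1 + |(k j : ℝ)|) ^ 2 ≤ ∏ _j : Fin n, (1 + l1 k) ^ 2 := by
            refine Finset.prod_le_prod (fun j _ => by positivity) fun j _ => ?_
            gcongr
            exact Finset.single_le_sum (f := fun j => |(k j : ℝ)|)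
              (fun _ _ => abs_nonneg _) (Finset.mem_univ j)
        _ = _ := by simp [← pow_mul]
    calc 1 / (1 + l1 k) ^ (2 * n) ≤ 1 / ∏ j : Fin n, (1 + |(k j : ℝ)|) ^ 2 := by
          refine one_div_le_one_div_of_le (Finset.prod_pos fun j _ => by positivity) h2
      _ = _ := by simp
  refine ne_top_of_le_ne_top ?_ (ENNReal.tsum_le_tsum h1)
  rw [tsum_pi_prod (fun i => ENNReal.ofReal (1 / (1 + |(i : ℝ)|) ^ 2))]
  refine ENNReal.pow_ne_top ?_
  have h3 : Summable fun i : ℤ => 1 / (1 + |(i : ℝ)|) ^ 2 := by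
    have := (Real.summable_one_div_int_pow (p := 2)).2 (by norm_num)
    refine Summable.of_norm_bounded_eventually this ?_
    filter_upwards [(Set.finite_singleton (0 : ℤ)).compl_mem_cofinite] with i hi
    have hi0 : (i : ℝ) ≠ 0 := by exact_mod_cast hi
    rw [Real.norm_of_nonneg (by positivity), ← sq_abs (i : ℝ)]
    have : 0 < |(i : ℝ)| := abs_pos.2 hi0
    gcongr
    linarith
  rw [← ENNReal.ofReal_tsum_of_nonneg (fun i => by positivity) h3]
  exact ENNReal.ofReal_ne_top

/-- The sum of `(1 + |k|) ^ (-2 n)` over the lattice. -/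
noncomputable def latticeSum (n : ℕ) : ℝ :=
  (∑' k : Fin n → ℤ, ENNReal.ofReal (1 / (1 + l1 k) ^ (2 * n))).toReal

theorem volume_diophantine_le {n : ℕ} {G : Set (Fin n → ℝ)}
    (hG : G ⊆ frequencyBox n) {f : (Fin n → ℝ) → ℝ} {κ : ℝ} (hκ : 0 ≤ κ)
    (hf : ∀ ω ∈ G, ∀ ω' ∈ G, |f ω' - f ω| ≤ 1 / 2 * ‖ω' - ω‖) :
    volume {ω ∈ G | ∃ k : Fin n → ℤ, k ≠ 0 ∧ |dot k ω - f ω| < κ / (1 + l1 k) ^ (2 * n)} ≤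
      ENNReal.ofReal (4 * (2 * Real.pi) ^ n * latticeSum n * κ) := by
  have hsub : {ω ∈ G | ∃ k : Fin n → ℤ, k ≠ 0 ∧ |dot k ω - f ω| < κ / (1 + l1 k) ^ (2 * n)} ⊆
      ⋃ k : Fin n → ℤ, {ω ∈ G | k ≠ 0 ∧ |dot k ω - f ω| < κ / (1 + l1 k) ^ (2 * n)} := by
    rintro ω ⟨hω, k, hk⟩
    exact Set.mem_iUnion.2 ⟨k, hω, hk⟩
  refine (measure_mono hsub).trans ((measure_iUnion_le _).trans ?_)
  have hle : ∀ k : Fin n → ℤ,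
      volume {ω ∈ G | k ≠ 0 ∧ |dot k ω - f ω| < κ / (1 + l1 k) ^ (2 * n)} ≤
      ENNReal.ofReal (4 * (2 * Real.pi) ^ n * κ) *
        ENNReal.ofReal (1 / (1 + l1 k) ^ (2 * n)) := fun k => by
    have hl := l1_nonneg k
    by_cases hk : k = 0
    · simp [hk]
    · have := volume_resonant_le hk hG (f := f) (η := 0) (κ := κ / (1 + l1 k) ^ (2 * n)) le_rfl
        (by positivity) (by simpa using hf)
      simp only [ne_eq, hk, not_false_eq_true, true_and]
      refine this.trans (le_of_eq ?_)
      rw [← ENNReal.ofReal_mul (by positivity)]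
      congr 1
      ring
  refine (ENNReal.tsum_le_tsum hle).trans (le_of_eq ?_)
  rw [ENNReal.tsum_mul_left, ← ENNReal.ofReal_toReal (tsum_one_add_l1_ne_top n),
    ← ENNReal.ofReal_mul (by positivity)]
  congr 1
  rw [latticeSum]
  ring

/-- Frequencies with Diophantine properties that do not depend on the perturbation. -/
def IsDiophantine {n : ℕ} (ν₁ γ : ℝ) (ω : Fin n → ℝ) : Prop :=
  ∀ k : Fin n → ℤ, k ≠ 0 → γ / (1 + l1 k) ^ (2 * n) ≤ |dot k ω| ∧
    γ / (1 + l1 k) ^ (2 * n) ≤ |dot k ω - 2 * ν₁| ∧ γ / (1 + l1 k) ^ (2 * n) ≤ |dot k ω - -ν₁|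

theorem volume_not_isDiophantine (n : ℕ) (ν₁ : ℝ) :
    volume {ω ∈ frequencyBox n | ¬ ∃ γ > 0, IsDiophantine ν₁ γ ω} = 0 := by
  set c := 4 * (2 * Real.pi) ^ n * latticeSum n with hc
  have hS : 0 ≤ latticeSum n := ENNReal.toReal_nonneg
  have hle : ∀ γ > (0 : ℝ), volume {ω ∈ frequencyBox n | ¬ ∃ γ > 0, IsDiophantine ν₁ γ ω} ≤
      ENNReal.ofReal (3 * c * γ) := fun γ hγ => by
    have key : ∀ a : ℝ, volume {ω ∈ frequencyBox n | ∃ k : Fin n → ℤ, k ≠ 0 ∧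
        |dot k ω - a| < γ / (1 + l1 k) ^ (2 * n)} ≤ ENNReal.ofReal (c * γ) := fun a =>
      volume_diophantine_le subset_rfl (f := fun _ => a) hγ.le (fun ω _ ω' _ => by simp)
    have hsub : {ω ∈ frequencyBox n | ¬ ∃ γ > 0, IsDiophantine ν₁ γ ω} ⊆
        ({ω ∈ frequencyBox n | ∃ k : Fin n → ℤ, k ≠ 0 ∧
            |dot k ω - 0| < γ / (1 + l1 k) ^ (2 * n)} ∪
          {ω ∈ frequencyBox n | ∃ k : Fin n → ℤ, k ≠ 0 ∧
            |dot k ω - 2 * ν₁| < γ / (1 + l1 k) ^ (2 * n)}) ∪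
          {ω ∈ frequencyBox n | ∃ k : Fin n → ℤ, k ≠ 0 ∧
            |dot k ω - -ν₁| < γ / (1 + l1 k) ^ (2 * n)} := by
      rintro ω ⟨hω, h⟩
      have h' : ¬ IsDiophantine ν₁ γ ω := fun h' => h ⟨γ, hγ, h'⟩
      unfold IsDiophantine at h'
      push Not at h'
      obtain ⟨k, hk, hk'⟩ := h'
      by_cases h1 : γ / (1 + l1 k) ^ (2 * n) ≤ |dot k ω|
      · by_cases h2 : γ / (1 + l1 k) ^ (2 * n) ≤ |dot k ω - 2 * ν₁|
        · exact Or.inr ⟨hω, k, hk, hk' h1 h2⟩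
        · exact Or.inl (Or.inr ⟨hω, k, hk, not_le.1 h2⟩)
      · exact Or.inl (Or.inl ⟨hω, k, hk, by simpa using h1⟩)
    refine (measure_mono hsub).trans ((measure_union_le _ _).trans ?_)
    have e : ENNReal.ofReal (3 * c * γ) =
        ENNReal.ofReal (c * γ) + ENNReal.ofReal (c * γ) + ENNReal.ofReal (c * γ) := by
      rw [← ENNReal.ofReal_add (by positivity) (by positivity),
        ← ENNReal.ofReal_add (by positivity) (by positivity)]
      congr 1
      ring
    rw [e]
    exact add_le_add ((measure_union_le _ _).trans (add_le_add (key 0) (key _))) (key _)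
  refine le_antisymm (ge_of_tendsto (x := 𝓝[>] (0 : ℝ))
    (f := fun γ => ENNReal.ofReal (3 * c * γ)) ?_ ?_) bot_le
  · have h1 : Tendsto (fun γ : ℝ => ENNReal.ofReal (3 * c * γ)) (𝓝 0) (𝓝 (ENNReal.ofReal (3 * c * 0))) :=
      (ENNReal.continuous_ofReal.comp (by fun_prop)).tendsto 0
    simp only [mul_zero, ENNReal.ofReal_zero] at h1
    exact h1.mono_left nhdsWithin_le_nhds
  · filter_upwards [self_mem_nhdsWithin] with γ hγ using hle γ hγ

theorem smallDivisor_lower_bound {γ C₀ x r d β β₀ l : ℝ} {τ : ℕ} (hγ : 0 < γ) (hC₀ : 1 ≤ C₀)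
    (hx : 0 < x) (hx1 : x ≤ 1) (hr : 0 ≤ r) (hr1 : r ≤ 1) (hl : 0 ≤ l)
    (h1 : γ / (1 + l) ^ τ ≤ |d - β₀|) (h2 : |β - β₀| ≤ 4 * C₀ * x ^ 9) (h3 : x * r ≤ |d - β|) :
    γ / (8 * C₀) * r / (1 + l) ^ τ ≤ |d - β| := by
  set D := (1 + l) ^ τ with hD
  have hD0 : 0 < D := by positivity
  have hx9 : x ^ 9 ≤ x := by
    simpa using pow_le_pow_of_le_one hx.le hx1 (by norm_num : 1 ≤ 9)
  by_cases h : 4 * C₀ * x ^ 9 ≤ γ / D / 2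
  · have h4 : |d - β₀| ≤ |d - β| + |β - β₀| := abs_sub_le _ _ _
    have h5 : γ / (8 * C₀) * r / D ≤ γ / D / 2 := by
      rw [div_div γ D 2, div_mul_eq_mul_div, div_div, div_le_div_iff₀ (by positivity) (by positivity)]
      nlinarith [mul_le_mul_of_nonneg_left hr1 (by positivity : 0 ≤ γ * D * 2),
        mul_le_mul_of_nonneg_left hC₀ (by positivity : 0 ≤ γ * D)]
    linarith
  · rw [not_le] at h
    refine le_trans ?_ h3
    have h6 : γ / (8 * C₀) / D ≤ x := by
      refine le_trans ?_ hx9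
      rw [div_div, div_le_iff₀ (by positivity)]
      rw [div_div, div_lt_iff₀ (by positivity)] at h
      linarith
    calc γ / (8 * C₀) * r / D = (γ / (8 * C₀) / D) * r := by ring
      _ ≤ x * r := by gcongr

theorem card_l1_le (n N : ℕ) : ∃ S : Finset (Fin n → ℤ), S.card = (2 * N + 1) ^ n ∧
    ∀ k : Fin n → ℤ, l1 k ≤ N → k ∈ S := by
  refine ⟨Fintype.piFinset fun _ => Finset.Icc (-N : ℤ) N, ?_, fun k hk => ?_⟩
  · rw [Fintype.card_piFinset]
    simp only [Int.card_Icc, Finset.prod_const, Finset.card_univ, Fintype.card_fin]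
    congr 1
    omega
  · rw [Fintype.mem_piFinset]
    intro j
    have h1 : |(k j : ℝ)| ≤ N := (Finset.single_le_sum (f := fun j => |(k j : ℝ)|)
      (fun _ _ => abs_nonneg _) (Finset.mem_univ j)).trans hk
    rw [Finset.mem_Icc, ← abs_le]
    exact_mod_cast h1

end QuasiPeriodic

namespace QuasiPeriodic

open scoped ENNReal

open MeasureTheory Filter Topology

theorem volume_resonant_step_le {n : ℕ} {G : Set (Fin n → ℝ)} (hG : G ⊆ frequencyBox n)
    {f : (Fin n → ℝ) → ℝ} {κ : ℝ} (hκ : 0 ≤ κ) {N : ℕ}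
    (hf : ∀ ω ∈ G, ∀ ω' ∈ G, |f ω' - f ω| ≤ 1 / 2 * ‖ω' - ω‖ + κ) :
    volume {ω ∈ G | ∃ k : Fin n → ℤ, l1 k ≤ N ∧ k ≠ 0 ∧ |dot k ω - f ω| < κ} ≤
      ENNReal.ofReal ((2 * N + 1) ^ n * (8 * (2 * Real.pi) ^ n * κ)) := by
  obtain ⟨S, hS, hmem⟩ := card_l1_le n N
  have hsub : {ω ∈ G | ∃ k : Fin n → ℤ, l1 k ≤ N ∧ k ≠ 0 ∧ |dot k ω - f ω| < κ} ⊆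
      ⋃ k ∈ S, {ω ∈ G | k ≠ 0 ∧ |dot k ω - f ω| < κ} := by
    rintro ω ⟨hω, k, hkN, hk⟩
    exact Set.mem_biUnion (hmem k hkN) ⟨hω, hk⟩
  refine (measure_mono hsub).trans ((measure_biUnion_finset_le _ _).trans ?_)
  have hle : ∀ k ∈ S, volume {ω ∈ G | k ≠ 0 ∧ |dot k ω - f ω| < κ} ≤
      ENNReal.ofReal (8 * (2 * Real.pi) ^ n * κ) := fun k _ => by
    by_cases hk : k = 0
    · simp [hk]
    · have := volume_resonant_le hk hG (f := f) hκ hκ hf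
      simp only [ne_eq, hk, not_false_eq_true, true_and]
      refine this.trans (le_of_eq ?_)
      congr 1
      ring
  refine (Finset.sum_le_sum hle).trans (le_of_eq ?_)
  rw [Finset.sum_const, hS, nsmul_eq_mul, ← ENNReal.ofReal_natCast,
    ← ENNReal.ofReal_mul (by positivity)]
  push_cast
  rfl

/-- The frequencies excluded by the non-resonance conditions of the Newton iteration. -/
theorem volume_not_nonResonant_le {n : ℕ} {A B c₀ : (Fin n → ℝ) → ℂ} {ν₁ s₀ C₀ ρ x : ℝ} {L : ℕ}
    (hp : NewtonParameters s₀ C₀ ρ x L) (hsm : 384 * C₀ * x ^ 8 ≤ s₀)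
    (hsm' : 64 * C₀ * x ^ 8 ≤ 1) (hν : 4 * C₀ * x ^ 9 ≤ ν₁) (hxν : x ≤ ν₁)
    (hρn : 2 ^ n * ρ ≤ 1 / 2)
    (hA : ∀ θ, starRingEnd ℂ (A θ) = -c₀ θ) (hB : ∀ θ, starRingEnd ℂ (B θ) = -B θ)
    {X : ℕ → (Fin n → ℝ) → NewtonState n}
    (hX : ∀ ω m, (∀ j < m, NonResonant ρ x L ω j (X j ω).2.2) →
      NewtonInvariant A (fun θ => Complex.I * ((2 * ν₁ : ℝ) : ℂ) + B θ) c₀ ((2 * ν₁ : ℝ) : ℂ)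
        s₀ C₀ ρ x ω m (X m ω)) :
    volume {ω ∈ frequencyBox n | ¬ ∀ m, NonResonant ρ x L ω m (X m ω).2.2} ≤
      ENNReal.ofReal (32 * (2 * L + 1) ^ n * (2 * Real.pi) ^ n * 2 * x) := by
  have hp' := hp
  obtain ⟨hs, hC, hρ, hρ2, hx, hx1, hsmall, hcut⟩ := hp
  have hC0 : 0 < C₀ := by linarith
  set G : ℕ → Set (Fin n → ℝ) := fun m =>
    {ω ∈ frequencyBox n | ∀ j < m, NonResonant ρ x L ω j (X j ω).2.2} with hGdef
  set c := 16 * (2 * L + 1) ^ n * (2 * Real.pi) ^ n * x with hc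
  have hρm1 : ∀ m : ℕ, ρ ^ m ≤ 1 := fun m => pow_le_one₀ hρ.le (by linarith)
  have hstep : ∀ m, volume {ω ∈ G m | ¬ NonResonant ρ x L ω m (X m ω).2.2} ≤
      ENNReal.ofReal (c * (1 / 2) ^ m) := fun m => by
    have hκ : 0 ≤ x * ρ ^ m := by positivity
    have hGm : G m ⊆ frequencyBox n := fun ω hω => hω.1
    have hinv := fun ω (hω : ω ∈ G m) => hX ω m hω.2
    have v1 := volume_resonant_step_le hGm (f := fun ω => (X m ω).2.2.re) hκ (N := L * 2 ^ m)
      (fun ω hω ω' hω' => by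
        refine (NewtonInvariant.abs_sub_re_le hp' hsm hA hB (hinv ω hω) (hinv ω' hω')).trans ?_
        have h1 : 64 * C₀ * x ^ 9 * ρ ^ (2 * m) = (64 * C₀ * x ^ 8) * ρ ^ m * (x * ρ ^ m) := by
          ring
        have h2 : (64 * C₀ * x ^ 8) * ρ ^ m ≤ 1 :=
          mul_le_one₀ hsm' (by positivity) (hρm1 m)
        rw [h1]
        exact add_le_add le_rfl (mul_le_of_le_one_left hκ h2))
    have v2 := volume_resonant_step_le hGm (f := fun ω => 0) hκ (N := L * 2 ^ m)
      (fun ω _ ω' _ => by simp; positivity)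
    have hsub : {ω ∈ G m | ¬ NonResonant ρ x L ω m (X m ω).2.2} ⊆
        {ω ∈ G m | ∃ k : Fin n → ℤ, l1 k ≤ (L * 2 ^ m : ℕ) ∧ k ≠ 0 ∧
          |dot k ω - (X m ω).2.2.re| < x * ρ ^ m} ∪
        {ω ∈ G m | ∃ k : Fin n → ℤ, l1 k ≤ (L * 2 ^ m : ℕ) ∧ k ≠ 0 ∧
          |dot k ω - 0| < x * ρ ^ m} := by
      rintro ω ⟨hω, h⟩
      unfold NonResonant at h
      push Not at h
      obtain ⟨k, hkN, hk⟩ := h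
      have hkN' : l1 k ≤ (L * 2 ^ m : ℕ) := by exact_mod_cast hkN
      by_cases h1 : x * ρ ^ m ≤ |dot k ω - (X m ω).2.2.re|
      · obtain ⟨hk0, hk1⟩ := hk h1
        exact Or.inr ⟨hω, k, hkN', hk0, by simpa using hk1⟩
      · refine Or.inl ⟨hω, k, hkN', fun hk0 => h1 ?_, not_le.1 h1⟩
        have h2 := (hinv ω hω).2
        have h3 : 4 * C₀ * x ^ 9 * (1 - (1 / 2) ^ m) ≤ 4 * C₀ * x ^ 9 :=
          mul_le_of_le_one_right (by positivity) (by
            have : (0 : ℝ) ≤ (1 / 2) ^ m := by positivity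
            linarith)
        have h4 := (Complex.abs_re_le_norm _).trans (h2.trans (h3.trans hν))
        rw [Complex.sub_re, Complex.ofReal_re] at h4
        have h5 := (abs_le.1 h4).1
        have h6 : x * ρ ^ m ≤ x := mul_le_of_le_one_right hx.le (hρm1 m)
        rw [hk0, dot_zero_left, zero_sub, abs_neg]
        exact le_trans (by linarith) (le_abs_self _)
    refine (measure_mono hsub).trans ((measure_union_le _ _).trans
      ((add_le_add v1 v2).trans ?_))
    rw [← ENNReal.ofReal_add (by positivity) (by positivity)]
    refine ENNReal.ofReal_le_ofReal ?_
    have hN : (2 * ((L * 2 ^ m : ℕ) : ℝ) + 1) ^ n ≤ (2 * L + 1) ^ n * (2 ^ n) ^ m := by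
      rw [pow_right_comm, ← mul_pow]
      have h2 : (1 : ℝ) ≤ 2 ^ m := one_le_pow₀ (by norm_num)
      gcongr
      push_cast
      nlinarith
    have hρ' : (2 ^ n) ^ m * ρ ^ m ≤ (1 / 2) ^ m := by
      rw [← mul_pow]
      exact pow_le_pow_left₀ (by positivity) hρn m
    calc _ = (2 * ((L * 2 ^ m : ℕ) : ℝ) + 1) ^ n * (16 * (2 * Real.pi) ^ n * (x * ρ ^ m)) := by ring
      _ ≤ (2 * L + 1) ^ n * (2 ^ n) ^ m * (16 * (2 * Real.pi) ^ n * (x * ρ ^ m)) := by gcongr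
      _ = c * ((2 ^ n) ^ m * ρ ^ m) := by rw [hc]; ring
      _ ≤ _ := by gcongr
  have hsub : {ω ∈ frequencyBox n | ¬ ∀ m, NonResonant ρ x L ω m (X m ω).2.2} ⊆
      ⋃ m, {ω ∈ G m | ¬ NonResonant ρ x L ω m (X m ω).2.2} := by
    classical
    rintro ω ⟨hω, h⟩
    push Not at h
    refine Set.mem_iUnion.2 ⟨Nat.find h, ⟨hω, fun j hj => ?_⟩, Nat.find_spec h⟩
    exact not_not.1 (Nat.find_min h hj)
  refine (measure_mono hsub).trans ((measure_iUnion_le _).trans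
    ((ENNReal.tsum_le_tsum hstep).trans ?_))
  have hg : Summable fun m : ℕ => c * ((1 : ℝ) / 2) ^ m :=
    (summable_geometric_of_lt_one (by norm_num) (by norm_num)).mul_left c
  rw [← ENNReal.ofReal_tsum_of_nonneg (fun m => by positivity) hg, tsum_mul_left,
    tsum_geometric_two]
  refine ENNReal.ofReal_le_ofReal ?_
  rw [hc]
  have : 0 ≤ (2 * (L : ℝ) + 1) ^ n * (2 * Real.pi) ^ n * x := by positivity
  nlinarith

/-- A solution of the Riccati equation, its linearization and the small divisor estimates that are
needed for the reduction. -/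
structure RiccatiSolution {n : ℕ} (ω : Fin n → ℝ) (a₀ b₀ c₀ : (Fin n → ℝ) → ℂ)
    (ν₁ s x r r' e g : ℝ) (w Φ : (Fin n → ℝ) → ℂ) (β : ℂ) : Prop where
  mem_w : InWiener s r w
  mem_Φ : InWiener s r Φ
  mem_w' : InWiener s r' w
  mem_Φ' : InWiener s r' Φ
  dir_w : ∀ θ, dir ω w θ = a₀ θ + b₀ θ * w θ + c₀ θ * w θ ^ 2
  dir_Φ : ∀ θ, dir ω Φ θ = b₀ θ + 2 * c₀ θ * w θ - Complex.I * β
  norm_sub_le : ‖β - (2 * ν₁ : ℝ)‖ ≤ e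
  le_re : ν₁ ≤ β.re
  dio₀ : ∀ k : Fin n → ℤ, k ≠ 0 → x / (1 + l1 k) ^ (2 * n) ≤ |dot k ω| ∧
    g / (1 + l1 k) ^ (4 * n) ≤ |dot k ω|
  dio₁ : ∀ k : Fin n → ℤ, x / (1 + l1 k) ^ (2 * n) ≤ |dot k ω - -(β.re / 2)| ∧
    g / (1 + l1 k) ^ (4 * n) ≤ |dot k ω - -(β.re / 2)|

/-- The scheme parameters exist for all small `x`. -/
theorem exists_newtonParameters {s₀ C₀ ν₁ : ℝ} (n : ℕ) (hs : 0 < s₀) (hC : 1 ≤ C₀) (hν : 0 < ν₁) :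
    ∃ (ρ : ℝ) (L : ℕ), ρ * 2 ^ (2 * n) ≤ 1 / 2 ∧ 2 ^ n * ρ ≤ 1 / 2 ∧ ∃ x₀ > (0 : ℝ), x₀ ≤ 1 ∧
      ∀ x, 0 < x → x ≤ x₀ → NewtonParameters s₀ C₀ ρ x L ∧ 384 * C₀ * x ^ 8 ≤ s₀ ∧
        64 * C₀ * x ^ 8 ≤ 1 ∧ 4 * C₀ * x ^ 9 ≤ ν₁ ∧ 2 * x ≤ ν₁ := by
  set ρ : ℝ := (1 / 2) ^ (2 * n + 1) with hρ
  have hρ0 : 0 < ρ := by positivity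
  have hC0 : 0 < C₀ := by linarith
  have hρ2 : ρ ≤ 1 / 2 := by
    have := pow_le_pow_of_le_one (by norm_num : (0 : ℝ) ≤ 1 / 2) (by norm_num)
      (by omega : 1 ≤ 2 * n + 1)
    simpa [hρ] using this
  have hρτ : ρ * 2 ^ (2 * n) = 1 / 2 := by
    have : ((1 : ℝ) / 2) ^ (2 * n) * 2 ^ (2 * n) = 1 := by rw [← mul_pow]; norm_num
    rw [hρ, pow_succ]
    linear_combination (1 / 2) * this
  obtain ⟨L, hL⟩ := exists_nat_ge (-(8 / s₀) * Real.log (ρ ^ 3 / 8))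
  refine ⟨ρ, L, hρτ.le, ?_, min (min 1 (ν₁ / 2)) (min (min (ρ ^ 3 / (24 * C₀)) (s₀ / (384 * C₀)))
    (min (1 / (64 * C₀)) (ν₁ / (4 * C₀)))), by positivity,
    (min_le_left _ _).trans (min_le_left _ _), fun x hx hx0 => ?_⟩
  · rw [← hρτ, mul_comm]
    gcongr
    · norm_num
    · omega
  · simp only [le_min_iff] at hx0
    obtain ⟨⟨h1, h2⟩, ⟨h3, h4⟩, h5, h6⟩ := hx0
    rw [le_div_iff₀ (by positivity)] at h2 h3 h4 h5 h6
    have h8 : x ^ 8 ≤ x := by simpa using pow_le_pow_of_le_one hx.le h1 (by norm_num : 1 ≤ 8)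
    have h9 : x ^ 9 ≤ x := by simpa using pow_le_pow_of_le_one hx.le h1 (by norm_num : 1 ≤ 9)
    have h8' : C₀ * x ^ 8 ≤ C₀ * x := by gcongr
    have h9' : C₀ * x ^ 9 ≤ C₀ * x := by gcongr
    refine ⟨⟨hs, hC, hρ0, hρ2, hx, h1, by linarith, ?_⟩, by linarith, by linarith, by linarith,
      by linarith⟩
    rw [← Real.exp_log (by positivity : 0 < ρ ^ 3 / 8)]
    refine Real.exp_le_exp.2 ?_
    have : s₀ / 8 * (-(8 / s₀) * Real.log (ρ ^ 3 / 8)) ≤ s₀ / 8 * L := by gcongr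
    have e : s₀ / 8 * (-(8 / s₀) * Real.log (ρ ^ 3 / 8)) = -Real.log (ρ ^ 3 / 8) := by
      field_simp
    linarith

end QuasiPeriodic

namespace QuasiPeriodic

open scoped ENNReal

open MeasureTheory Filter Topology

theorem exists_diophantineConstant {n : ℕ} {ν₁ : ℝ} (hν : 0 < ν₁) :
    ∃ γ : (Fin n → ℝ) → ℝ, (∀ ω, 0 < γ ω) ∧ ∀ ω, (∃ γ > 0, IsDiophantine ν₁ γ ω) →
      (∀ k : Fin n → ℤ, k ≠ 0 → γ ω / (1 + l1 k) ^ (2 * n) ≤ |dot k ω|) ∧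
      (∀ k : Fin n → ℤ, γ ω / (1 + l1 k) ^ (2 * n) ≤ |dot k ω - 2 * ν₁|) ∧
      (∀ k : Fin n → ℤ, γ ω / (1 + l1 k) ^ (2 * n) ≤ |dot k ω - -ν₁|) := by
  have h : ∀ ω : Fin n → ℝ, ∃ γ : ℝ, 0 < γ ∧ ((∃ γ > 0, IsDiophantine ν₁ γ ω) →
      (∀ k : Fin n → ℤ, k ≠ 0 → γ / (1 + l1 k) ^ (2 * n) ≤ |dot k ω|) ∧
      (∀ k : Fin n → ℤ, γ / (1 + l1 k) ^ (2 * n) ≤ |dot k ω - 2 * ν₁|) ∧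
      (∀ k : Fin n → ℤ, γ / (1 + l1 k) ^ (2 * n) ≤ |dot k ω - -ν₁|)) := by
    intro ω
    by_cases hω : ∃ γ > 0, IsDiophantine ν₁ γ ω
    · obtain ⟨γ, hγ, hd⟩ := hω
      have hle : ∀ k : Fin n → ℤ,
          min γ ν₁ / (1 + l1 k) ^ (2 * n) ≤ γ / (1 + l1 k) ^ (2 * n) := fun k => by
        have := l1_nonneg k
        gcongr
        exact min_le_left _ _
      refine ⟨min γ ν₁, lt_min hγ hν, fun _ => ⟨fun k hk => (hle k).trans (hd k hk).1,
        fun k => ?_, fun k => ?_⟩⟩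
      · by_cases hk : k = 0
        · simp only [hk, l1_zero, add_zero, one_pow, div_one, dot_zero_left, zero_sub, abs_neg]
          rw [abs_of_pos (by linarith)]
          exact (min_le_right _ _).trans (by linarith)
        · exact (hle k).trans (hd k hk).2.1
      · by_cases hk : k = 0
        · simp only [hk, l1_zero, add_zero, one_pow, div_one, dot_zero_left, zero_sub, neg_neg]
          rw [abs_of_pos hν]
          exact min_le_right _ _
        · exact (hle k).trans (hd k hk).2.2
    · exact ⟨1, one_pos, fun h => (hω h).elim⟩
  choose γ h1 h2 using h
  exact ⟨γ, h1, h2⟩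

/-- For most frequencies the Riccati equation has a quasi-periodic solution. -/
theorem exists_goodFrequencies (n : ℕ) {ν₁ s₀ C₁ : ℝ} (hν : 0 < ν₁) (hs : 0 < s₀)
    {A B : (Fin n → ℝ) → ℂ} (hA : InWiener s₀ C₁ A) (hB : InWiener s₀ C₁ B)
    (hBc : ∀ θ, starRingEnd ℂ (B θ) = -B θ) :
    ∃ x₀ > (0 : ℝ), x₀ ≤ 1 ∧ ∃ C > (0 : ℝ), ∃ K g : (Fin n → ℝ) → ℝ, (∀ ω, 0 < K ω) ∧
      (∀ ω, 0 < g ω) ∧ ∀ ε x : ℝ, 0 < x → x ≤ x₀ → |ε| = x ^ 9 →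
      ∃ E : Set (Fin n → ℝ), MeasurableSet E ∧ E ⊆ frequencyBox n ∧
        volume (frequencyBox n \ E) ≤ ENNReal.ofReal (C * x) ∧
        ∀ ω ∈ E, ∃ w Φ β, RiccatiSolution ω (fun θ => ε * A θ)
          (fun θ => Complex.I * ((2 * ν₁ : ℝ) : ℂ) + ε * B θ)
          (fun θ => -(ε * starRingEnd ℂ (A θ))) ν₁ (s₀ / 2) x (C * x ^ 8) (K ω * x ^ 9)
          (C * x ^ 9) (g ω) w Φ β := by
  set C₀ := max C₁ 1 with hC₀
  have hC : 1 ≤ C₀ := le_max_right _ _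
  have hC0 : 0 < C₀ := by linarith
  obtain ⟨ρ, L, hρτ, hρn, x₀, hx₀, hx₀1, hpar⟩ := exists_newtonParameters n hs hC hν
  obtain ⟨γ, hγ, hdio⟩ := exists_diophantineConstant (n := n) hν
  have hS : 0 ≤ latticeSum n := ENNReal.toReal_nonneg
  set M₁ := 32 * (2 * (L : ℝ) + 1) ^ n * (2 * Real.pi) ^ n * 2 with hM₁
  set M₂ := 4 * (2 * Real.pi) ^ n * latticeSum n with hM₂
  have hM₁0 : 0 ≤ M₁ := by positivity
  have hM₂0 : 0 ≤ M₂ := by positivity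
  refine ⟨x₀, hx₀, hx₀1, M₁ + 2 * M₂ + 6 * C₀, by positivity,
    fun ω => 6 * C₀ * (1 + L) ^ (2 * n) / (γ ω / (8 * C₀)), fun ω => γ ω / (8 * C₀),
    fun ω => by have := hγ ω; positivity, fun ω => by have := hγ ω; positivity,
    fun ε x hx hxx₀ hε => ?_⟩
  obtain ⟨hp, hsm, hsm', hν9, hxν⟩ := hpar x hx hxx₀
  have hx1 : x ≤ 1 := hp.x_le
  have hεn : ‖(ε : ℂ)‖ ≤ x ^ 9 := by rw [Complex.norm_real, Real.norm_eq_abs, hε]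
  have hW : ∀ {F : (Fin n → ℝ) → ℂ}, InWiener s₀ C₁ F →
      InWiener s₀ (C₀ * x ^ 9) (fun θ => ε * F θ) := fun hF =>
    ((hF.mono le_rfl (le_max_left _ _)).const_mul _ hεn).mono le_rfl (le_of_eq (mul_comm _ _))
  have hc : InWiener s₀ (C₀ * x ^ 9) (fun θ => -(ε * starRingEnd ℂ (A θ))) := (hW hA.conj).neg
  obtain ⟨X, hX0, hX⟩ := exists_newtonSequence (β₀ := ((2 * ν₁ : ℝ) : ℂ)) hp (hW hA) (hW hB) hc
  have hAc : ∀ θ, starRingEnd ℂ ((ε : ℂ) * A θ) = - -(ε * starRingEnd ℂ (A θ)) := fun θ => by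
    rw [map_mul, Complex.conj_ofReal, neg_neg]
  have hBc' : ∀ θ, starRingEnd ℂ ((ε : ℂ) * B θ) = -(ε * B θ) := fun θ => by
    rw [map_mul, Complex.conj_ofReal, hBc, mul_neg]
  have hbad₁ := volume_not_nonResonant_le hp hsm hsm' hν9 (by linarith) hρn hAc hBc'
    (X := X) (fun ω m h => (hX ω m h).1)
  set G : Set (Fin n → ℝ) :=
    {ω ∈ frequencyBox n | ∀ m, NonResonant ρ x L ω m (X m ω).2.2} with hG
  have hGbox : G ⊆ frequencyBox n := fun ω hω => hω.1
  have hinv : ∀ ω ∈ G, ∀ m, NewtonInvariant (fun θ => ε * A θ)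
      (fun θ => Complex.I * ((2 * ν₁ : ℝ) : ℂ) + ε * B θ)
      (fun θ => -(ε * starRingEnd ℂ (A θ))) ((2 * ν₁ : ℝ) : ℂ) s₀ C₀ ρ x ω m (X m ω) :=
    fun ω hω m => (hX ω m fun j _ => hω.2 j).1
  have hsol := fun ω (hω : ω ∈ G) => exists_riccati_solution (X := fun m => X m ω) hp hρτ (hX0 ω)
    (hinv ω hω) (fun m => (hX ω (m + 1) fun j _ => hω.2 j).2 m (by omega)) hω.2
  choose! w Φ β hβ hβ0 hw hΦ hdw hdΦ hK using hsol
  have hlip : ∀ ω ∈ G, ∀ ω' ∈ G, |(β ω').re - (β ω).re| ≤ 1 / 2 * ‖ω' - ω‖ := by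
    intro ω hω ω' hω'
    have t1 : Tendsto (fun m => |(X m ω').2.2.re - (X m ω).2.2.re|) atTop
        (𝓝 |(β ω').re - (β ω).re|) :=
      (((Complex.continuous_re.tendsto _).comp (hβ ω' hω')).sub
        ((Complex.continuous_re.tendsto _).comp (hβ ω hω))).abs
    have t2 : Tendsto (fun m => 1 / 2 * ‖ω' - ω‖ + 64 * C₀ * x ^ 9 * ρ ^ (2 * m)) atTop
        (𝓝 (1 / 2 * ‖ω' - ω‖ + 64 * C₀ * x ^ 9 * 0)) := by
      refine ((tendsto_const_nhds).mul ?_).const_add _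
      simp only [pow_mul]
      refine tendsto_pow_atTop_nhds_zero_of_lt_one (by positivity) ?_
      have := hp.ρ_pos
      have := hp.ρ_le
      nlinarith
    rw [mul_zero, add_zero] at t2
    exact le_of_tendsto_of_tendsto' t1 t2 fun m =>
      NewtonInvariant.abs_sub_re_le hp hsm hAc hBc' (hinv ω hω m) (hinv ω' hω' m)
  have hbad₂ := volume_diophantine_le (subset_refl (frequencyBox n)) (f := fun _ => 0) hx.le
    (fun ω _ ω' _ => by simp)
  have hbad₃ := volume_diophantine_le hGbox (f := fun ω => -((β ω).re / 2)) hx.le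
    (fun ω hω ω' hω' => by
      have h1 := hlip ω hω ω' hω'
      have h2 : -((β ω').re / 2) - -((β ω).re / 2) = -(1 / 2) * ((β ω').re - (β ω).re) := by ring
      rw [h2, abs_mul, abs_neg, abs_of_pos (by norm_num : (0 : ℝ) < 1 / 2)]
      have h3 := abs_nonneg ((β ω').re - (β ω).re)
      linarith)
  have hbad₄ := volume_not_isDiophantine n ν₁
  set S₁ := {ω ∈ frequencyBox n | ¬ ∀ m, NonResonant ρ x L ω m (X m ω).2.2}
  set S₂ := {ω ∈ frequencyBox n | ∃ k : Fin n → ℤ, k ≠ 0 ∧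
    |dot k ω - 0| < x / (1 + l1 k) ^ (2 * n)}
  set S₃ := {ω ∈ G | ∃ k : Fin n → ℤ, k ≠ 0 ∧
    |dot k ω - -((β ω).re / 2)| < x / (1 + l1 k) ^ (2 * n)}
  set S₄ := {ω ∈ frequencyBox n | ¬ ∃ γ > 0, IsDiophantine ν₁ γ ω}
  refine ⟨frequencyBox n \ toMeasurable volume (S₁ ∪ S₂ ∪ S₃ ∪ S₄),
    (measurableSet_frequencyBox n).diff (measurableSet_toMeasurable _ _), Set.sdiff_subset, ?_, ?_⟩
  · have hsub : frequencyBox n \ (frequencyBox n \ toMeasurable volume (S₁ ∪ S₂ ∪ S₃ ∪ S₄)) ⊆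
        toMeasurable volume (S₁ ∪ S₂ ∪ S₃ ∪ S₄) := by
      rintro ω ⟨h1, h2⟩
      by_contra h3
      exact h2 ⟨h1, h3⟩
    refine (measure_mono hsub).trans ?_
    rw [measure_toMeasurable]
    have e : ENNReal.ofReal ((M₁ + 2 * M₂ + 6 * C₀) * x) = ENNReal.ofReal (M₁ * x) +
        ENNReal.ofReal (M₂ * x) + ENNReal.ofReal (M₂ * x) + ENNReal.ofReal (6 * C₀ * x) := by
      rw [← ENNReal.ofReal_add (by positivity) (by positivity),
        ← ENNReal.ofReal_add (by positivity) (by positivity),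
        ← ENNReal.ofReal_add (by positivity) (by positivity)]
      congr 1
      ring
    rw [e]
    refine (measure_union_le _ _).trans (add_le_add ((measure_union_le _ _).trans (add_le_add
      ((measure_union_le _ _).trans (add_le_add hbad₁ hbad₂)) hbad₃)) ?_)
    rw [hbad₄]
    exact bot_le
  · rintro ω ⟨hω, hωbad⟩
    have hωbad' : ω ∉ S₁ ∪ S₂ ∪ S₃ ∪ S₄ := fun h => hωbad (subset_toMeasurable volume _ h)
    simp only [Set.mem_union, not_or] at hωbad'
    obtain ⟨⟨⟨n1, n2⟩, n3⟩, n4⟩ := hωbad'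
    have g1 : ∀ m, NonResonant ρ x L ω m (X m ω).2.2 := by
      by_contra h
      exact n1 ⟨hω, h⟩
    have hωG : ω ∈ G := ⟨hω, g1⟩
    have g2 : ∀ k : Fin n → ℤ, k ≠ 0 → x / (1 + l1 k) ^ (2 * n) ≤ |dot k ω| := fun k hk => by
      by_contra h
      exact n2 ⟨hω, k, hk, by simpa using h⟩
    have g3 : ∀ k : Fin n → ℤ, k ≠ 0 →
        x / (1 + l1 k) ^ (2 * n) ≤ |dot k ω - -((β ω).re / 2)| := fun k hk => by
      by_contra h
      exact n3 ⟨hωG, k, hk, not_le.1 h⟩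
    have g4 : ∃ γ > 0, IsDiophantine ν₁ γ ω := by
      by_contra h
      exact n4 ⟨hω, h⟩
    obtain ⟨d0, d1, d2⟩ := hdio ω g4
    have hγω := hγ ω
    have hβre : |(β ω).re - 2 * ν₁| ≤ 4 * C₀ * x ^ 9 := by
      have := (Complex.abs_re_le_norm _).trans (hβ0 ω hωG)
      simpa using this
    have hre : ν₁ ≤ (β ω).re := by
      have := (abs_le.1 hβre).1
      linarith
    have hone : ∀ k : Fin n → ℤ, 1 ≤ (1 + l1 k) ^ (2 * n) := fun k =>
      one_le_pow₀ (by linarith [l1_nonneg k])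
    have g3' : ∀ k : Fin n → ℤ,
        x / (1 + l1 k) ^ (2 * n) ≤ |dot k ω - -((β ω).re / 2)| := fun k => by
      by_cases hk : k = 0
      · simp only [hk, l1_zero, add_zero, one_pow, div_one, dot_zero_left, zero_sub, neg_neg]
        exact le_trans (by linarith) (le_abs_self _)
      · exact g3 k hk
    have hKω := hK ω hωG (γ ω / (8 * C₀)) (by positivity) fun m k hk => by
      have hρm0 : 0 ≤ ρ ^ m := pow_nonneg hp.ρ_pos.le m
      have hρm1 : ρ ^ m ≤ 1 := pow_le_one₀ hp.ρ_pos.le (by linarith [hp.ρ_le])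
      constructor
      · refine smallDivisor_lower_bound hγω hC hx hx1 hρm0 hρm1 (l1_nonneg k) (d1 k) ?_
          (g1 m k hk).1
        have h2 := (Complex.abs_re_le_norm _).trans (hinv ω hωG m).2
        rw [Complex.sub_re, Complex.ofReal_re] at h2
        refine h2.trans (mul_le_of_le_one_right (by positivity) ?_)
        have : (0 : ℝ) ≤ (1 / 2) ^ m := by positivity
        linarith
      · intro hk0
        refine smallDivisor_lower_bound (β := 0) (β₀ := 0) (d := dot k ω) hγω hC hx hx1 hρm0 hρm1
          (l1_nonneg k) (by simpa using d0 k hk0) (by simp; positivity)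
          (by simpa using (g1 m k hk).2 hk0) |>.trans (by simp)
    have hCle : 6 * C₀ ≤ M₁ + 2 * M₂ + 6 * C₀ := by linarith
    refine ⟨w ω, Φ ω, β ω, ?_⟩
    have hb : ∀ d β' β₀' : ℝ, ∀ k : Fin n → ℤ, γ ω / (1 + l1 k) ^ (2 * n) ≤ |d - β₀'| →
        |β' - β₀'| ≤ 4 * C₀ * x ^ 9 → x / (1 + l1 k) ^ (2 * n) ≤ |d - β'| →
        γ ω / (8 * C₀) / (1 + l1 k) ^ (4 * n) ≤ |d - β'| := by
      intro d β' β₀' k h1 h2 h3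
      have hl := l1_nonneg k
      have := smallDivisor_lower_bound (r := 1 / (1 + l1 k) ^ (2 * n)) hγω hC hx hx1
        (by positivity) (by rw [div_le_one (by positivity)]; exact hone k) hl h1 h2
        (by rwa [mul_one_div])
      refine le_trans (le_of_eq ?_) this
      have e : (1 + l1 k) ^ (4 * n) = (1 + l1 k) ^ (2 * n) * (1 + l1 k) ^ (2 * n) := by
        rw [← pow_add]
        ring_nf
      rw [e]
      field_simp
    exact
      { mem_w := (hw ω hωG).mono le_rfl (by gcongr)
        mem_Φ := (hΦ ω hωG).mono le_rfl (by gcongr)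
        mem_w' := hKω.1
        mem_Φ' := hKω.2
        dir_w := hdw ω hωG
        dir_Φ := hdΦ ω hωG
        norm_sub_le := (hβ0 ω hωG).trans (by gcongr; linarith)
        le_re := hre
        dio₀ := fun k hk => ⟨g2 k hk, by
          simpa using hb (dot k ω) 0 0 k (by simpa using d0 k hk) (by simp; positivity)
            (by simpa using g2 k hk)⟩
        dio₁ := fun k => ⟨g3' k, hb _ _ (-ν₁) k (d2 k) (by
          have h2 : -((β ω).re / 2) - -ν₁ = -(1 / 2) * ((β ω).re - 2 * ν₁) := by ring
          rw [h2, abs_mul, abs_neg, abs_of_pos (by norm_num : (0 : ℝ) < 1 / 2)]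
          have h3 := abs_nonneg ((β ω).re - 2 * ν₁)
          linarith) (g3' k)⟩ }

end QuasiPeriodic

namespace QuasiPeriodic

open scoped ENNReal

variable {n : ℕ}

theorem InWiener.inf {s r r' : ℝ} {F : (Fin n → ℝ) → ℂ} (h : InWiener s r F)
    (h' : InWiener s r' F) : InWiener s (min r r') F := by
  rcases min_choice r r' with e | e <;> rw [e] <;> assumption

theorem exp_sub_one_le {r : ℝ} (h0 : 0 ≤ r) (h : r ≤ 1 / 2) : Real.exp r - 1 ≤ 2 * r := by
  have h1 := Real.exp_bound_div_one_sub_of_interval h0 (by linarith)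
  rw [le_div_iff₀ (by linarith)] at h1
  nlinarith [Real.exp_pos r]

/-- The logarithm of `1 - |w|²`. -/
theorem InWiener.neg_log_one_sub {s r : ℝ} {w : (Fin n → ℝ) → ℂ} (hw : InWiener s r w)
    (hs : 0 ≤ s) (hr0 : 0 ≤ r) (hr : r ≤ 1 / 2) :
    InWiener s r (fun θ => -Complex.log (1 - w θ * starRingEnd ℂ (w θ))) := by
  have hz : InWiener s (r * r) (fun θ => w θ * starRingEnd ℂ (w θ)) := hw.mul hw.conj hs hr0
  have hrr : r * r ≤ 1 / 4 := by nlinarith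
  have hsum : Summable fun j : ℕ => (r * r) * (r * r) ^ j :=
    (summable_geometric_of_lt_one (by positivity) (by linarith)).mul_left _
  have hF : ∀ j : ℕ, InWiener s ((r * r) * (r * r) ^ j)
      (fun θ => (w θ * starRingEnd ℂ (w θ)) ^ (j + 1) / ((j + 1 : ℕ) : ℂ)) := fun j => by
    have := (hz.pow hs (by positivity) (j + 1)).const_mul (((j + 1 : ℕ) : ℂ)⁻¹) (r' := 1) (by
      rw [norm_inv, Complex.norm_natCast]
      exact inv_le_one_of_one_le₀ (by exact_mod_cast Nat.succ_pos j))
    rw [one_mul, pow_succ'] at this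
    simpa only [div_eq_inv_mul] using this
  have h := InWiener.tsum hs hF (fun j => by positivity) hsum
    (H := fun θ => -Complex.log (1 - w θ * starRingEnd ℂ (w θ))) (fun θ => by
      have hn := hz.norm_le hs (by positivity) θ
      have := Complex.hasSum_taylorSeries_neg_log (z := w θ * starRingEnd ℂ (w θ)) (by linarith)
      simpa using (hasSum_nat_add_iff' 1).2 this)
  refine h.mono le_rfl ?_
  rw [tsum_mul_left, tsum_geometric_of_lt_one (by positivity) (by linarith), ← div_eq_mul_inv,
    div_le_iff₀ (by linarith)]
  nlinarith

/-- The diagonalizing amplitude `p` with `|p|² (1 - |w|²) = 1`. -/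
theorem exists_amplitude {ω : Fin n → ℝ} {a₀ b₀ c₀ w Φ : (Fin n → ℝ) → ℂ} {s r : ℝ} {β : ℂ}
    (hs : 0 < s) (hr0 : 0 ≤ r) (hr : r ≤ 1 / 2) (hw : InWiener s r w) (hΦ : InWiener s r Φ)
    (hdw : ∀ θ, dir ω w θ = a₀ θ + b₀ θ * w θ + c₀ θ * w θ ^ 2)
    (hdΦ : ∀ θ, dir ω Φ θ = b₀ θ + 2 * c₀ θ * w θ - Complex.I * β)
    (ha : ∀ θ, starRingEnd ℂ (a₀ θ) = -c₀ θ) (hb : ∀ θ, starRingEnd ℂ (b₀ θ) = -b₀ θ) :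
    ∃ p : (Fin n → ℝ) → ℂ, InWiener s 2 p ∧ InWiener s (2 * r) (fun θ => p θ - 1) ∧
      (∀ θ, p θ * starRingEnd ℂ (p θ) * (1 - w θ * starRingEnd ℂ (w θ)) = 1) ∧
      ∀ θ, dir ω p θ = p θ * (-(b₀ θ / 2) - c₀ θ * w θ + Complex.I * (β.re / 2 : ℝ)) := by
  have hc : ∀ θ, starRingEnd ℂ (c₀ θ) = -a₀ θ := fun θ => by
    rw [← neg_neg (c₀ θ), ← ha θ, map_neg, Complex.conj_conj]
  set ℓ : (Fin n → ℝ) → ℂ := fun θ => -Complex.log (1 - w θ * starRingEnd ℂ (w θ)) with hℓ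
  have hℓW : InWiener s r ℓ := hw.neg_log_one_sub hs.le hr0 hr
  set ψ : (Fin n → ℝ) → ℂ := fun θ =>
    -(1 / 4) * (Φ θ - starRingEnd ℂ (Φ θ)) + 1 / 2 * ℓ θ with hψ
  have hψW : InWiener s r ψ := by
    have h1 := (hΦ.sub hΦ.conj hr0 hr0).const_mul (-(1 / 4)) (r' := 1 / 4) (by simp)
    have h2 := hℓW.const_mul (1 / 2) (r' := 1 / 2) (by simp)
    exact (h1.add h2 (by positivity) (by positivity)).mono le_rfl (by linarith)
  have hpos : ∀ θ, ∃ y : ℝ, 0 < y ∧ 1 - w θ * starRingEnd ℂ (w θ) = y := fun θ => by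
    refine ⟨1 - ‖w θ‖ ^ 2, ?_, ?_⟩
    · have := hw.norm_le hs.le hr0 θ
      have h0 := norm_nonneg (w θ)
      nlinarith
    · rw [Complex.mul_conj, Complex.normSq_eq_norm_sq]
      push_cast
      rfl
  have hpW : InWiener s 2 (fun θ => Complex.exp (ψ θ)) :=
    (hψW.exp hs.le hr0).mono le_rfl (exp_le_two hr)
  refine ⟨fun θ => Complex.exp (ψ θ), hpW,
    (hψW.exp_sub_one hs.le hr0).mono le_rfl (exp_sub_one_le hr0 hr), fun θ => ?_, fun θ => ?_⟩
  · obtain ⟨y, hy, he⟩ := hpos θ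
    have hℓr : ℓ θ = ((-Real.log y : ℝ) : ℂ) := by
      simp only [hℓ, he]
      rw [← Complex.ofReal_log hy.le]
      push_cast
      rfl
    rw [← Complex.exp_conj, ← Complex.exp_add, he]
    have e1 : ψ θ + starRingEnd ℂ (ψ θ) = ((-Real.log y : ℝ) : ℂ) := by
      simp only [hψ, hℓr, map_add, map_mul, map_sub, map_neg, Complex.conj_conj,
        Complex.conj_ofReal, map_div₀, map_one, Complex.conj_ofNat]
      ring
    rw [e1, ← Complex.ofReal_exp, Real.exp_neg, Real.exp_log hy, ← Complex.ofReal_mul,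
      inv_mul_cancel₀ hy.ne', Complex.ofReal_one]
  · have dw := hw.hasDerivAt_dir hs ω θ
    have dΦ := hΦ.hasDerivAt_dir hs ω θ
    have dq := (dw.mul dw.star).const_sub 1
    obtain ⟨y, hy, he⟩ := hpos θ
    have hslit : (1 - (w (θ + (0 : ℝ) • ω) * star (w (θ + (0 : ℝ) • ω)))) ∈ Complex.slitPlane := by
      rw [zero_smul, add_zero, Complex.star_def, he]
      exact Complex.ofReal_mem_slitPlane.2 hy
    have dℓ := (dq.clog_real hslit).neg
    have dψ := ((dΦ.sub dΦ.star).const_mul (-(1 / 4) : ℂ)).add (dℓ.const_mul (1 / 2 : ℂ))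
    have dp := dψ.cexp
    refine Eq.trans dp.deriv ?_
    simp only [Pi.add_apply, Pi.neg_apply, Pi.mul_apply, Pi.sub_apply, zero_smul, add_zero,
      Complex.star_def]
    have hy0 : (y : ℂ) ≠ 0 := by exact_mod_cast hy.ne'
    have e1 : -(dir ω w θ * starRingEnd ℂ (w θ) + w θ * starRingEnd ℂ (dir ω w θ)) /
        (1 - w θ * starRingEnd ℂ (w θ)) = -(a₀ θ * starRingEnd ℂ (w θ) - c₀ θ * w θ) := by
      rw [div_eq_iff (he ▸ hy0), hdw]
      simp only [map_add, map_mul, map_pow, ha, hb, hc]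
      ring
    have e2 : β + starRingEnd ℂ β = 2 * (β.re : ℂ) := by
      rw [Complex.add_conj]
      push_cast
      rfl
    rw [e1, hdΦ]
    simp only [map_add, map_mul, map_sub, hb, hc, Complex.conj_I, Complex.conj_ofNat]
    congr 1
    push_cast
    linear_combination (Complex.I / 4) * e2

/-- Removal of the terms that are linear in `(ξ₁, η₁)` and of the oscillating part of the
coefficient of `ξ₂²`. -/
theorem exists_linearReduction (n : ℕ) {s₀ C₁ : ℝ} (hs : 0 < s₀) (hC₁ : 0 ≤ C₁)
    {P R : (Fin n → ℝ) → ℂ} (hP : InWiener s₀ C₁ P) (hR : InWiener s₀ C₁ R)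
    (hRc : ∀ θ, starRingEnd ℂ (R θ) = R θ) :
    ∃ C > (0 : ℝ), ∀ (ε x g : ℝ) (ω : Fin n → ℝ) (w p : (Fin n → ℝ) → ℂ) (ν : ℝ), 0 < x → x ≤ 1 →
      |ε| = x ^ 9 → 0 < g → 0 < ν → InWiener (s₀ / 2) 1 w → InWiener (s₀ / 2) 2 p →
      (∀ k : Fin n → ℤ, k ≠ 0 → x / (1 + l1 k) ^ (2 * n) ≤ |dot k ω| ∧
        g / (1 + l1 k) ^ (4 * n) ≤ |dot k ω|) →
      (∀ k : Fin n → ℤ, x / (1 + l1 k) ^ (2 * n) ≤ |dot k ω - -ν| ∧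
        g / (1 + l1 k) ^ (4 * n) ≤ |dot k ω - -ν|) →
      ∃ (F u y : (Fin n → ℝ) → ℂ) (c : ℝ),
        (∀ θ, F θ = -(Complex.I * ε * (starRingEnd ℂ (p θ) * starRingEnd ℂ (P θ) +
          starRingEnd ℂ (p θ) * starRingEnd ℂ (w θ) * P θ))) ∧
        InWiener (s₀ / 8) (C * x ^ 8) u ∧ InWiener (s₀ / 8) (C / g * x ^ 9) u ∧
        InWiener (s₀ / 8) (C * x ^ 8) y ∧ InWiener (s₀ / 8) (C / g * x ^ 9) y ∧
        (∀ θ, starRingEnd ℂ (y θ) = y θ) ∧ |c| ≤ C * x ^ 9 ∧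
        (∀ θ, dir ω u θ = -(Complex.I * ν) * u θ - F θ) ∧
        (∀ θ, Complex.I * dir ω y θ = 2 * Complex.I * c - 2 * Complex.I * ε * R θ -
          (starRingEnd ℂ (u θ) * F θ - u θ * starRingEnd ℂ (F θ))) := by
  set D : ℕ → ℝ → ℝ := fun τ ς => τ.factorial * Real.exp ς / ς ^ τ with hD
  set cu := max (D (2 * n) (s₀ / 2 - s₀ / 4)) (D (4 * n) (s₀ / 2 - s₀ / 4)) * (6 * C₁) with hcu
  set CG := C₁ + cu * (6 * C₁) with hCG
  set cy := max (D (2 * n) (s₀ / 4 - s₀ / 8)) (D (4 * n) (s₀ / 4 - s₀ / 8)) * (2 * CG) with hcy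
  have hD0 : ∀ τ ς, 0 < ς → 0 ≤ D τ ς := fun τ ς h => by simp only [hD]; positivity
  have hcu0 : 0 ≤ cu := mul_nonneg (le_max_of_le_left (hD0 _ _ (by linarith))) (by positivity)
  have hCG0 : 0 ≤ CG := by positivity
  have hcy0 : 0 ≤ cy := mul_nonneg (le_max_of_le_left (hD0 _ _ (by linarith))) (by positivity)
  refine ⟨cu + CG + cy + 1, by positivity, ?_⟩
  intro ε x g ω w p ν hx hx1 hε hg hν hw hp hd0 hd1
  have hεn : ‖-(Complex.I * (ε : ℂ))‖ ≤ x ^ 9 := by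
    rw [norm_neg, norm_mul, Complex.norm_I, one_mul, Complex.norm_real, Real.norm_eq_abs, hε]
  have hεn' : ‖(ε : ℂ)‖ ≤ x ^ 9 := by rw [Complex.norm_real, Real.norm_eq_abs, hε]
  have hs2 : 0 < s₀ / 2 := by positivity
  have hP2 : InWiener (s₀ / 2) C₁ P := hP.mono (by linarith) le_rfl
  set F : (Fin n → ℝ) → ℂ := fun θ => -(Complex.I * ε) *
    (starRingEnd ℂ (p θ) * starRingEnd ℂ (P θ) +
      starRingEnd ℂ (p θ) * starRingEnd ℂ (w θ) * P θ) with hF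
  have hFW : InWiener (s₀ / 2) (6 * C₁ * x ^ 9) F := by
    have h1 := hp.conj.mul hP2.conj hs2.le (by norm_num)
    have h2 := (hp.conj.mul hw.conj hs2.le (by norm_num)).mul hP2 hs2.le (by norm_num)
    refine ((h1.add h2 (by positivity) (by positivity)).const_mul _ hεn).mono le_rfl ?_
    have : 0 ≤ C₁ * x ^ 9 := by positivity
    linarith
  have hx9 : (0 : ℝ) ≤ x ^ 9 := by positivity
  have hν' : ∀ k : Fin n → ℤ, ‖(dot k ω : ℂ) - ((-ν : ℝ) : ℂ)‖ = |dot k ω - -ν| := fun k => by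
    rw [← Complex.ofReal_sub, Complex.norm_real, Real.norm_eq_abs]
  have hnz : ∀ k : Fin n → ℤ, (dot k ω : ℂ) - ((-ν : ℝ) : ℂ) ≠ 0 := fun k h => by
    have h1 := (hd1 k).1
    rw [← hν', h, norm_zero] at h1
    have := l1_nonneg k
    have : 0 < x / (1 + l1 k) ^ (2 * n) := by positivity
    linarith
  obtain ⟨u, m, -, hm, hu, hub⟩ := hFW.neg.exists_diophantine (s' := s₀ / 4) (by positivity)
    (by linarith) (by positivity) ω ((-ν : ℝ) : ℂ) hx (fun k _ => hnz k)
    (fun k _ => (hd1 k).1.trans (hν' k).ge)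
  rw [hm (by exact_mod_cast (neg_ne_zero.2 hν.ne'))] at hu
  have hu1 : InWiener (s₀ / 4) (cu * x ^ 8) u := by
    refine (hub x hx (2 * n) fun k _ => (hd1 k).1.trans (hν' k).ge).mono le_rfl ?_
    rw [div_le_iff₀ hx]
    calc _ ≤ max (D (2 * n) (s₀ / 2 - s₀ / 4)) (D (4 * n) (s₀ / 2 - s₀ / 4)) * (6 * C₁ * x ^ 9) := by
          gcongr
          exact le_max_left _ _
      _ = _ := by rw [hcu]; ring
  have hu2 : InWiener (s₀ / 4) (cu / g * x ^ 9) u := by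
    refine (hub g hg (4 * n) fun k _ => (hd1 k).2.trans (hν' k).ge).mono le_rfl ?_
    refine le_trans (b := cu * x ^ 9 / g) (div_le_div_of_nonneg_right ?_ hg.le) (le_of_eq (by ring))
    calc _ ≤ max (D (2 * n) (s₀ / 2 - s₀ / 4)) (D (4 * n) (s₀ / 2 - s₀ / 4)) * (6 * C₁ * x ^ 9) := by
          gcongr
          exact le_max_right _ _
      _ = _ := by rw [hcu]; ring
  have hs4 : 0 < s₀ / 4 := by positivity
  have hF4 : InWiener (s₀ / 4) (6 * C₁ * x ^ 9) F := hFW.mono (by linarith) le_rfl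
  set G : (Fin n → ℝ) → ℂ := fun θ => ε * R θ + -(Complex.I / 2) *
    (starRingEnd ℂ (u θ) * F θ - u θ * starRingEnd ℂ (F θ)) with hG
  have hx8 : x ^ 8 ≤ 1 := pow_le_one₀ hx.le hx1
  have hGW : InWiener (s₀ / 4) (CG * x ^ 9) G := by
    have h1 : InWiener (s₀ / 4) (x ^ 9 * C₁) (fun θ => ε * R θ) :=
      (hR.mono (by linarith) le_rfl).const_mul _ hεn'
    have h2 := (((hu1.conj.mul hF4 hs4.le (by positivity)).sub
      (hu1.mul hF4.conj hs4.le (by positivity)) (by positivity) (by positivity))).const_mul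
      (-(Complex.I / 2)) (r' := 1 / 2) (by simp)
    refine (h1.add h2 (by positivity) (by positivity)).mono le_rfl ?_
    have h3 : cu * x ^ 8 * (6 * C₁ * x ^ 9) ≤ cu * 1 * (6 * C₁ * x ^ 9) := by gcongr
    rw [hCG]
    linarith
  have hGc : ∀ θ, starRingEnd ℂ (G θ) = G θ := fun θ => by
    simp only [hG, map_add, map_mul, map_sub, map_neg, map_div₀, Complex.conj_ofReal, hRc,
      Complex.conj_conj, Complex.conj_I, Complex.conj_ofNat]
    ring
  have h0' : ∀ k : Fin n → ℤ, ‖(dot k ω : ℂ) - 0‖ = |dot k ω| := fun k => by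
    rw [sub_zero, Complex.norm_real, Real.norm_eq_abs]
  have hk0 : ∀ k : Fin n → ℤ, (dot k ω : ℂ) - 0 ≠ 0 → k ≠ 0 := fun k h hk => h (by simp [hk])
  obtain ⟨U, m', hm'n, -, hU, hUb⟩ := hGW.exists_diophantine (s' := s₀ / 8) (by positivity)
    (by linarith) (by positivity) ω 0 hx (fun k hk h => by
      have h1 := (hd0 k hk).1
      rw [← h0', h, norm_zero] at h1
      have := l1_nonneg k
      have : 0 < x / (1 + l1 k) ^ (2 * n) := by positivity
      linarith) (fun k hk => (hd0 k (hk0 k hk)).1.trans (h0' k).ge)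
  have hy : ∀ {r : ℝ}, InWiener (s₀ / 8) r U → 0 ≤ r →
      InWiener (s₀ / 8) (2 * r) (fun θ => -(U θ + starRingEnd ℂ (U θ))) := fun h hr =>
    (h.add h.conj hr hr).neg.mono le_rfl (by linarith)
  have hU1 := hUb x hx (2 * n) fun k hk => (hd0 k (hk0 k hk)).1.trans (h0' k).ge
  have hU2 := hUb g hg (4 * n) fun k hk => (hd0 k (hk0 k hk)).2.trans (h0' k).ge
  have e48 : s₀ / 8 ≤ s₀ / 4 := by linarith
  have hD48 : ∀ τ, 0 ≤ D τ (s₀ / 4 - s₀ / 8) := fun τ => hD0 _ _ (by linarith)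
  refine ⟨F, u, fun θ => -(U θ + starRingEnd ℂ (U θ)), m'.re, fun θ => ?_,
    hu1.mono e48 (by gcongr; linarith), hu2.mono e48 (by gcongr; linarith),
    (hy hU1 (by have := hD48 (2 * n); positivity)).mono le_rfl ?_,
    (hy hU2 (by have := hD48 (4 * n); positivity)).mono le_rfl ?_, fun θ => ?_, ?_, fun θ => ?_,
    fun θ => ?_⟩
  · simp only [hF]
    ring
  · rw [← mul_div_assoc, div_le_iff₀ hx]
    calc _ = D (2 * n) (s₀ / 4 - s₀ / 8) * (2 * CG) * x ^ 9 := by simp only [hD]; ring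
      _ ≤ cy * x ^ 9 := by
          rw [hcy]
          gcongr
          exact le_max_left _ _
      _ ≤ (cu + CG + cy + 1) * x ^ 9 := by gcongr; linarith
      _ = _ := by ring
  · rw [← mul_div_assoc]
    refine le_trans (b := (cu + CG + cy + 1) * x ^ 9 / g) (div_le_div_of_nonneg_right ?_ hg.le)
      (le_of_eq (by ring))
    calc _ = D (4 * n) (s₀ / 4 - s₀ / 8) * (2 * CG) * x ^ 9 := by simp only [hD]; ring
      _ ≤ cy * x ^ 9 := by
          rw [hcy]
          gcongr
          exact le_max_right _ _
      _ ≤ (cu + CG + cy + 1) * x ^ 9 := by gcongr; linarith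
  · simp only [map_neg, map_add, Complex.conj_conj]
    ring
  · refine (Complex.abs_re_le_norm _).trans (hm'n.trans ?_)
    gcongr
    linarith
  · rw [hu]
    push_cast
    ring
  · have dU := hU1.hasDerivAt_dir (by positivity) ω θ
    have dy : dir ω (fun θ => -(U θ + starRingEnd ℂ (U θ))) θ =
        -(dir ω U θ + starRingEnd ℂ (dir ω U θ)) := ((dU.add dU.star).neg).deriv
    have em : m' + starRingEnd ℂ m' = 2 * (m'.re : ℂ) := by
      rw [Complex.add_conj]
      push_cast
      rfl
    rw [dy, hU]
    simp only [mul_zero, zero_mul, zero_add, map_sub, hGc]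
    simp only [hG]
    linear_combination Complex.I * em + (starRingEnd ℂ (u θ) * F θ -
      u θ * starRingEnd ℂ (F θ)) * Complex.I_mul_I

end QuasiPeriodic

namespace QuasiPeriodic

open scoped ENNReal

/-- The linear Hamiltonian vector field with coefficients `a, b, c, f₁, f₂, r`. -/
noncomputable def hamMatrix (a b c f₁ f₂ r : ℂ) : Matrix (Fin 2 ⊕ Fin 2) (Fin 2 ⊕ Fin 2) ℂ :=
  Matrix.fromBlocks !![-(b / 2), f₁; 0, 0] !![-c, 0; 0, 0] !![a, f₂; f₂, r] !![b / 2, 0; -f₁, 0]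

/-- The matrix of the reducing change of coordinates. -/
noncomputable def transMatrix (p w u y : ℂ) : Matrix (Fin 2 ⊕ Fin 2) (Fin 2 ⊕ Fin 2) ℂ :=
  Matrix.fromBlocks !![starRingEnd ℂ p, u; 0, 1] !![-(starRingEnd ℂ p * starRingEnd ℂ w), 0; 0, 0]
    !![-(p * w), starRingEnd ℂ u; starRingEnd ℂ u * starRingEnd ℂ p + u * p * w, Complex.I * y]
    !![p, 0; -(starRingEnd ℂ u * starRingEnd ℂ p * starRingEnd ℂ w) - u * p, 1]

theorem hamMatrix_symplectic (a b c f₁ f₂ r : ℂ) :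
    (hamMatrix a b c f₁ f₂ r)ᵀ * Matrix.J (Fin 2) ℂ =
      -(Matrix.J (Fin 2) ℂ * hamMatrix a b c f₁ f₂ r) := by
  rw [hamMatrix, Matrix.J, Matrix.fromBlocks_transpose, Matrix.fromBlocks_multiply,
    Matrix.fromBlocks_multiply, Matrix.fromBlocks_neg]
  congr 1 <;> ext i j <;> fin_cases i <;> fin_cases j <;> simp

theorem transMatrix_symplectic {p w u y : ℂ}
    (h : p * starRingEnd ℂ p * (1 - w * starRingEnd ℂ w) = 1) :
    (transMatrix p w u y)ᵀ * Matrix.J (Fin 2) ℂ * transMatrix p w u y = Matrix.J (Fin 2) ℂ := by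
  rw [transMatrix, Matrix.J, Matrix.fromBlocks_transpose, Matrix.fromBlocks_multiply,
    Matrix.fromBlocks_multiply]
  congr 1 <;> ext i j <;> fin_cases i <;> fin_cases j <;>
    simp [Matrix.mul_apply, Fin.sum_univ_two]
  all_goals first
    | ring1
    | linear_combination h
    | linear_combination -h

theorem isRealState_iff (z : PhaseSpace) : IsRealState z ↔
    starRingEnd ℂ (z (Sum.inl 0)) = z (Sum.inr 0) ∧
    starRingEnd ℂ (z (Sum.inl 1)) = z (Sum.inl 1) ∧
    starRingEnd ℂ (z (Sum.inr 1)) = z (Sum.inl 1) - z (Sum.inr 1) := by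
  unfold IsRealState
  rw [funext_iff]
  simp only [Sum.forall, Fin.forall_fin_two, realInvolution, Sum.elim_inl, Sum.elim_inr,
    Matrix.cons_val_zero, Matrix.cons_val_one]
  constructor
  · rintro ⟨⟨h1, h2⟩, h3, h4⟩
    refine ⟨h3, h2, ?_⟩
    rw [map_sub, h2] at h4
    linear_combination -h4
  · rintro ⟨h1, h2, h3⟩
    refine ⟨⟨by rw [← h1, Complex.conj_conj], h2⟩, h1, ?_⟩
    rw [map_sub, h2, h3]
    ring

theorem transMatrix_isRealState {p w u y : ℂ} (hy : starRingEnd ℂ y = y) {z : PhaseSpace}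
    (hz : IsRealState z) : IsRealState (transMatrix p w u y *ᵥ z) := by
  rw [isRealState_iff] at hz ⊢
  obtain ⟨h1, h2, h3⟩ := hz
  have h1' : starRingEnd ℂ (z (Sum.inr 0)) = z (Sum.inl 0) := by rw [← h1, Complex.conj_conj]
  simp only [transMatrix, Matrix.mulVec, dotProduct, Fintype.sum_sum_type, Fin.sum_univ_two,
    Matrix.fromBlocks_apply₁₁, Matrix.fromBlocks_apply₁₂, Matrix.fromBlocks_apply₂₁,
    Matrix.fromBlocks_apply₂₂, Matrix.of_apply, Matrix.cons_val', Matrix.cons_val_zero,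
    Matrix.cons_val_one, Matrix.cons_val_fin_one, map_add, map_mul, map_sub, map_neg, map_zero,
    map_one, Complex.conj_conj, h1, h2, h3, h1', hy, Complex.conj_I]
  refine ⟨by ring, by ring, by ring⟩

section Linear

variable {ι : Type*} [Fintype ι]

theorem hasDerivAt_mulVec {M L L' : ℝ → Matrix ι ι ℂ} {z : ℝ → ι → ℂ} {t : ℝ}
    (hM : ∀ i j, HasDerivAt (fun t => M t i j) ((L' t * M t - M t * L t) i j) t)
    (hz : ∀ i, HasDerivAt (fun t => z t i) ((L t *ᵥ z t) i) t) (i : ι) :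
    HasDerivAt (fun t => (M t *ᵥ z t) i) ((L' t *ᵥ (M t *ᵥ z t)) i) t := by
  have h : HasDerivAt (fun t => ∑ j, M t i j * z t j)
      (∑ j, ((L' t * M t - M t * L t) i j * z t j + M t i j * (L t *ᵥ z t) j)) t :=
    HasDerivAt.fun_sum fun j _ => (hM i j).mul (hz j)
  refine h.congr_deriv ?_
  rw [Finset.sum_add_distrib]
  change ((L' t * M t - M t * L t) *ᵥ z t) i + (M t *ᵥ (L t *ᵥ z t)) i = _
  rw [← Pi.add_apply, Matrix.sub_mulVec, ← Matrix.mulVec_mulVec, ← Matrix.mulVec_mulVec,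
    sub_add_cancel]

/-- A symplectic change of coordinates conjugates two linear Hamiltonian vector fields. -/
theorem conjugates_of_hasDerivAt {l : Type*} [Fintype l] [DecidableEq l]
    {M L L' : ℝ → Matrix (l ⊕ l) (l ⊕ l) ℂ}
    (hM : ∀ t i j, HasDerivAt (fun t => M t i j) ((L' t * M t - M t * L t) i j) t)
    (hL : ∀ t, (L t)ᵀ * Matrix.J l ℂ = -(Matrix.J l ℂ * L t))
    (hL' : ∀ t, (L' t)ᵀ * Matrix.J l ℂ = -(Matrix.J l ℂ * L' t))
    (hMs : ∀ t, (M t)ᵀ * Matrix.J l ℂ * M t = Matrix.J l ℂ) (z : ℝ → l ⊕ l → ℂ) :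
    (∀ t i, HasDerivAt (fun t => z t i) ((L t *ᵥ z t) i) t) ↔
      ∀ t i, HasDerivAt (fun t => (M t *ᵥ z t) i) ((L' t *ᵥ (M t *ᵥ z t)) i) t := by
  refine ⟨fun hz t i => hasDerivAt_mulVec (hM t) (hz t) i, fun hz => ?_⟩
  set J := Matrix.J l ℂ with hJdef
  have hJ : J * J = -1 := Matrix.J_squared l ℂ
  set N : ℝ → Matrix (l ⊕ l) (l ⊕ l) ℂ := fun t => -(J * (M t)ᵀ * J) with hN
  have hNM : ∀ t, N t * M t = 1 := fun t => by
    simp only [hN]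
    rw [Matrix.neg_mul, Matrix.mul_assoc J, Matrix.mul_assoc J, hMs, hJ, neg_neg]
  have hNd : ∀ t i j, HasDerivAt (fun t => N t i j) ((L t * N t - N t * L' t) i j) t := by
    intro t i j
    have e : L t * N t - N t * L' t = -(J * (L' t * M t - M t * L t)ᵀ * J) := by
      have h1 : J * (L t)ᵀ = -(L t * J) := by
        have h2 : J * ((L t)ᵀ * J) * J = J * -(J * L t) * J := by rw [hL]
        have h3 : J * ((L t)ᵀ * J) * J = -(J * (L t)ᵀ) := by
          rw [Matrix.mul_assoc, Matrix.mul_assoc, hJ, Matrix.mul_neg, Matrix.mul_one,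
            Matrix.mul_neg]
        have h4 : J * -(J * L t) * J = L t * J := by
          rw [Matrix.mul_neg, ← Matrix.mul_assoc, hJ, neg_one_mul, Matrix.neg_mul, Matrix.neg_mul,
            neg_neg]
        rw [h3, h4] at h2
        rw [← h2, neg_neg]
      rw [Matrix.transpose_sub, Matrix.transpose_mul, Matrix.transpose_mul, Matrix.mul_sub,
        Matrix.sub_mul]
      have h5 : J * ((M t)ᵀ * (L' t)ᵀ) * J = -(J * (M t)ᵀ * J * L' t) := by
        rw [← Matrix.mul_assoc, Matrix.mul_assoc (J * (M t)ᵀ), hL', Matrix.mul_neg,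
          ← Matrix.mul_assoc]
      have h6 : J * ((L t)ᵀ * (M t)ᵀ) * J = -(L t * (J * (M t)ᵀ * J)) := by
        rw [← Matrix.mul_assoc, h1]
        simp only [Matrix.neg_mul, Matrix.mul_assoc]
      rw [h5, h6]
      simp only [hN, Matrix.mul_neg, Matrix.neg_mul]
      abel
    rw [e]
    have h : HasDerivAt (fun t => -∑ k, (∑ m, J i m * M t k m) * J k j)
        (-∑ k, (∑ m, J i m * (L' t * M t - M t * L t) k m) * J k j) t :=
      (HasDerivAt.fun_sum fun k _ => (HasDerivAt.fun_sum fun m _ =>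
        (hM t k m).const_mul (J i m)).mul_const (J k j)).neg
    simpa only [hN, Matrix.neg_apply, Matrix.mul_apply, Matrix.transpose_apply] using h
  intro t i
  have h := hasDerivAt_mulVec (M := N) (z := fun t => M t *ᵥ z t) (hNd t) (hz t) i
  simpa only [Matrix.mulVec_mulVec, hNM, Matrix.one_mulVec, ← Matrix.mul_assoc,
    Matrix.mul_assoc (L t), Matrix.mul_one] using h

end Linear

/-- The derivative of the change of coordinates. -/
theorem hasDerivAt_transMatrix {p w u y : ℝ → ℂ} {a b c f₁ f₂ r : ℂ} {ν c' : ℝ} {t : ℝ}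
    {y' : ℂ} {F : ℂ}
    (hp : HasDerivAt p (p t * (-(b / 2) - c * w t + Complex.I * ν)) t)
    (hw : HasDerivAt w (a + b * w t + c * w t ^ 2) t)
    (hF : F = starRingEnd ℂ (p t) * f₁ - starRingEnd ℂ (p t) * starRingEnd ℂ (w t) * f₂)
    (hu : HasDerivAt u (-(Complex.I * ν) * u t - F) t)
    (hy : HasDerivAt y y' t)
    (hy' : Complex.I * y' = 2 * Complex.I * c' - r -
      (starRingEnd ℂ (u t) * F - u t * starRingEnd ℂ F))
    (ha : starRingEnd ℂ a = -c) (hb : starRingEnd ℂ b = -b) (hf : starRingEnd ℂ f₂ = f₁)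
    (hdet : p t * starRingEnd ℂ (p t) * (1 - w t * starRingEnd ℂ (w t)) = 1)
    (i j : Fin 2 ⊕ Fin 2) :
    HasDerivAt (fun t => transMatrix (p t) (w t) (u t) (y t) i j)
      ((hamMatrix 0 (2 * (Complex.I * ν)) 0 0 0 (2 * Complex.I * c') *
          transMatrix (p t) (w t) (u t) (y t) -
        transMatrix (p t) (w t) (u t) (y t) * hamMatrix a b c f₁ f₂ r) i j) t := by
  have hc : starRingEnd ℂ c = -a := by rw [← neg_neg c, ← ha, map_neg, Complex.conj_conj]
  have hf' : starRingEnd ℂ f₁ = f₂ := by rw [← hf, Complex.conj_conj]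
  have hFc : starRingEnd ℂ F = p t * f₂ - p t * w t * f₁ := by
    rw [hF]
    simp only [map_sub, map_mul, Complex.conj_conj, hf, hf']
  have dp := hp.star
  have dw := hw.star
  have du := hu.star
  simp only [Complex.star_def, map_add, map_mul, map_sub, map_neg, map_pow, map_div₀,
    Complex.conj_ofReal, Complex.conj_I, Complex.conj_ofNat, ha, hb, hc, hFc] at dp dw du
  set P := starRingEnd ℂ (p t)
  set W := starRingEnd ℂ (w t)
  set V := starRingEnd ℂ (u t)
  have hent : ∀ M N : Matrix (Fin 2 ⊕ Fin 2) (Fin 2 ⊕ Fin 2) ℂ, (M * N) i j =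
      M i (Sum.inl 0) * N (Sum.inl 0) j + M i (Sum.inl 1) * N (Sum.inl 1) j +
        (M i (Sum.inr 0) * N (Sum.inr 0) j + M i (Sum.inr 1) * N (Sum.inr 1) j) := fun M N => by
    rw [Matrix.mul_apply, Fintype.sum_sum_type, Fin.sum_univ_two, Fin.sum_univ_two]
  rw [Matrix.sub_apply, hent, hent]
  rcases i with i | i <;> rcases j with j | j <;> fin_cases i <;> fin_cases j <;>
    simp only [transMatrix, hamMatrix, Matrix.fromBlocks_apply₁₁, Matrix.fromBlocks_apply₁₂,
      Matrix.fromBlocks_apply₂₁, Matrix.fromBlocks_apply₂₂, Matrix.of_apply, Matrix.cons_val',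
      Matrix.cons_val_zero, Matrix.cons_val_one, Matrix.cons_val_fin_one, Fin.zero_eta, Fin.mk_one,
      Fin.isValue]
  · exact dp.congr_deriv (by ring)
  · exact hu.congr_deriv (by rw [hF]; ring)
  · exact (hasDerivAt_const t (0 : ℂ)).congr_deriv (by ring)
  · exact (hasDerivAt_const t (1 : ℂ)).congr_deriv (by ring)
  · exact (dp.mul dw).neg.congr_deriv (by ring)
  · exact (hasDerivAt_const t (0 : ℂ)).congr_deriv (by ring)
  · exact (hasDerivAt_const t (0 : ℂ)).congr_deriv (by ring)
  · exact (hasDerivAt_const t (0 : ℂ)).congr_deriv (by ring)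
  · exact (hp.mul hw).neg.congr_deriv (by ring)
  · exact du.congr_deriv (by ring)
  · refine ((du.mul dp).add ((hu.mul hp).mul hw)).congr_deriv ?_
    simp only [Pi.mul_apply]
    rw [hF]
    linear_combination -f₂ * hdet
  · refine (hy.const_mul Complex.I).congr_deriv ?_
    rw [hy', hFc, hF]
    ring
  · exact hp.congr_deriv (by ring)
  · exact (hasDerivAt_const t (0 : ℂ)).congr_deriv (by ring)
  · refine (((du.mul dp).mul dw).neg.sub (hu.mul hp)).congr_deriv ?_
    simp only [Pi.mul_apply]
    rw [hF]
    linear_combination f₁ * hdet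
  · exact (hasDerivAt_const t (1 : ℂ)).congr_deriv (by ring)

end QuasiPeriodic

namespace QuasiPeriodic

open scoped ENNReal

section Analytic

variable {n : ℕ}

/-- The real linear form `h ↦ i ⟨k, h⟩`. -/
noncomputable def dotForm (k : Fin n → ℤ) : (Fin n → ℝ) →L[ℝ] ℂ :=
  LinearMap.mkContinuous
    { toFun := fun h => Complex.I * (dot k h : ℂ)
      map_add' := fun x y => by rw [dot_add_right]; push_cast; ring
      map_smul' := fun c x => by rw [dot_smul_right]; simp; ring } (l1 k) fun x => by
    simpa [← Complex.ofReal_mul] using abs_dot_le k x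

theorem dotForm_apply (k : Fin n → ℤ) (h : Fin n → ℝ) :
    dotForm k h = Complex.I * (dot k h : ℂ) := rfl

theorem norm_dotForm_le (k : Fin n → ℤ) : ‖dotForm k‖ ≤ l1 k :=
  LinearMap.mkContinuous_norm_le _ (l1_nonneg k) _

/-- The terms of the Taylor series of a Fourier series. -/
noncomputable def taylorTerm (a : (Fin n → ℤ) → ℂ) (x : Fin n → ℝ) (m : ℕ) (k : Fin n → ℤ) :
    ContinuousMultilinearMap ℝ (fun _ : Fin m => Fin n → ℝ) ℂ :=
  (a k * fchar k x / (m.factorial : ℂ)) •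
    (ContinuousMultilinearMap.mkPiAlgebraFin ℝ m ℂ).compContinuousLinearMap fun _ => dotForm k

theorem taylorTerm_apply (a : (Fin n → ℤ) → ℂ) (x y : Fin n → ℝ) (m : ℕ) (k : Fin n → ℤ) :
    (taylorTerm a x m k fun _ => y) =
      a k * fchar k x * ((dotForm k y) ^ m / (m.factorial : ℂ)) := by
  simp [taylorTerm, List.ofFn_const, smul_eq_mul]
  ring

theorem norm_taylorTerm_le (a : (Fin n → ℤ) → ℂ) (x : Fin n → ℝ) (m : ℕ) (k : Fin n → ℤ) :
    ‖taylorTerm a x m k‖ ≤ ‖a k‖ * (l1 k ^ m / m.factorial) := by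
  rw [taylorTerm, norm_smul, norm_div, norm_mul, norm_fchar, mul_one, Complex.norm_natCast,
    div_mul_eq_mul_div, mul_div_assoc]
  gcongr
  refine (ContinuousMultilinearMap.norm_compContinuousLinearMap_le _ _).trans ?_
  rw [Finset.prod_const, Finset.card_univ, Fintype.card_fin]
  calc _ ≤ 1 * l1 k ^ m := by
        gcongr
        · exact ContinuousMultilinearMap.norm_mkPiAlgebraFin_le.trans_eq (by simp)
        · exact norm_dotForm_le k
    _ = _ := one_mul _

theorem InWiener.analyticOnNhd {s r : ℝ} {F : (Fin n → ℝ) → ℂ} (hF : InWiener s r F)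
    (hs : 0 < s) : AnalyticOnNhd ℝ F Set.univ := by
  obtain ⟨a, ha, hFa⟩ := hF.nonneg_radius
  obtain ⟨hsum, -⟩ := (wnorm_le_iff (le_max_right r 0)).1 ha
  intro x _
  have hpow : ∀ (k : Fin n → ℤ) (m : ℕ), l1 k ^ m / m.factorial * s ^ m ≤ Real.exp (s * l1 k) := by
    intro k m
    have h := Real.pow_div_factorial_le_exp (s * l1 k) (mul_nonneg hs.le (l1_nonneg k)) m
    rwa [mul_pow, mul_comm (s ^ m), mul_div_right_comm] at h
  have hterm : ∀ (m : ℕ) (k : Fin n → ℤ),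
      ‖taylorTerm a x m k‖ * s ^ m ≤ ‖a k‖ * Real.exp (s * l1 k) := fun m k =>
    calc _ ≤ ‖a k‖ * (l1 k ^ m / m.factorial) * s ^ m := by
          gcongr
          exact norm_taylorTerm_le a x m k
      _ = ‖a k‖ * (l1 k ^ m / m.factorial * s ^ m) := by ring
      _ ≤ _ := by
          gcongr
          exact hpow k m
  have hsm : ∀ m, Summable fun k => ‖taylorTerm a x m k‖ := fun m => by
    refine Summable.of_nonneg_of_le (fun _ => norm_nonneg _) (fun k => ?_)
      (hsum.mul_right (s ^ m)⁻¹)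
    rw [← div_eq_mul_inv, le_div_iff₀ (pow_pos hs m)]
    exact hterm m k
  set T : FormalMultilinearSeries ℝ (Fin n → ℝ) ℂ := fun m => ∑' k, taylorTerm a x m k with hT
  have hTn : ∀ m, ‖T m‖ * s ^ m ≤ ∑' k, ‖a k‖ * Real.exp (s * l1 k) := fun m =>
    calc _ ≤ (∑' k, ‖taylorTerm a x m k‖) * s ^ m := by
          gcongr
          exact norm_tsum_le_tsum_norm (hsm m)
      _ = ∑' k, ‖taylorTerm a x m k‖ * s ^ m := tsum_mul_right.symm
      _ ≤ _ := ((hsm m).mul_right _).tsum_le_tsum (hterm m) hsum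
  lift s to NNReal using hs.le
  have hball : HasFPowerSeriesOnBall F T x s := by
    refine ⟨T.le_radius_of_bound _ hTn, by exact_mod_cast hs, fun {y} hy => ?_⟩
    have hy' : ‖y‖ < s := by
      have := Metric.mem_eball.1 hy
      rw [edist_zero_right, ← ofReal_norm, ENNReal.ofReal_lt_coe_iff (norm_nonneg _)] at this
      exact this
    have hexp : ∀ k, HasSum (fun m : ℕ => (dotForm k y) ^ m / (m.factorial : ℂ)) (fchar k y) :=
      fun k => by
        rw [fchar, ← dotForm_apply, Complex.exp_eq_exp_ℂ]
        exact NormedSpace.expSeries_div_hasSum_exp (dotForm k y)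
    have hnexp : ∀ k, HasSum (fun m : ℕ => ‖dotForm k y‖ ^ m / (m.factorial : ℝ))
        (Real.exp ‖dotForm k y‖) := fun k => by
      rw [Real.exp_eq_exp_ℝ]
      exact NormedSpace.expSeries_div_hasSum_exp ‖dotForm k y‖
    have hdot : ∀ k, ‖dotForm k y‖ ≤ s * l1 k := fun k => by
      refine ((dotForm k).le_opNorm y).trans ?_
      rw [mul_comm]
      exact mul_le_mul hy'.le (norm_dotForm_le k) (norm_nonneg _) s.2
    have hprod : Summable fun z : (Fin n → ℤ) × ℕ =>
        a z.1 * fchar z.1 x * ((dotForm z.1 y) ^ z.2 / (z.2.factorial : ℂ)) := by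
      refine Summable.of_norm ?_
      rw [summable_prod_of_nonneg (fun _ => norm_nonneg _)]
      simp only [norm_mul, norm_fchar, mul_one, norm_div, norm_pow, Complex.norm_natCast]
      refine ⟨fun k => (hnexp k).summable.mul_left _, ?_⟩
      simp only [tsum_mul_left, (hnexp _).tsum_eq]
      exact Summable.of_nonneg_of_le (fun _ => by positivity)
        (fun k => mul_le_mul_of_nonneg_left (Real.exp_le_exp.2 (hdot k)) (norm_nonneg _)) hsum
    have h1 : HasSum (fun z : (Fin n → ℤ) × ℕ =>
        a z.1 * fchar z.1 x * ((dotForm z.1 y) ^ z.2 / (z.2.factorial : ℂ))) (F (x + y)) := by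
      have h2 := hprod.hasSum.prod_fiberwise fun k => (hexp k).mul_left (a k * fchar k x)
      have h3 := hFa (x + y)
      simp only [fchar_add_right, ← mul_assoc] at h3
      rw [← h2.unique h3]
      exact hprod.hasSum
    have h4 : HasSum (fun z : ℕ × (Fin n → ℤ) =>
        a z.2 * fchar z.2 x * ((dotForm z.2 y) ^ z.1 / (z.1.factorial : ℂ))) (F (x + y)) :=
      (Equiv.prodComm ℕ (Fin n → ℤ)).hasSum_iff.2 h1
    refine h4.prod_fiberwise fun m => ?_
    have h5 := ContinuousMultilinearMap.hasSum_eval (Summable.of_norm (hsm m)).hasSum fun _ => y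
    simpa only [taylorTerm_apply] using h5
  exact hball.analyticAt

end Analytic

section Log

theorem exists_linearMap_bound {E F : Type*} [NormedAddCommGroup E] [NormedSpace ℝ E]
    [NormedAddCommGroup F] [NormedSpace ℝ F] [FiniteDimensional ℝ E] (f : E →ₗ[ℝ] F) :
    ∃ C > 0, ∀ x, ‖f x‖ ≤ C * ‖x‖ :=
  ⟨‖LinearMap.toContinuousLinearMap f‖ + 1, by positivity, fun x =>
    ((LinearMap.toContinuousLinearMap f).le_opNorm x).trans (by gcongr; linarith)⟩

theorem analyticAt_linearMap_comp {E F V : Type*} [NormedAddCommGroup E] [NormedSpace ℝ E]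
    [NormedAddCommGroup F] [NormedSpace ℝ F] [FiniteDimensional ℝ E] [NormedAddCommGroup V]
    [NormedSpace ℝ V] (L : E →ₗ[ℝ] F) {f : V → E} {x : V} (hf : AnalyticAt ℝ f x) :
    AnalyticAt ℝ (fun x => L (f x)) x :=
  ((LinearMap.toContinuousLinearMap L).analyticAt (f x)).comp hf

theorem exists_log (𝔸 : Type*) [NormedRing 𝔸] [NormedAlgebra ℝ 𝔸] [CompleteSpace 𝔸] :
    ∃ ρ > 0, ∃ δ > 0, ∃ D > 0, ∃ ℓ : 𝔸 → 𝔸, Set.InjOn NormedSpace.exp (Metric.ball (0 : 𝔸) ρ) ∧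
      ∀ M, ‖M - 1‖ < δ → NormedSpace.exp (ℓ M) = M ∧ ‖ℓ M‖ ≤ D * ‖M - 1‖ ∧
        AnalyticAt ℝ ℓ M := by
  have hd : HasStrictFDerivAt (NormedSpace.exp : 𝔸 → 𝔸)
      ((ContinuousLinearEquiv.refl ℝ 𝔸 : 𝔸 ≃L[ℝ] 𝔸) : 𝔸 →L[ℝ] 𝔸) 0 :=
    hasStrictFDerivAt_exp_zero
  set Ψ := hd.toOpenPartialHomeomorph (NormedSpace.exp : 𝔸 → 𝔸) with hΨ
  have hcoe : (Ψ : 𝔸 → 𝔸) = NormedSpace.exp := hd.toOpenPartialHomeomorph_coe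
  have h0 : (0 : 𝔸) ∈ Ψ.source := hd.mem_toOpenPartialHomeomorph_source
  have hΨ0 : Ψ 0 = 1 := by rw [hcoe, NormedSpace.exp_zero]
  have h1 : (1 : 𝔸) ∈ Ψ.target := hΨ0 ▸ Ψ.map_source h0
  have hs1 : Ψ.symm 1 = 0 := by rw [← hΨ0, Ψ.left_inv h0]
  have han : AnalyticAt ℝ Ψ.symm 1 := by
    have h := Ψ.analyticAt_symm' (𝕜 := ℝ) (i := ContinuousLinearEquiv.refl ℝ 𝔸) h0
      (by rw [hcoe]; exact NormedSpace.exp_analytic 0) (by rw [hcoe]; exact hd.hasFDerivAt.fderiv)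
    rwa [hΨ0] at h
  obtain ⟨ρ, hρ, hρs⟩ := Metric.isOpen_iff.1 Ψ.open_source 0 h0
  obtain ⟨D, hD⟩ := han.differentiableAt.isBigO_sub.bound
  obtain ⟨δ, hδ, hδs⟩ := Metric.eventually_nhds_iff.1
    (hD.and (han.eventually_analyticAt.and (Ψ.open_target.mem_nhds h1)))
  refine ⟨ρ, hρ, δ, hδ, max D 1, by positivity, Ψ.symm, ?_, fun M hM => ?_⟩
  · rw [← hcoe]
    exact Ψ.injOn.mono hρs
  · obtain ⟨h2, h3, h4⟩ := hδs (dist_eq_norm M 1 ▸ hM)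
    refine ⟨by rw [← hcoe, Ψ.right_inv h4], ?_, h3⟩
    rw [hs1, sub_zero] at h2
    exact h2.trans (by gcongr; exact le_max_left _ _)

/-- A logarithm of the matrices close to the identity, which maps symplectic matrices to
Hamiltonian ones. -/
theorem exists_symplectic_log (l : Type*) [Fintype l] [DecidableEq l] :
    ∃ δ > 0, ∃ D > 0, ∃ ℓ : Matrix (l ⊕ l) (l ⊕ l) ℂ → Matrix (l ⊕ l) (l ⊕ l) ℂ,
      ∀ (M : Matrix (l ⊕ l) (l ⊕ l) ℂ) (r : ℝ), 0 ≤ r → r < δ → (∀ i j, ‖(M - 1) i j‖ ≤ r) →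
        NormedSpace.exp (ℓ M) = M ∧ (∀ i j, ‖ℓ M i j‖ ≤ D * r) ∧
        (Mᵀ * Matrix.J l ℂ * M = Matrix.J l ℂ → ℓ M ∈ LieAlgebra.Symplectic.sp l ℂ) ∧
        ∀ {V : Type} [NormedAddCommGroup V] [NormedSpace ℝ V]
          (G : V → Matrix (l ⊕ l) (l ⊕ l) ℂ) (x : V), G x = M →
          (∀ i j, AnalyticAt ℝ (fun x => G x i j) x) →
          ∀ i j, AnalyticAt ℝ (fun x => ℓ (G x) i j) x := by
  open scoped Matrix.Norms.Operator in
  obtain ⟨ρ, hρ, δ, hδ, D, hD, ℓ, hinj, hℓ⟩ := exists_log (Matrix (l ⊕ l) (l ⊕ l) ℂ)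
  set J := Matrix.J l ℂ with hJdef
  have hJ : J * J = -1 := Matrix.J_squared l ℂ
  obtain ⟨B, hB, hBX⟩ := exists_linearMap_bound
    (Matrix.ofLinearEquiv ℝ).symm.toLinearMap (E := Matrix (l ⊕ l) (l ⊕ l) ℂ)
      (F := l ⊕ l → l ⊕ l → ℂ)
  obtain ⟨S, hS, hSX⟩ := exists_linearMap_bound
    (Matrix.ofLinearEquiv ℝ).toLinearMap (F := Matrix (l ⊕ l) (l ⊕ l) ℂ)
      (E := l ⊕ l → l ⊕ l → ℂ)
  let τ : Matrix (l ⊕ l) (l ⊕ l) ℂ →ₗ[ℝ] Matrix (l ⊕ l) (l ⊕ l) ℂ :=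
    { toFun := fun X => J * Xᵀ * J
      map_add' := fun X Y => by rw [Matrix.transpose_add, Matrix.mul_add, Matrix.add_mul]
      map_smul' := fun c X => by simp }
  have hτ : ∀ X, τ X = J * Xᵀ * J := fun X => rfl
  obtain ⟨T, hT, hTX⟩ := exists_linearMap_bound τ
  have hentry : ∀ i j (X : Matrix (l ⊕ l) (l ⊕ l) ℂ), ‖X i j‖ ≤ B * ‖X‖ := fun i j X =>
    ((norm_le_pi_norm (X i) j).trans
      (norm_le_pi_norm ((Matrix.ofLinearEquiv ℝ).symm X) i)).trans (hBX X)
  have hnorm : ∀ (X : Matrix (l ⊕ l) (l ⊕ l) ℂ) (r : ℝ), 0 ≤ r → (∀ i j, ‖X i j‖ ≤ r) →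
      ‖X‖ ≤ S * r := fun X r hr hX =>
    (hSX (fun i j => X i j)).trans (mul_le_mul_of_nonneg_left
      ((pi_norm_le_iff_of_nonneg hr).2 fun i => (pi_norm_le_iff_of_nonneg hr).2 (hX i)) hS.le)
  refine ⟨min (δ / S) (ρ / ((T + 1) * (D * S))), by positivity, B * (D * S), by positivity, ℓ,
    fun M r hr0 hr hM => ?_⟩
  have hM1 : ‖M - 1‖ ≤ S * r := hnorm _ r hr0 hM
  have hMδ : ‖M - 1‖ < δ := by
    have h := (lt_div_iff₀ hS).1 (hr.trans_le (min_le_left _ _))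
    linarith
  obtain ⟨hexp, hle, han⟩ := hℓ M hMδ
  have hℓr : ‖ℓ M‖ ≤ D * (S * r) := hle.trans (by gcongr)
  have hsmall : (T + 1) * ‖ℓ M‖ < ρ := by
    have h := (lt_div_iff₀ (by positivity)).1 (hr.trans_le (min_le_right _ _))
    calc _ ≤ (T + 1) * (D * (S * r)) := by gcongr
      _ < ρ := by linarith
  refine ⟨hexp, fun i j => ?_, fun hMs => ?_, ?_⟩
  · calc _ ≤ B * ‖ℓ M‖ := hentry i j _
      _ ≤ B * (D * (S * r)) := by gcongr
      _ = _ := by ring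
  · have hJu : IsUnit J := IsUnit.of_mul_eq_one (-J) (by rw [Matrix.mul_neg, hJ, neg_neg])
    have hJi : J⁻¹ = -J := Matrix.inv_eq_right_inv (by rw [Matrix.mul_neg, hJ, neg_neg])
    have hτe : τ (ℓ M) = J⁻¹ * -(ℓ M)ᵀ * J := by
      rw [hτ, hJi, neg_mul_neg]
    have hexpτ : NormedSpace.exp (τ (ℓ M)) = M := by
      have hexpT : NormedSpace.exp (ℓ M)ᵀ = Mᵀ :=
        (Matrix.exp_transpose _).trans (congr_arg Matrix.transpose hexp)
      rw [hτe, Matrix.exp_conj' _ _ hJu, Matrix.exp_neg, hexpT]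
      have hdet : IsUnit (Mᵀ).det := by
        have h := congr_arg Matrix.det hMs
        rw [Matrix.det_mul, Matrix.det_mul] at h
        have hJd : IsUnit J.det := (Matrix.isUnit_iff_isUnit_det J).1 hJu
        rw [← h] at hJd
        exact (IsUnit.mul_iff.1 (IsUnit.mul_iff.1 hJd).1).1
      have hJM : J * M = (Mᵀ)⁻¹ * J := by
        conv_rhs => rw [← hMs]
        rw [Matrix.mul_assoc Mᵀ, Matrix.nonsing_inv_mul_cancel_left _ _ hdet]
      rw [Matrix.mul_assoc, ← hJM, hJi, ← Matrix.mul_assoc, Matrix.neg_mul, hJ, neg_neg,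
        Matrix.one_mul]
    have hfix : τ (ℓ M) = ℓ M := by
      refine hinj ?_ ?_ (hexpτ.trans hexp.symm) <;> rw [mem_ball_zero_iff]
      · exact (hTX _).trans_lt (by nlinarith [norm_nonneg (ℓ M)])
      · nlinarith [norm_nonneg (ℓ M)]
    rw [LieAlgebra.Symplectic.sp, mem_skewAdjointMatricesLieSubalgebra,
      mem_skewAdjointMatricesSubmodule]
    change (ℓ M)ᵀ * J = J * -(ℓ M)
    conv_rhs => rw [← hfix, hτ]
    rw [Matrix.mul_neg, Matrix.mul_assoc, ← Matrix.mul_assoc J J, hJ, Matrix.neg_mul,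
      Matrix.one_mul, neg_neg]
  · intro V _ _ G x hG hGa i j
    have hGan : AnalyticAt ℝ G x :=
      analyticAt_linearMap_comp (Matrix.ofLinearEquiv ℝ).toLinearMap
        (F := Matrix (l ⊕ l) (l ⊕ l) ℂ) (f := fun x i j => G x i j)
        (analyticAt_pi_iff.2 fun i => analyticAt_pi_iff.2 (hGa i))
    have h := analyticAt_linearMap_comp (Matrix.ofLinearEquiv ℝ).symm.toLinearMap
      (E := Matrix (l ⊕ l) (l ⊕ l) ℂ) (F := l ⊕ l → l ⊕ l → ℂ)
      (AnalyticAt.comp (g := ℓ) (hG ▸ han) hGan)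
    exact analyticAt_pi_iff.1 (analyticAt_pi_iff.1 h i) j

end Log

end QuasiPeriodic

namespace QuasiPeriodic

open scoped ENNReal

section Fourier

open MeasureTheory

attribute [local instance] instMeasureSpaceUnitAddCircle

instance : (volume : Measure UnitAddCircle).IsAddHaarMeasure :=
  inferInstanceAs (AddCircle.haarAddCircle (T := 1)).IsAddHaarMeasure

variable {n : ℕ}

/-- The unit box `(0, 1]ⁿ`. -/
def unitBox (n : ℕ) : Set (Fin n → ℝ) := {x | ∀ i, x i ∈ Set.Ioc (0 : ℝ) (0 + 1)}

/-- The projection of `ℝⁿ` onto the torus. -/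
def torusMk (x : Fin n → ℝ) : UnitAddTorus (Fin n) := fun i => (x i : UnitAddCircle)

theorem torusMk_isOpenQuotientMap : IsOpenQuotientMap (torusMk (n := n)) :=
  IsOpenQuotientMap.piMap fun _ => QuotientAddGroup.isOpenQuotientMap_mk

theorem exists_torus_lift {E : Type*} {g : (Fin n → ℝ) → E}
    (hg : ∀ x (m : Fin n → ℤ), g (x + fun j => (m j : ℝ)) = g x) :
    ∃ G : UnitAddTorus (Fin n) → E, ∀ x, G (torusMk x) = g x := by
  have hsurj := (torusMk_isOpenQuotientMap (n := n)).surjective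
  refine ⟨fun t => g (Function.surjInv hsurj t), fun x => ?_⟩
  have h := Function.surjInv_eq hsurj (torusMk x)
  set x' := Function.surjInv hsurj (torusMk x)
  have h1 : ∀ j, ∃ m : ℤ, (m : ℝ) = x' j - x j := fun j => by
    have h2 : ((x' j - x j : ℝ) : UnitAddCircle) = 0 := by
      rw [AddCircle.coe_sub, sub_eq_zero]
      exact congr_fun h j
    obtain ⟨m, hm⟩ := (AddCircle.coe_eq_zero_iff (1 : ℝ)).1 h2
    exact ⟨m, by simpa using hm⟩
  choose m hm using h1
  have h3 : x' = x + fun j => (m j : ℝ) := by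
    ext j
    simp [hm]
  change g x' = g x
  rw [h3, hg]

theorem continuous_of_comp_torusMk {E : Type*} [TopologicalSpace E] {G : UnitAddTorus (Fin n) → E}
    {g : (Fin n → ℝ) → E} (hG : ∀ x, G (torusMk x) = g x) (hg : Continuous g) : Continuous G :=
  (torusMk_isOpenQuotientMap.continuous_comp_iff).1 ((funext hG : G ∘ torusMk = g) ▸ hg)

theorem setIntegral_unitBox_add {g : (Fin n → ℝ) → ℂ}
    (hg : ∀ x (m : Fin n → ℤ), g (x + fun j => (m j : ℝ)) = g x) (v : Fin n → ℝ) :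
    ∫ x in unitBox n, g (x + v) = ∫ x in unitBox n, g x := by
  obtain ⟨G, hG⟩ := exists_torus_lift hg
  have h1 := UnitAddTorus.integral_preimage G fun _ => 0
  have h2 := UnitAddTorus.integral_preimage (fun t => G (t + torusMk v)) fun _ => 0
  have h3 : ∫ t, G (t + torusMk v) = ∫ t, G t := integral_add_right_eq_self G (torusMk v)
  rw [h1, h2] at h3
  simp only [← hG]
  exact h3

/-- The point `2 π x + z y` of `ℂⁿ`. -/
noncomputable def linePoint (x y : Fin n → ℝ) (z : ℂ) : Fin n → ℂ :=
  fun j => ((2 * Real.pi * x j : ℝ) : ℂ) + z * (y j : ℂ)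

theorem continuous_linePoint (y : Fin n → ℝ) :
    Continuous fun p : (Fin n → ℝ) × ℂ => linePoint p.1 y p.2 := by
  unfold linePoint
  fun_prop

theorem linePoint_mem {σ : ℝ} {y : Fin n → ℝ} {z : ℂ} (h : ∀ j, |z.im| * |y j| ≤ σ)
    (x : Fin n → ℝ) : linePoint x y z ∈ strip n σ := fun j => by
  simpa [linePoint, abs_mul] using h j

theorem hasDerivAt_linePoint (x y : Fin n → ℝ) (z : ℂ) :
    HasDerivAt (linePoint x y) (fun j => (y j : ℂ)) z :=
  hasDerivAt_pi.2 fun j =>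
    (((hasDerivAt_id z).mul_const (y j : ℂ)).const_add
      ((2 * Real.pi * x j : ℝ) : ℂ)).congr_deriv (one_mul _)

theorem unitBox_subset : unitBox n ⊆ Set.Icc 0 1 := fun x hx =>
  ⟨fun j => (hx j).1.le, fun j => by simpa using (hx j).2⟩

theorem measurableSet_unitBox : MeasurableSet (unitBox n) := by
  have : unitBox n = Set.univ.pi fun _ => Set.Ioc (0 : ℝ) (0 + 1) := by
    ext x
    simp [unitBox]
  rw [this]
  exact MeasurableSet.univ_pi fun _ => measurableSet_Ioc

theorem volume_unitBox : volume (unitBox n) = 1 := by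
  have : unitBox n = Set.univ.pi fun _ => Set.Ioc (0 : ℝ) (0 + 1) := by
    ext x
    simp [unitBox]
  rw [this, Real.volume_pi_Ioc]
  simp

/-- The mean value of a holomorphic periodic function does not depend on the imaginary part. -/
theorem setIntegral_shift {σ : ℝ} {Φ : (Fin n → ℂ) → ℂ} (hΦ : AnalyticOnNhd ℂ Φ (strip n σ))
    (hper : ∀ θ ∈ strip n σ, ∀ m : Fin n → ℤ, Φ (θ + fun j => 2 * Real.pi * (m j : ℂ)) = Φ θ)
    {y : Fin n → ℝ} (hy : ∀ j, 3 / 2 * |y j| ≤ σ) :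
    ∫ x in unitBox n, Φ (linePoint x y Complex.I) = ∫ x in unitBox n, Φ (linePoint x y 0) := by
  set U := Metric.ball (0 : ℂ) (3 / 2)
  have him : ∀ z ∈ Metric.closedBall (0 : ℂ) (3 / 2), ∀ j, |z.im| * |y j| ≤ σ := fun z hz j =>
    (mul_le_mul_of_nonneg_right ((Complex.abs_im_le_norm z).trans (mem_closedBall_zero_iff.1 hz))
      (abs_nonneg _)).trans (hy j)
  have hU : ∀ z ∈ U, z ∈ Metric.closedBall (0 : ℂ) (3 / 2) :=
    fun z hz => Metric.ball_subset_closedBall hz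
  have hcont : ∀ z ∈ U, Continuous fun x => Φ (linePoint x y z) := fun z hz =>
    hΦ.continuousOn.comp_continuous ((continuous_linePoint y).comp (Continuous.prodMk_left z))
      fun x => linePoint_mem (him z (hU z hz)) x
  set y' : Fin n → ℂ := fun j => (y j : ℂ)
  have hcont' : ∀ z ∈ U, Continuous fun x => fderiv ℂ Φ (linePoint x y z) y' := fun z hz =>
    (hΦ.fderiv.continuousOn.comp_continuous
      ((continuous_linePoint y).comp (Continuous.prodMk_left z))
      fun x => linePoint_mem (him z (hU z hz)) x).clm_apply continuous_const
  set K := (Set.Icc (0 : Fin n → ℝ) 1) ×ˢ Metric.closedBall (0 : ℂ) (3 / 2)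
  have hK : IsCompact K := isCompact_Icc.prod (isCompact_closedBall _ _)
  have hKc : ContinuousOn (fun p : (Fin n → ℝ) × ℂ => fderiv ℂ Φ (linePoint p.1 y p.2) y') K :=
    (hΦ.fderiv.continuousOn.comp (continuous_linePoint y).continuousOn
      fun p hp => linePoint_mem (him p.2 hp.2) p.1).clm_apply continuousOn_const
  obtain ⟨C, hC⟩ := hK.exists_bound_of_continuousOn hKc
  set h : ℂ → ℂ := fun z => ∫ x in unitBox n, Φ (linePoint x y z) with hh
  have hfin : volume (unitBox n) ≠ ⊤ := by rw [volume_unitBox]; exact ENNReal.one_ne_top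
  have hder : ∀ z ∈ U, HasDerivAt h (∫ x in unitBox n, fderiv ℂ Φ (linePoint x y z) y') z := by
    intro z hz
    refine (hasDerivAt_integral_of_dominated_loc_of_deriv_le (s := U) (bound := fun _ => C)
      (F := fun z x => Φ (linePoint x y z)) (F' := fun z x => fderiv ℂ Φ (linePoint x y z) y')
      (Metric.isOpen_ball.mem_nhds hz) ?_ ?_ (hcont' z hz).aestronglyMeasurable ?_ ?_ ?_).2
    · filter_upwards [Metric.isOpen_ball.mem_nhds hz] with w hw
      exact (hcont w hw).aestronglyMeasurable
    · exact ((hcont z hz).continuousOn.integrableOn_compact isCompact_Icc).mono_set unitBox_subset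
    · exact ae_restrict_of_forall_mem measurableSet_unitBox fun x hx w hw =>
        hC (x, w) ⟨unitBox_subset hx, hU w hw⟩
    · exact integrableOn_const hfin
    · refine Filter.Eventually.of_forall fun x w hw => ?_
      exact (hΦ _ (linePoint_mem (him w (hU w hw)) x)).differentiableAt.hasFDerivAt.comp_hasDerivAt w
        (hasDerivAt_linePoint x y w)
  have htrans : ∀ z ∈ U, ∀ s : ℝ, h (z + s) = h z := by
    intro z hz s
    have h1 := setIntegral_unitBox_add (g := fun x => Φ (linePoint x y z)) (fun x m => by
      rw [← hper _ (linePoint_mem (him z (hU z hz)) x) m]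
      congr 1
      ext j
      simp [linePoint]
      ring) fun j => s * y j / (2 * Real.pi)
    rw [hh]
    simp only
    rw [← h1]
    refine setIntegral_congr_fun measurableSet_unitBox fun x _ => congr_arg Φ ?_
    ext j
    have hpi : (Real.pi : ℂ) ≠ 0 := by exact_mod_cast Real.pi_ne_zero
    simp [linePoint]
    field_simp
    ring
  have hzero : ∀ z ∈ U, deriv h z = 0 := by
    intro z hz
    have h1 : HasDerivAt (fun s : ℂ => h (z + s)) (deriv h z) ((0 : ℝ) : ℂ) := by
      have h2 := (hder z hz).differentiableAt.hasDerivAt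
      rw [← add_zero z] at h2
      simpa using h2.comp_const_add z 0
    have h3 := h1.comp_ofReal
    simp only [htrans z hz] at h3
    exact h3.unique (hasDerivAt_const 0 (h z))
  have hconst := (convex_ball (0 : ℂ) (3 / 2)).is_const_of_fderivWithin_eq_zero (𝕜 := ℂ)
    (f := h) (fun z hz => (hder z hz).differentiableAt.differentiableWithinAt) (fun z hz => by
      rw [fderivWithin_of_isOpen Metric.isOpen_ball hz]
      ext
      simpa using hzero z hz)
    (x := Complex.I) (y := 0) (by simp; norm_num) (by simp)
  exact hconst

theorem periodic_int {σ : ℝ} {f : (Fin n → ℂ) → ℂ}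
    (hper : ∀ θ ∈ strip n σ, ∀ j, f (θ + Pi.single j ((2 * Real.pi : ℝ) : ℂ)) = f θ)
    {θ : Fin n → ℂ} (hθ : θ ∈ strip n σ) (m : Fin n → ℤ) :
    f (θ + fun j => 2 * Real.pi * (m j : ℂ)) = f θ := by
  have hmem : ∀ θ ∈ strip n σ, ∀ m : Fin n → ℤ,
      (θ + fun j => 2 * Real.pi * (m j : ℂ)) ∈ strip n σ := fun θ hθ m j => by
    simpa using hθ j
  let H : AddSubgroup (Fin n → ℤ) :=
    { carrier := {m | ∀ θ ∈ strip n σ, f (θ + fun j => 2 * Real.pi * (m j : ℂ)) = f θ}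
      zero_mem' := fun θ _ => by
        congr 1
        ext j
        simp
      add_mem' := fun {m m'} hm hm' θ hθ => by
        rw [← hm θ hθ, ← hm' _ (hmem θ hθ m)]
        congr 1
        ext j
        simp
        ring
      neg_mem' := fun {m} hm θ hθ => by
        rw [← hm _ (hmem θ hθ (-m))]
        congr 1
        ext j
        simp }
  have hH : ∀ j, Pi.single j 1 ∈ H := fun j θ hθ => by
    rw [← hper θ hθ j]
    congr 1
    ext i
    rcases eq_or_ne i j with rfl | h
    · simp
    · simp [h]
  have hm : m ∈ H := by
    have : m = ∑ j, m j • (Pi.single j 1 : Fin n → ℤ) := by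
      ext i
      simp [Finset.sum_apply, Pi.single_apply]
    rw [this]
    exact H.sum_mem fun j _ => H.zsmul_mem (hH j) _
  exact hm θ hθ

theorem mFourier_torusMk (k : Fin n → ℤ) (x : Fin n → ℝ) :
    UnitAddTorus.mFourier k (torusMk x) = fchar k ((2 * Real.pi) • x) := by
  simp only [UnitAddTorus.mFourier, ContinuousMap.coe_mk, torusMk, fourier_coe_apply]
  rw [← Complex.exp_sum, fchar, dot]
  congr 1
  push_cast
  rw [Finset.mul_sum]
  refine Finset.sum_congr rfl fun j _ => ?_
  simp
  ring

theorem summable_exp_l1 (n : ℕ) {δ : ℝ} (hδ : 0 < δ) :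
    Summable fun k : Fin n → ℤ => Real.exp (-(δ * l1 k)) := by
  have h := ENNReal.summable_toReal (tsum_one_add_l1_ne_top n)
  refine Summable.of_nonneg_of_le (fun _ => (Real.exp_pos _).le) (fun k => ?_)
    (h.mul_left ((2 * n).factorial * Real.exp δ / δ ^ (2 * n)))
  have hl := l1_nonneg k
  rw [ENNReal.toReal_ofReal (by positivity), Real.exp_neg, mul_one_div,
    le_div_iff₀ (by positivity), inv_mul_le_iff₀ (Real.exp_pos _), mul_comm (Real.exp _)]
  exact InWiener.one_add_pow_mul_exp_le hδ (2 * n) hl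

theorem norm_fourier_integral_le {σ M : ℝ} {f : (Fin n → ℂ) → ℂ}
    (hf : AnalyticOnNhd ℂ f (strip n σ)) (hσ : 0 < σ)
    (hper : ∀ θ ∈ strip n σ, ∀ m : Fin n → ℤ, f (θ + fun j => 2 * Real.pi * (m j : ℂ)) = f θ)
    (hM : ∀ x ∈ unitBox n, ∀ y : Fin n → ℝ, (∀ j, |y j| ≤ σ) →
      ‖f (linePoint x y Complex.I)‖ ≤ M) (k : Fin n → ℤ) :
    ‖∫ x in unitBox n, fchar (-k) ((2 * Real.pi) • x) * f (toComplexVec ((2 * Real.pi) • x))‖ ≤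
      M * Real.exp (-(2 * σ / 3 * l1 k)) := by
  obtain ⟨g, hsign, hkg⟩ : ∃ g : Fin n → ℝ, (∀ j, |g j| ≤ 1) ∧ ∀ j, k j * g j = |(k j : ℝ)| :=
    ⟨fun j => (SignType.sign (k j : ℝ) : ℝ), fun j => by
      rcases lt_trichotomy (k j : ℝ) 0 with h | h | h <;> simp [h], fun j => self_mul_sign _⟩
  set y : Fin n → ℝ := fun j => -(2 * σ / 3 * g j) with hy
  have hyσ : ∀ j, 3 / 2 * |y j| ≤ σ := fun j => by
    rw [hy]
    simp only
    rw [abs_neg, abs_mul, abs_of_pos (by positivity)]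
    nlinarith [hsign j]
  set Φ : (Fin n → ℂ) → ℂ := fun θ => Complex.exp (∑ j, -(Complex.I * (k j : ℂ)) * θ j) * f θ
    with hΦ
  have hΦa : AnalyticOnNhd ℂ Φ (strip n σ) := by
    refine fun θ hθ => AnalyticAt.mul ?_ (hf θ hθ)
    refine AnalyticAt.cexp ?_
    exact Finset.analyticAt_fun_sum _ fun j _ => analyticAt_const.mul
      ((ContinuousLinearMap.proj (R := ℂ) (φ := fun _ : Fin n => ℂ) j).analyticAt θ)
  have hΦp : ∀ θ ∈ strip n σ, ∀ m : Fin n → ℤ,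
      Φ (θ + fun j => 2 * Real.pi * (m j : ℂ)) = Φ θ := fun θ hθ m => by
    simp only [hΦ]
    rw [hper θ hθ m]
    congr 1
    have h : ∑ j, -(Complex.I * (k j : ℂ)) * (θ + fun j => 2 * Real.pi * (m j : ℂ)) j =
        ∑ j, -(Complex.I * (k j : ℂ)) * θ j +
          (-∑ j, k j * m j : ℤ) * (2 * Real.pi * Complex.I) := by
      push_cast
      rw [neg_mul, Finset.sum_mul, ← Finset.sum_neg_distrib, ← Finset.sum_add_distrib]
      refine Finset.sum_congr rfl fun j _ => ?_
      simp only [Pi.add_apply]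
      ring
    rw [h, Complex.exp_add, Complex.exp_int_mul_two_pi_mul_I, mul_one]
  have h0 : ∀ x, Φ (linePoint x y 0) =
      fchar (-k) ((2 * Real.pi) • x) * f (toComplexVec ((2 * Real.pi) • x)) := fun x => by
    have h1 : linePoint x y 0 = toComplexVec ((2 * Real.pi) • x) := by
      ext j
      simp [linePoint, toComplexVec]
    rw [h1]
    simp only [hΦ, fchar, dot]
    congr 2
    push_cast
    rw [Finset.mul_sum]
    refine Finset.sum_congr rfl fun j _ => ?_
    simp [toComplexVec]
    ring
  simp only [← h0]
  rw [← setIntegral_shift hΦa hΦp hyσ]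
  have hnorm : ∀ x ∈ unitBox n, ‖Φ (linePoint x y Complex.I)‖ ≤
      M * Real.exp (-(2 * σ / 3 * l1 k)) := fun x hx => by
    simp only [hΦ]
    rw [norm_mul, mul_comm, Complex.norm_exp]
    have he : (∑ j, -(Complex.I * (k j : ℂ)) * linePoint x y Complex.I j).re =
        -(2 * σ / 3 * l1 k) := by
      rw [Complex.re_sum, l1, Finset.mul_sum, ← Finset.sum_neg_distrib]
      refine Finset.sum_congr rfl fun j _ => ?_
      simp [linePoint, hy]
      rw [← hkg]
      ring
    rw [he]
    gcongr
    refine hM x hx y fun j => ?_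
    linarith [hyσ j, abs_nonneg (y j)]
  refine (norm_setIntegral_le_of_norm_le_const (by rw [volume_unitBox]; simp) hnorm).trans ?_
  rw [Measure.real, volume_unitBox]
  simp

/-- A periodic function which is analytic in a strip has exponentially decaying Fourier
coefficients. -/
theorem exists_inWiener {σ s : ℝ} (hσ : 0 < σ) (hsσ : s < 2 * σ / 3) {f : (Fin n → ℂ) → ℂ}
    (hf : AnalyticOnNhd ℂ f (strip n σ))
    (hper : ∀ θ ∈ strip n σ, ∀ j, f (θ + Pi.single j ((2 * Real.pi : ℝ) : ℂ)) = f θ) :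
    ∃ C, InWiener s C fun θ => f (toComplexVec θ) := by
  have hperZ := fun θ hθ m => periodic_int (f := f) hper (θ := θ) hθ m
  obtain ⟨M, hM⟩ : ∃ M, ∀ x ∈ unitBox n, ∀ y : Fin n → ℝ, (∀ j, |y j| ≤ σ) →
      ‖f (linePoint x y Complex.I)‖ ≤ M := by
    have hK : IsCompact ((Set.Icc (0 : Fin n → ℝ) 1) ×ˢ
        (Set.univ.pi fun _ : Fin n => Set.Icc (-σ) σ)) :=
      isCompact_Icc.prod (isCompact_univ_pi fun _ => isCompact_Icc)
    have hc : ContinuousOn (fun p : (Fin n → ℝ) × (Fin n → ℝ) => f (linePoint p.1 p.2 Complex.I))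
        ((Set.Icc (0 : Fin n → ℝ) 1) ×ˢ (Set.univ.pi fun _ : Fin n => Set.Icc (-σ) σ)) := by
      refine hf.continuousOn.comp ?_ fun p hp => linePoint_mem (fun j => ?_) p.1
      · unfold linePoint
        fun_prop
      · have := hp.2 j trivial
        simpa using abs_le.2 this
    obtain ⟨M, hM⟩ := hK.exists_bound_of_continuousOn hc
    exact ⟨M, fun x hx y hy => hM (x, y) ⟨unitBox_subset hx, fun j _ => abs_le.1 (hy j)⟩⟩
  have hreal : ∀ θ : Fin n → ℝ, toComplexVec θ ∈ strip n σ := fun θ j => by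
    simpa [toComplexVec] using hσ.le
  obtain ⟨G, hG⟩ := exists_torus_lift (g := fun x => f (toComplexVec ((2 * Real.pi) • x)))
    fun x m => by
      refine Eq.trans (congr_arg f ?_) (hperZ _ (hreal _) m)
      ext j
      simp [toComplexVec]
      ring
  have hGc : Continuous G := continuous_of_comp_torusMk hG <|
    hf.continuousOn.comp_continuous (by unfold toComplexVec; fun_prop) fun x => hreal _
  have hcoeff : ∀ k, ‖UnitAddTorus.mFourierCoeff G k‖ ≤ M * Real.exp (-(2 * σ / 3 * l1 k)) := by
    intro k
    have h := UnitAddTorus.mFourierCoeff_eq_integral G k fun _ => 0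
    rw [h]
    refine le_trans (le_of_eq ?_) (norm_fourier_integral_le hf hσ hperZ hM k)
    congr 1
    refine integral_congr_ae (Filter.Eventually.of_forall fun x => ?_)
    change UnitAddTorus.mFourier (-k) (torusMk x) • G (torusMk x) = _
    rw [hG, mFourier_torusMk, smul_eq_mul]
  have hsum : Summable fun k => ‖UnitAddTorus.mFourierCoeff G k‖ * Real.exp (s * l1 k) := by
    refine Summable.of_nonneg_of_le (fun _ => by positivity) (fun k => ?_)
      ((summable_exp_l1 n (sub_pos.2 hsσ)).mul_left M)
    refine (mul_le_mul_of_nonneg_right (hcoeff k) (Real.exp_pos _).le).trans_eq ?_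
    rw [mul_assoc, ← Real.exp_add]
    ring_nf
  have hsum0 : Summable fun k => UnitAddTorus.mFourierCoeff G k := by
    refine Summable.of_norm (Summable.of_nonneg_of_le (fun _ => norm_nonneg _) hcoeff ?_)
    exact (summable_exp_l1 n (by positivity)).mul_left M
  refine ⟨_, fun k => UnitAddTorus.mFourierCoeff G k,
    (wnorm_le_iff (tsum_nonneg fun k => by positivity)).2 ⟨hsum, le_rfl⟩, fun θ => ?_⟩
  have h := UnitAddTorus.hasSum_mFourier_series_apply_of_summable (f := ⟨G, hGc⟩) hsum0
    (torusMk ((2 * Real.pi)⁻¹ • θ))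
  have hpi : (2 * Real.pi) • (2 * Real.pi)⁻¹ • θ = θ := by
    rw [smul_smul, mul_inv_cancel₀ (by positivity), one_smul]
  simpa only [ContinuousMap.coe_mk, hG, mFourier_torusMk, hpi, smul_eq_mul] using h

end Fourier

end QuasiPeriodic

namespace QuasiPeriodic

open scoped ENNReal

section Polynomial

open MvPolynomial

/-- The quadratic Hamiltonian with the given coefficients. -/
noncomputable def quadHam (α β γ p₁ p₂ r : ℂ) : MvPolynomial (Fin 2 ⊕ Fin 2) ℂ :=
  C α * X (Sum.inl 0) ^ 2 + C β * (X (Sum.inl 0) * X (Sum.inr 0)) + C γ * X (Sum.inr 0) ^ 2 +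
    C p₁ * (X (Sum.inl 0) * X (Sum.inl 1)) + C p₂ * (X (Sum.inr 0) * X (Sum.inl 1)) +
    C r * X (Sum.inl 1) ^ 2

/-- The exponent of `ξ₁ ^ a * ξ₂ ^ b * η₁ ^ c`. -/
noncomputable def quadExp (a b c : ℕ) : (Fin 2 ⊕ Fin 2) →₀ ℕ :=
  Finsupp.single (Sum.inl 0) a + Finsupp.single (Sum.inl 1) b + Finsupp.single (Sum.inr 0) c

theorem quadExp_inj {a b c a' b' c' : ℕ} :
    quadExp a b c = quadExp a' b' c' ↔ a = a' ∧ b = b' ∧ c = c' := by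
  refine ⟨fun h => ?_, fun ⟨h1, h2, h3⟩ => by rw [h1, h2, h3]⟩
  have h1 := DFunLike.congr_fun h (Sum.inl 0)
  have h2 := DFunLike.congr_fun h (Sum.inl 1)
  have h3 := DFunLike.congr_fun h (Sum.inr 0)
  simp [quadExp] at h1 h2 h3
  exact ⟨h1, h2, h3⟩

theorem monomial_quadExp (a b c : ℕ) (x : ℂ) :
    monomial (quadExp a b c) x =
      C x * (X (Sum.inl 0) ^ a * X (Sum.inl 1) ^ b * X (Sum.inr 0) ^ c) := by
  rw [X_pow_eq_monomial, X_pow_eq_monomial, X_pow_eq_monomial, monomial_mul, monomial_mul,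
    C_mul_monomial, quadExp]
  simp

theorem eq_quadHam {p : MvPolynomial (Fin 2 ⊕ Fin 2) ℂ} (hp : p.IsHomogeneous 2)
    (hv : Sum.inr 1 ∉ p.vars) :
    p = quadHam (p.coeff (quadExp 2 0 0)) (p.coeff (quadExp 1 0 1)) (p.coeff (quadExp 0 0 2))
      (p.coeff (quadExp 1 1 0)) (p.coeff (quadExp 0 1 1)) (p.coeff (quadExp 0 2 0)) := by
  have h : p = monomial (quadExp 2 0 0) (p.coeff (quadExp 2 0 0)) +
      monomial (quadExp 1 0 1) (p.coeff (quadExp 1 0 1)) +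
      monomial (quadExp 0 0 2) (p.coeff (quadExp 0 0 2)) +
      monomial (quadExp 1 1 0) (p.coeff (quadExp 1 1 0)) +
      monomial (quadExp 0 1 1) (p.coeff (quadExp 0 1 1)) +
      monomial (quadExp 0 2 0) (p.coeff (quadExp 0 2 0)) := by
    ext m
    simp only [coeff_add, coeff_monomial]
    by_cases hm : p.coeff m = 0
    · split_ifs <;> simp_all
    · have h1 : m (Sum.inr 1) = 0 := by
        by_contra h
        exact hv ((mem_vars_iff_mem_support _).2 ⟨m, mem_support_iff.2 hm, Finsupp.mem_support_iff.2 h⟩)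
      have h2 : m.degree = 2 := by
        have := hp hm
        rw [Finsupp.degree_eq_weight_one]
        exact this
      have h3 : m (Sum.inl 0) + m (Sum.inl 1) + m (Sum.inr 0) = 2 := by
        rw [Finsupp.degree_eq_sum, Fintype.sum_sum_type, Fin.sum_univ_two, Fin.sum_univ_two] at h2
        omega
      have h4 : m = quadExp (m (Sum.inl 0)) (m (Sum.inl 1)) (m (Sum.inr 0)) := by
        ext i
        rcases i with i | i <;> fin_cases i <;> simp [quadExp, h1]
      have ha : m (Sum.inl 0) ≤ 2 := by omega
      have hb : m (Sum.inl 1) ≤ 2 := by omega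
      have hc : m (Sum.inr 0) ≤ 2 := by omega
      rw [h4]
      clear h4
      generalize m (Sum.inl 0) = a at *
      generalize m (Sum.inl 1) = b at *
      generalize m (Sum.inr 0) = c at *
      interval_cases a <;> interval_cases b <;> interval_cases c <;>
        first
          | omega
          | simp [quadExp_inj]
  conv_lhs => rw [h]
  simp only [monomial_quadExp, quadHam]
  ring

theorem eval_quadHam (α β γ p₁ p₂ r : ℂ) (z : PhaseSpace) :
    eval z (quadHam α β γ p₁ p₂ r) = α * z (Sum.inl 0) ^ 2 + β * (z (Sum.inl 0) * z (Sum.inr 0)) +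
      γ * z (Sum.inr 0) ^ 2 + p₁ * (z (Sum.inl 0) * z (Sum.inl 1)) +
      p₂ * (z (Sum.inr 0) * z (Sum.inl 1)) + r * z (Sum.inl 1) ^ 2 := by
  simp [quadHam]

theorem quadHam_real {α β γ p₁ p₂ r : ℂ}
    (h : ∀ z : PhaseSpace, IsRealState z → (eval z (quadHam α β γ p₁ p₂ r)).im = 0) :
    γ = starRingEnd ℂ α ∧ starRingEnd ℂ β = β ∧ p₂ = starRingEnd ℂ p₁ ∧ starRingEnd ℂ r = r := by
  have h' : ∀ (x : ℂ) (s : ℝ), (α * x ^ 2 + β * (x * starRingEnd ℂ x) +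
      γ * starRingEnd ℂ x ^ 2 + p₁ * (x * (s : ℂ)) +
      p₂ * (starRingEnd ℂ x * (s : ℂ)) + r * (s : ℂ) ^ 2).im = 0 := fun x s => by
    have h1 := h (Sum.elim ![x, (s : ℂ)] ![starRingEnd ℂ x, ((s / 2 : ℝ) : ℂ)])
      ((isRealState_iff _).2 ⟨by simp, by simp, by
        simp only [Sum.elim_inr, Sum.elim_inl, Matrix.cons_val_one,
          Matrix.cons_val_fin_one, Complex.conj_ofReal]
        push_cast
        ring⟩)
    rw [eval_quadHam] at h1
    simpa only [Sum.elim_inr, Sum.elim_inl, Matrix.cons_val_one, Matrix.cons_val_zero,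
      Matrix.cons_val_fin_one] using h1
  have h1 := h' 1 0
  have h2 := h' Complex.I 0
  have h3 := h' (1 + Complex.I) 0
  have h4 := h' 0 1
  have h5 := h' 1 1
  have h6 := h' Complex.I 1
  simp [pow_two] at h1 h2 h3 h4 h5 h6
  refine ⟨?_, ?_, ?_, ?_⟩ <;> apply Complex.ext <;> simp <;> linarith

theorem isHamiltonianTrajectory_quadHam {α β γ p₁ p₂ r : ℝ → ℂ} (z : ℝ → PhaseSpace) :
    IsHamiltonianTrajectory (fun t => quadHam (α t) (β t) (γ t) (p₁ t) (p₂ t) (r t)) z ↔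
      ∀ t i, HasDerivAt (fun t => z t i) ((hamMatrix (2 * Complex.I * α t) (2 * Complex.I * β t)
        (2 * Complex.I * γ t) (-(Complex.I * p₂ t)) (Complex.I * p₁ t) (2 * Complex.I * r t) *ᵥ
          z t) i) t := by
  unfold IsHamiltonianTrajectory
  refine forall_congr' fun t => ?_
  simp only [Sum.forall, Fin.forall_fin_two, hamMatrix, Matrix.mulVec, dotProduct,
    Fintype.sum_sum_type, Fin.sum_univ_two, Matrix.fromBlocks_apply₁₁, Matrix.fromBlocks_apply₁₂,
    Matrix.fromBlocks_apply₂₁, Matrix.fromBlocks_apply₂₂, Matrix.of_apply, Matrix.cons_val',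
    Matrix.cons_val_zero, Matrix.cons_val_one, Matrix.cons_val_fin_one]
  have e1 : -Complex.I * eval (z t) (pderiv (Sum.inr 0)
      (quadHam (α t) (β t) (γ t) (p₁ t) (p₂ t) (r t))) =
      -(2 * Complex.I * β t / 2) * z t (Sum.inl 0) + -(Complex.I * p₂ t) * z t (Sum.inl 1) +
        (-(2 * Complex.I * γ t) * z t (Sum.inr 0) + 0 * z t (Sum.inr 1)) := by
    simp [quadHam, Derivation.leibniz, pderiv_X]
    ring
  have e2 : -Complex.I * eval (z t) (pderiv (Sum.inr 1)
      (quadHam (α t) (β t) (γ t) (p₁ t) (p₂ t) (r t))) =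
      0 * z t (Sum.inl 0) + 0 * z t (Sum.inl 1) +
        (0 * z t (Sum.inr 0) + 0 * z t (Sum.inr 1)) := by
    simp [quadHam, Derivation.leibniz, pderiv_X]
  have e3 : Complex.I * eval (z t) (pderiv (Sum.inl 0)
      (quadHam (α t) (β t) (γ t) (p₁ t) (p₂ t) (r t))) =
      2 * Complex.I * α t * z t (Sum.inl 0) + Complex.I * p₁ t * z t (Sum.inl 1) +
        (2 * Complex.I * β t / 2 * z t (Sum.inr 0) + 0 * z t (Sum.inr 1)) := by
    simp [quadHam, Derivation.leibniz, pderiv_X]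
    ring
  have e4 : Complex.I * eval (z t) (pderiv (Sum.inl 1)
      (quadHam (α t) (β t) (γ t) (p₁ t) (p₂ t) (r t))) =
      Complex.I * p₁ t * z t (Sum.inl 0) + 2 * Complex.I * r t * z t (Sum.inl 1) +
        (- -(Complex.I * p₂ t) * z t (Sum.inr 0) + 0 * z t (Sum.inr 1)) := by
    simp [quadHam, Derivation.leibniz, pderiv_X]
    ring
  rw [e1, e2, e3, e4]
  tauto

theorem normalForm_eq (a c : ℝ) : normalForm a c = quadHam 0 a 0 0 0 c := by
  simp [normalForm, quadHam]

theorem perturbedHamiltonian_eq {n : ℕ} {ν₁ ε : ℝ} {ω : Fin n → ℝ}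
    {q : (Fin n → ℂ) → MvPolynomial (Fin 2 ⊕ Fin 2) ℂ} {t : ℝ} {α β γ p₁ p₂ r : ℂ}
    (h : q (toComplexVec (t • ω)) = quadHam α β γ p₁ p₂ r) :
    perturbedHamiltonian ν₁ q ε ω t =
      quadHam (ε * α) (ν₁ + ε * β) (ε * γ) (ε * p₁) (ε * p₂) (ε * r) := by
  rw [perturbedHamiltonian, h]
  simp only [quadHam, C_add, C_mul]
  ring

/-- The coefficients of a quadratic perturbation. -/
theorem exists_coefficients {n : ℕ} {σ : ℝ} (hσ : 0 < σ)
    {q : (Fin n → ℂ) → MvPolynomial (Fin 2 ⊕ Fin 2) ℂ} (hq : IsQuadraticPerturbation σ q) :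
    ∃ α β p r : (Fin n → ℝ) → ℂ, ∃ C₁ > 0, InWiener (σ / 2) C₁ α ∧ InWiener (σ / 2) C₁ β ∧
      InWiener (σ / 2) C₁ p ∧ InWiener (σ / 2) C₁ r ∧ (∀ θ, starRingEnd ℂ (β θ) = β θ) ∧
      (∀ θ, starRingEnd ℂ (r θ) = r θ) ∧
      ∀ θ, q (toComplexVec θ) = quadHam (α θ) (β θ) (starRingEnd ℂ (α θ)) (p θ)
        (starRingEnd ℂ (p θ)) (r θ) := by
  have hreal : ∀ θ : Fin n → ℝ, toComplexVec θ ∈ strip n σ := fun θ j => by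
    simpa [toComplexVec] using hσ.le
  have hW : ∀ m, ∃ C, InWiener (σ / 2) C fun θ => (q (toComplexVec θ)).coeff m := fun m =>
    exists_inWiener (f := fun θ => (q θ).coeff m) hσ (by linarith) (hq.analytic m)
      fun θ hθ j => by rw [hq.periodic θ hθ j]
  choose C hC using hW
  have hH := fun θ => eq_quadHam (hq.homogeneous _ (hreal θ)) (hq.indep_eta₂ _ (hreal θ))
  have hR := fun θ : Fin n → ℝ => quadHam_real fun z hz => hH θ ▸ hq.real θ z hz
  refine ⟨_, _, _, _, |C (quadExp 2 0 0)| + |C (quadExp 1 0 1)| + |C (quadExp 1 1 0)| +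
    |C (quadExp 0 2 0)| + 1, by positivity, (hC (quadExp 2 0 0)).mono le_rfl ?_,
    (hC (quadExp 1 0 1)).mono le_rfl ?_, (hC (quadExp 1 1 0)).mono le_rfl ?_,
    (hC (quadExp 0 2 0)).mono le_rfl ?_, fun θ => (hR θ).2.1, fun θ => (hR θ).2.2.2, fun θ => ?_⟩
  case refine_5 =>
    conv_lhs => rw [hH θ]
    rw [(hR θ).1, (hR θ).2.2.1]
  all_goals
    have h1 := abs_nonneg (C (quadExp 2 0 0))
    have h2 := abs_nonneg (C (quadExp 1 0 1))
    have h3 := abs_nonneg (C (quadExp 1 1 0))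
    have h4 := abs_nonneg (C (quadExp 0 2 0))
    have h5 := le_abs_self (C (quadExp 2 0 0))
    have h6 := le_abs_self (C (quadExp 1 0 1))
    have h7 := le_abs_self (C (quadExp 1 1 0))
    have h8 := le_abs_self (C (quadExp 0 2 0))
    linarith

end Polynomial

end QuasiPeriodic

namespace QuasiPeriodic

open scoped ENNReal

open MeasureTheory

theorem norm_transMatrix_sub_one_le {p w u y : ℂ} {r : ℝ} (hr : r ≤ 1) (hp : ‖p - 1‖ ≤ r)
    (hw : ‖w‖ ≤ r) (hu : ‖u‖ ≤ r) (hy : ‖y‖ ≤ r) (i j : Fin 2 ⊕ Fin 2) :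
    ‖(transMatrix p w u y - 1) i j‖ ≤ 4 * r := by
  have hr0 : 0 ≤ r := (norm_nonneg _).trans hw
  have hp2 : ‖p‖ ≤ 2 := by
    calc ‖p‖ = ‖(p - 1) + 1‖ := by rw [sub_add_cancel]
      _ ≤ ‖p - 1‖ + ‖(1 : ℂ)‖ := norm_add_le _ _
      _ ≤ 2 := by rw [norm_one]; linarith
  have hpw : ‖p‖ * ‖w‖ ≤ 2 * r := mul_le_mul hp2 hw (norm_nonneg _) (by norm_num)
  have hup : ‖u‖ * ‖p‖ ≤ 2 * r := by
    rw [mul_comm 2]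
    exact mul_le_mul hu hp2 (norm_nonneg _) hr0
  have hupw : ‖u‖ * ‖p‖ * ‖w‖ ≤ 2 * r := by
    calc _ ≤ 2 * r * 1 := mul_le_mul hup (hw.trans hr) (norm_nonneg _) (by positivity)
      _ = _ := mul_one _
  have hpc : ‖starRingEnd ℂ p - 1‖ ≤ r := by
    rw [← map_one (starRingEnd ℂ), ← map_sub, Complex.norm_conj]
    exact hp
  rw [transMatrix, ← Matrix.fromBlocks_one, Matrix.sub_apply]
  rcases i with i | i <;> rcases j with j | j <;> fin_cases i <;> fin_cases j <;>
    simp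
  all_goals first
    | linarith
    | (refine (norm_add_le _ _).trans ?_
       simp only [norm_mul, Complex.norm_conj]
       linarith)
    | (refine (norm_sub_le _ _).trans ?_
       simp only [norm_neg, norm_mul, Complex.norm_conj]
       linarith)

theorem InWiener.analyticOnNhd_transMatrix {n : ℕ} {s r : ℝ} {p w u y : (Fin n → ℝ) → ℂ}
    (hs : 0 < s) (hp : InWiener s r p) (hw : InWiener s r w) (hu : InWiener s r u)
    (hy : InWiener s r y) (i j : Fin 2 ⊕ Fin 2) :
    AnalyticOnNhd ℝ (fun θ => transMatrix (p θ) (w θ) (u θ) (y θ) i j) Set.univ := by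
  have hp' := hp.conj.analyticOnNhd hs
  have hw' := hw.conj.analyticOnNhd hs
  have hu' := hu.conj.analyticOnNhd hs
  replace hp := hp.analyticOnNhd hs
  replace hw := hw.analyticOnNhd hs
  replace hu := hu.analyticOnNhd hs
  replace hy := hy.analyticOnNhd hs
  rcases i with i | i <;> rcases j with j | j <;> fin_cases i <;> fin_cases j <;>
    simp only [transMatrix, Matrix.fromBlocks_apply₁₁, Matrix.fromBlocks_apply₁₂,
      Matrix.fromBlocks_apply₂₁, Matrix.fromBlocks_apply₂₂, Matrix.of_apply, Matrix.cons_val',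
      Matrix.cons_val_zero, Matrix.cons_val_one, Matrix.cons_val_fin_one, Fin.zero_eta, Fin.mk_one,
      Fin.isValue]
  · exact hp'
  · exact hu
  · exact analyticOnNhd_const
  · exact analyticOnNhd_const
  · exact (hp'.mul hw').neg
  · exact analyticOnNhd_const
  · exact analyticOnNhd_const
  · exact analyticOnNhd_const
  · exact (hp.mul hw).neg
  · exact hu'
  · exact (hu'.mul hp').add ((hu.mul hp).mul hw)
  · exact analyticOnNhd_const.mul hy
  · exact hp
  · exact analyticOnNhd_const
  · exact ((hu'.mul hp').mul hw').neg.sub (hu.mul hp)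
  · exact analyticOnNhd_const

/-- The quadratic normal form, with the change of coordinates given by four functions. -/
theorem exists_conjugation (n : ℕ) {ν₁ σ : ℝ} (hν₁ : 0 < ν₁) (hσ : 0 < σ)
    {q : (Fin n → ℂ) → MvPolynomial (Fin 2 ⊕ Fin 2) ℂ} (hq : IsQuadraticPerturbation σ q) :
    ∃ x₀ > (0 : ℝ), x₀ ≤ 1 ∧ ∃ C > (0 : ℝ), ∃ K : (Fin n → ℝ) → ℝ, (∀ ω, 0 < K ω) ∧
      ∀ ε x : ℝ, 0 < x → x ≤ x₀ → |ε| = x ^ 9 →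
      ∃ E : Set (Fin n → ℝ), MeasurableSet E ∧ E ⊆ frequencyBox n ∧
        volume (frequencyBox n \ E) ≤ ENNReal.ofReal (C * x) ∧
        ∀ ω ∈ E, ∃ (p w u y : (Fin n → ℝ) → ℂ) (ν' c r : ℝ), 0 ≤ r ∧ r ≤ C * x ^ 8 ∧
          r ≤ K ω * x ^ 9 ∧
          InWiener (σ / 16) 2 p ∧ InWiener (σ / 16) r (fun θ => p θ - 1) ∧
          InWiener (σ / 16) r w ∧ InWiener (σ / 16) r u ∧ InWiener (σ / 16) r y ∧
          (∀ θ, starRingEnd ℂ (y θ) = y θ) ∧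
          (∀ θ, p θ * starRingEnd ℂ (p θ) * (1 - w θ * starRingEnd ℂ (w θ)) = 1) ∧
          Conjugates (fun t => transMatrix (p (t • ω)) (w (t • ω)) (u (t • ω)) (y (t • ω)))
            (perturbedHamiltonian ν₁ q ε ω) (fun _ => normalForm ν' c) ∧
          |ν' - ν₁| ≤ C * x ^ 9 ∧ |c| ≤ C * x ^ 9 := by
  obtain ⟨α, β₀, P, R, C₁, hC₁, hα, hβ, hP, hR, hβc, hRc, hqe⟩ := exists_coefficients hσ hq
  have hs : 0 < σ / 2 := by positivity
  have h2I : ‖2 * Complex.I‖ ≤ 2 := by simp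
  obtain ⟨x₀, hx₀, hx₀1, C, hC, K, g, hK, hg, hmain⟩ := exists_goodFrequencies n hν₁ hs
    (hα.const_mul _ h2I) (hβ.const_mul _ h2I) (fun θ => by
      rw [map_mul, hβc, map_mul, Complex.conj_I, Complex.conj_ofNat]
      ring)
  obtain ⟨C', hC', hlin⟩ := exists_linearReduction n hs hC₁.le hP hR hRc
  refine ⟨min x₀ (1 / (2 * C)), by positivity, (min_le_left _ _).trans hx₀1, 2 * C + C',
    by positivity, fun ω => 2 * K ω + C' / g ω,
    fun ω => add_pos (mul_pos two_pos (hK ω)) (div_pos hC' (hg ω)), fun ε x hx hxx hε => ?_⟩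
  have hx1 : x ≤ 1 := hxx.trans ((min_le_left _ _).trans hx₀1)
  have hCx : C * x ^ 8 ≤ 1 / 2 := by
    have h1 : x ^ 8 ≤ x := pow_le_of_le_one hx.le hx1 (by norm_num)
    have h2 : x ≤ 1 / (2 * C) := hxx.trans (min_le_right _ _)
    calc _ ≤ C * (1 / (2 * C)) := by gcongr; exact h1.trans h2
      _ = 1 / 2 := by field_simp
  obtain ⟨E, hE, hEb, hEv, hsol⟩ := hmain ε x hx (hxx.trans (min_le_left _ _)) hε
  refine ⟨E, hE, hEb, hEv.trans (ENNReal.ofReal_le_ofReal (by nlinarith)), fun ω hω => ?_⟩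
  obtain ⟨w, Φ, β, S⟩ := hsol ω hω
  have hgω := hg ω
  have hKω := hK ω
  set r := min (C * x ^ 8) (K ω * x ^ 9) with hr
  have hr0 : 0 ≤ r := le_min (by positivity) (by positivity)
  have hr1 : r ≤ 1 / 2 := (min_le_left _ _).trans hCx
  have hw := S.mem_w.inf S.mem_w'
  have hΦ := S.mem_Φ.inf S.mem_Φ'
  have hs4 : 0 < σ / 2 / 2 := by positivity
  obtain ⟨p, hp2, hp, hdet, hdp⟩ := exists_amplitude hs4 hr0 hr1 hw hΦ S.dir_w S.dir_Φ
    (fun θ => by simp) (fun θ => by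
      rw [map_add, map_mul, map_mul, map_mul, map_mul, hβc, Complex.conj_I, Complex.conj_ofReal,
        Complex.conj_ofReal, Complex.conj_ofNat]
      ring)
  have hν : 0 < β.re / 2 := by linarith [S.le_re]
  obtain ⟨F, u, y, c, hF, hu, hu', hy, hy', hyc, hc, hdu, hdy⟩ := hlin ε x (g ω) ω w p (β.re / 2)
    hx hx1 hε hgω hν (hw.mono le_rfl (by linarith)) hp2 S.dio₀ S.dio₁
  have hs16 : 0 < σ / 16 := by positivity
  have hle : σ / 16 ≤ σ / 2 / 2 := by linarith
  have hle' : σ / 16 ≤ σ / 2 / 8 := by linarith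
  set r' := 2 * r + min (C' * x ^ 8) (C' / g ω * x ^ 9) with hr'
  have hm0 : 0 ≤ min (C' * x ^ 8) (C' / g ω * x ^ 9) := le_min (by positivity) (by positivity)
  refine ⟨p, w, u, y, β.re / 2, c, r', by positivity, ?_, ?_, hp2.mono hle le_rfl,
    hp.mono hle (by linarith), hw.mono hle (by linarith), (hu.inf hu').mono hle' (by linarith),
    (hy.inf hy').mono hle' (by linarith), hyc, hdet, ?_, ?_, ?_⟩
  · have h1 := min_le_left (C * x ^ 8) (K ω * x ^ 9)
    have h2 := min_le_left (C' * x ^ 8) (C' / g ω * x ^ 9)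
    rw [hr', hr]
    linarith
  · have h1 := min_le_right (C * x ^ 8) (K ω * x ^ 9)
    have h2 := min_le_right (C' * x ^ 8) (C' / g ω * x ^ 9)
    rw [hr', hr]
    linarith
  · have hline : ∀ {s r : ℝ} {G : (Fin n → ℝ) → ℂ}, InWiener s r G → 0 < s → ∀ t : ℝ,
        HasDerivAt (fun t : ℝ => G (t • ω)) (dir ω G (t • ω)) t := fun hG hs t => by
      simpa using hG.hasDerivAt_line hs ω 0 t
    have hham : perturbedHamiltonian ν₁ q ε ω = fun t : ℝ =>
        quadHam (ε * α (t • ω)) (ν₁ + ε * β₀ (t • ω)) (ε * starRingEnd ℂ (α (t • ω)))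
          (ε * P (t • ω)) (ε * starRingEnd ℂ (P (t • ω))) (ε * R (t • ω)) :=
      funext fun t => perturbedHamiltonian_eq (hqe _)
    intro z
    rw [hham]
    simp only [normalForm_eq]
    rw [isHamiltonianTrajectory_quadHam, isHamiltonianTrajectory_quadHam]
    refine conjugates_of_hasDerivAt (fun t i j => ?_) (fun t => hamMatrix_symplectic _ _ _ _ _ _)
      (fun t => hamMatrix_symplectic _ _ _ _ _ _) (fun t => transMatrix_symplectic (hdet _)) z
    have hpt := hline hp2 hs4 t
    have hwt := hline hw hs4 t
    have hut := hline hu (by positivity) t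
    have hyt := hline hy (by positivity) t
    rw [hdp] at hpt
    rw [S.dir_w] at hwt
    rw [hdu] at hut
    have h := hasDerivAt_transMatrix (p := fun t => p (t • ω)) (w := fun t => w (t • ω))
      (u := fun t => u (t • ω)) (y := fun t => y (t • ω)) (f₁ := -(Complex.I * (ε *
        starRingEnd ℂ (P (t • ω))))) (f₂ := Complex.I * (ε * P (t • ω)))
      (r := 2 * Complex.I * (ε * R (t • ω))) hpt hwt
      (by rw [hF]; ring) hut hyt (by rw [hdy]; ring) (by simp)
      (by
        rw [map_add, map_mul, map_mul, map_mul, map_mul, hβc, Complex.conj_I, Complex.conj_ofReal,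
          Complex.conj_ofReal, Complex.conj_ofNat]
        ring) (by simp) (hdet _) i j
    have e1 : hamMatrix (2 * Complex.I * 0) (2 * Complex.I * ((β.re / 2 : ℝ) : ℂ))
        (2 * Complex.I * 0) (-(Complex.I * 0)) (Complex.I * 0) (2 * Complex.I * (c : ℂ)) =
        hamMatrix 0 (2 * (Complex.I * ((β.re / 2 : ℝ) : ℂ))) 0 0 0 (2 * Complex.I * c) := by
      simp only [mul_zero, neg_zero, mul_assoc]
    have e2 : hamMatrix (2 * Complex.I * (ε * α (t • ω))) (2 * Complex.I * (ν₁ + ε * β₀ (t • ω)))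
        (2 * Complex.I * (ε * starRingEnd ℂ (α (t • ω))))
        (-(Complex.I * (ε * starRingEnd ℂ (P (t • ω))))) (Complex.I * (ε * P (t • ω)))
        (2 * Complex.I * (ε * R (t • ω))) =
        hamMatrix (ε * (2 * Complex.I * α (t • ω)))
          (Complex.I * ((2 * ν₁ : ℝ) : ℂ) + ε * (2 * Complex.I * β₀ (t • ω)))
          (-(ε * starRingEnd ℂ (2 * Complex.I * α (t • ω))))
          (-(Complex.I * (ε * starRingEnd ℂ (P (t • ω))))) (Complex.I * (ε * P (t • ω)))
          (2 * Complex.I * (ε * R (t • ω))) := by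
      congr 1
      · ring
      · push_cast
        ring
      · simp only [map_mul, Complex.conj_I, Complex.conj_ofNat]
        ring
    rw [e1, e2]
    exact h
  · have h1 := (Complex.abs_re_le_norm (β - (2 * ν₁ : ℝ))).trans S.norm_sub_le
    rw [Complex.sub_re, Complex.ofReal_re] at h1
    have h2 : β.re / 2 - ν₁ = (β.re - 2 * ν₁) / 2 := by ring
    rw [h2, abs_div, abs_two]
    have h3 : 0 ≤ C * x ^ 9 := by positivity
    have h4 : 0 ≤ C' * x ^ 9 := by positivity
    linarith
  · have h3 : 0 ≤ C * x ^ 9 := by positivity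
    linarith

end QuasiPeriodic

namespace QuasiPeriodic

open scoped ENNReal

open MeasureTheory

theorem conjugates_zero {n : ℕ} (ν₁ : ℝ) (q : (Fin n → ℂ) → MvPolynomial (Fin 2 ⊕ Fin 2) ℂ)
    (ω : Fin n → ℝ) :
    Conjugates (fun _ => 1) (perturbedHamiltonian ν₁ q 0 ω) (fun _ => normalForm ν₁ 0) := by
  intro z
  have h : perturbedHamiltonian ν₁ q 0 ω = fun _ => normalForm ν₁ 0 := by
    funext t
    simp [perturbedHamiltonian, normalForm]
  simp only [h, Matrix.one_mulVec]

theorem transMatrix_periodic {n : ℕ} {s r r' : ℝ} {p w u y : (Fin n → ℝ) → ℂ}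
    (hp : InWiener s r' p) (hw : InWiener s r w) (hu : InWiener s r u) (hy : InWiener s r y)
    (θ : Fin n → ℝ) (j : Fin n) :
    transMatrix (p (θ + Pi.single j (2 * Real.pi))) (w (θ + Pi.single j (2 * Real.pi)))
      (u (θ + Pi.single j (2 * Real.pi))) (y (θ + Pi.single j (2 * Real.pi))) =
        transMatrix (p θ) (w θ) (u θ) (y θ) := by
  rw [hp.periodic, hw.periodic, hu.periodic, hy.periodic]

end QuasiPeriodic

open QuasiPeriodic

theorem mainTheorem3 (n : ℕ) (ν₁ : ℝ) (hν₁ : 0 < ν₁) (σ : ℝ) (hσ : 0 < σ)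
    (q : (Fin n → ℂ) → MvPolynomial (Fin 2 ⊕ Fin 2) ℂ) (hq : IsQuadraticPerturbation σ q) :
    ∃ εs > (0 : ℝ), ∃ C > (0 : ℝ), ∃ K : (Fin n → ℝ) → ℝ, ∀ ε : ℝ, |ε| < εs →
      ∃ E : Set (Fin n → ℝ), MeasurableSet E ∧ E ⊆ frequencyBox n ∧
        MeasureTheory.volume (frequencyBox n \ E) ≤ ENNReal.ofReal (C * |ε| ^ (1 / 9 : ℝ)) ∧
        ∀ ω ∈ E,
          ∃ (A : (Fin n → ℝ) → Matrix (Fin 2 ⊕ Fin 2) (Fin 2 ⊕ Fin 2) ℂ) (ν' c : ℝ),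
            (∀ θ, A θ ∈ LieAlgebra.Symplectic.sp (Fin 2) ℂ) ∧
            (∀ i j, AnalyticOnNhd ℝ (fun θ => A θ i j) Set.univ) ∧
            (∀ θ j, A (θ + Pi.single j (2 * Real.pi)) = A θ) ∧
            Conjugates (fun t => NormedSpace.exp (A (t • ω)))
              (perturbedHamiltonian ν₁ q ε ω) (fun _ => normalForm ν' c) ∧
            |ν' - ν₁| ≤ C * |ε| ∧ |c| ≤ C * |ε| ∧
            (∀ θ i j, ‖A θ i j‖ ≤ K ω * |ε|) ∧
            (∀ θ i j, ‖A θ i j‖ ≤ C * |ε| ^ (1 / 2 : ℝ)) ∧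
            (∀ θ z, IsRealState z → IsRealState (NormedSpace.exp (A θ) *ᵥ z)) := by
  obtain ⟨δ, hδ, D, hD, ℓ, hℓ⟩ := exists_symplectic_log (Fin 2)
  obtain ⟨x₀, hx₀, hx₀1, C, hC, K, hK, hmain⟩ := exists_conjugation n hν₁ hσ hq
  set x₁ := min x₀ (min (1 / C) (δ / (4 * C))) with hx₁
  have hx₁0 : 0 < x₁ := by positivity
  have hx₁1 : x₁ ≤ 1 := (min_le_left _ _).trans hx₀1
  refine ⟨x₁ ^ 9, by positivity, C + D * (4 * C), by positivity, fun ω => D * (4 * K ω),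
    fun ε hε => ?_⟩
  rcases eq_or_ne ε 0 with rfl | hε0
  · refine ⟨frequencyBox n, MeasurableSet.univ_pi fun _ => measurableSet_Ioc, subset_rfl, by simp,
      fun ω _ => ⟨fun _ => 0, ν₁, 0, fun _ => zero_mem _, fun i j => analyticOnNhd_const,
        fun _ _ => rfl, ?_, by simp, by simp, by simp, by simp, fun θ z hz => ?_⟩⟩
    · simpa only [NormedSpace.exp_zero] using conjugates_zero ν₁ q ω
    · rwa [NormedSpace.exp_zero, Matrix.one_mulVec]
  have hεpos : 0 < |ε| := abs_pos.2 hε0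
  set x := |ε| ^ (1 / 9 : ℝ) with hx
  have hx0 : 0 < x := Real.rpow_pos_of_pos hεpos _
  have hx9 : |ε| = x ^ 9 := by
    rw [hx, ← Real.rpow_natCast, ← Real.rpow_mul hεpos.le]
    norm_num
  have hxx : x < x₁ := lt_of_pow_lt_pow_left₀ 9 hx₁0.le (hx9 ▸ hε)
  have hx1 : x ≤ 1 := hxx.le.trans hx₁1
  obtain ⟨E, hE, hEb, hEv, hsol⟩ := hmain ε x hx0 (hxx.le.trans (min_le_left _ _)) hx9
  refine ⟨E, hE, hEb, hEv.trans (ENNReal.ofReal_le_ofReal (by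
    gcongr
    have : 0 ≤ D * (4 * C) := by positivity
    linarith)), fun ω hω => ?_⟩
  obtain ⟨p, w, u, y, ν', c, r, hr0, hrC, hrK, hp2, hp, hw, hu, hy, hyc, hdet, hconj, hν', hc⟩ :=
    hsol ω hω
  have hx8 : x ^ 8 ≤ x := pow_le_of_le_one hx0.le hx1 (by norm_num)
  have hrx : r ≤ C * x := hrC.trans (by gcongr)
  have hr1 : r ≤ 1 := by
    calc r ≤ C * x := hrx
      _ ≤ C * (1 / C) := by
        gcongr
        exact hxx.le.trans ((min_le_right _ _).trans (min_le_left _ _))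
      _ = 1 := by field_simp
  have hrδ : 4 * r < δ := by
    calc 4 * r ≤ 4 * (C * x) := by gcongr
      _ < 4 * (C * (δ / (4 * C))) := by
        gcongr
        exact hxx.trans_le ((min_le_right _ _).trans (min_le_right _ _))
      _ = δ := by field_simp
  have hs : 0 < σ / 16 := by positivity
  set M : (Fin n → ℝ) → Matrix (Fin 2 ⊕ Fin 2) (Fin 2 ⊕ Fin 2) ℂ :=
    fun θ => transMatrix (p θ) (w θ) (u θ) (y θ) with hM
  have hlog := fun θ => hℓ (M θ) (4 * r) (by positivity) hrδ
    (norm_transMatrix_sub_one_le hr1 (hp.norm_le hs.le hr0 θ) (hw.norm_le hs.le hr0 θ)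
      (hu.norm_le hs.le hr0 θ) (hy.norm_le hs.le hr0 θ))
  have hexp : ∀ θ, NormedSpace.exp (ℓ (M θ)) = M θ := fun θ => (hlog θ).1
  have hCD : C ≤ C + D * (4 * C) := by
    have : 0 ≤ D * (4 * C) := by positivity
    linarith
  refine ⟨fun θ => ℓ (M θ), ν', c, fun θ => (hlog θ).2.2.1 (transMatrix_symplectic (hdet θ)),
    fun i j θ _ => (hlog θ).2.2.2 M θ rfl (fun i j =>
      InWiener.analyticOnNhd_transMatrix hs hp2 (hw.mono le_rfl (by linarith))
        (hu.mono le_rfl (by linarith)) (hy.mono le_rfl (by linarith)) i j θ trivial) i j,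
    fun θ j => congr_arg ℓ (transMatrix_periodic hp2 hw hu hy θ j), ?_, ?_, ?_, fun θ i j => ?_,
    fun θ i j => ?_, fun θ z hz => ?_⟩
  · simp only [hexp]
    exact hconj
  · rw [hx9]
    exact hν'.trans (by gcongr)
  · rw [hx9]
    exact hc.trans (by gcongr)
  · refine ((hlog θ).2.1 i j).trans ?_
    calc D * (4 * r) ≤ D * (4 * (K ω * x ^ 9)) := by gcongr
      _ = D * (4 * K ω) * |ε| := by rw [hx9]; ring
  · refine ((hlog θ).2.1 i j).trans ?_
    have hhalf : x ^ 8 ≤ |ε| ^ (1 / 2 : ℝ) := by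
      rw [hx9, ← Real.rpow_natCast, ← Real.rpow_natCast, ← Real.rpow_mul hx0.le]
      exact Real.rpow_le_rpow_of_exponent_ge hx0 hx1 (by norm_num)
    calc D * (4 * r) ≤ D * (4 * (C * |ε| ^ (1 / 2 : ℝ))) := by
          gcongr
          exact hrC.trans (by gcongr)
      _ = D * (4 * C) * |ε| ^ (1 / 2 : ℝ) := by ring
      _ ≤ (C + D * (4 * C)) * |ε| ^ (1 / 2 : ℝ) := by
          gcongr
          linarith
  · rw [hexp]
    exact transMatrix_isRealState (hyc θ) hz
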